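/- Let $S$ and $\Gamma$ be locally compact, second countable Hausdorff groups, let $S$ act continuously on $\Gamma$ by automorphisms preserving a left Haar measure $\mu$ of $\Gamma$, and form the semidirect product $S\ltimes\Gamma$ (so that $s\gamma s^{-1}$ denotes the action of $s$ on $\gamma$). Let $$1\to U(1)\to \Gamma^\tau\xrightarrow{\;p\;}\Gamma\to 1$$ be a central extension of topological groups, with $\Gamma^\tau$ locally compact, second countable and Hausdorff, and assume that the action of $S$ on $\Gamma$ lifts to a continuous action on $\Gamma^\tau$ by automorphisms fixing $U(1)$ pointwise (so that $S\ltimes\Gamma^\tau$ is a $U(1)$-central extension of $S\ltimes\Gamma$). Give $\Gamma^\tau$ the left Haar measure $d\widehat\gamma$ with push-forward $\mu$ under $p$. Let $L^2_\tau(\Gamma)\subset L^2(\Gamma^\tau)$ be the closed subspace of those $f$ with $f(z^{-1}\widehat\gamma)=z f(\widehat\gamma)$ for all $z\in U(1)$, with the representation of $S\ltimes\Gamma^\tau$ by $$(\rho(s,\widehat\gamma)f)(\widehat\gamma_1)=f(s^{-1}\widehat\gamma_1 s\,\widehat\gamma),$$ and let $S\ltimes\Gamma^\tau$ act on the compact operators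 $\mathbb K=\mathbb K(L^2_\tau(\Gamma))$ by $\mathrm{Ad}(\rho)(T)=\rho T\rho^{-1}$; this action descends to $S\ltimes\Gamma$. Let $X$ be a locally compact Hausdorff space with a continuous action of $S\ltimes\Gamma$ such that $\Gamma$ acts properly. Let $C_0(X\times_\Gamma\mathbb K)$ be the $C^*$-algebra of norm continuous $\Gamma$-equivariant maps $F:X\to\mathbb K$ vanishing at infinity in $X/\Gamma$, with the $S$-action $(s\cdot F)(x)=\mathrm{Ad}(\rho(s))(F(s^{-1}x))$. Let $\Gamma\ltimes_\tau C_0(X)$ be the twisted crossed product, i.e. the norm closure, in the maximal crossed product $\Gamma^\tau\ltimes C_0(X)$ ($\Gamma^\tau$ acting through $p$), of the functions $a\in C_c(\Gamma^\tau,C_0(X))$ with $a(z^{-1}\widehat\gamma)=z\,a(\widehat\gamma)$ for all $z\in U(1)$, with the $S$-action extending $(s\cdot a)(\widehat\gamma)=s.a(s^{-1}\widehat\gamma s)$. Then both actions of $S$ are strongly continuous, i.e. $\Gamma\ltimes_\tau C_0(X)$ and $C_0(X\times_\Gamma\mathbb K)$ are $S$-$C^*$-algebras, and there is an $S$-equivariant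 $*$-isomorphism $$\Phi:\Gamma\ltimes_\tau C_0(X)\;\xrightarrow{\ \sim\ }\;C_0(X\times_\Gamma\mathbb K).$$ It is the restriction of Rieffel's map: for $a\in C_c(\Gamma^\tau,C_0(X))$ with $a(z^{-1}\widehat\gamma)=z\,a(\widehat\gamma)$, every $x\in X$ and every $f\in L^2_\tau(\Gamma)$, $$(\Phi(a)(x)f)(\widehat\gamma_1)=\int_{\Gamma^\tau}a(\widehat\gamma;\,p(\widehat\gamma_1)x)\,f(\widehat\gamma^{-1}\widehat\gamma_1)\,d\widehat\gamma\qquad\text{for almost every }\widehat\gamma_1.$$ -/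

import Mathlib

open MeasureTheory Topology Filter
open scoped ENNReal NNReal CompactlySupported ZeroAtInfty

universe u v

noncomputable section

set_option linter.unusedSectionVars false

/-! ### Full crossed products -/

/-- A bundled complex Hilbert space. -/
structure HilbertSpaceBundle : Type (u + 1) where
  carrier : Type u
  [normed : NormedAddCommGroup carrier]
  [inner : InnerProductSpace ℂ carrier]
  [complete : CompleteSpace carrier]

attribute [instance] HilbertSpaceBundle.normed HilbertSpaceBundle.inner
  HilbertSpaceBundle.complete

/-- A covariant pair `(π, u)` of the system `α : G → Aut A` on a Hilbert space `H`: a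
`*`-representation `π` of `A` and a strongly continuous unitary representation `u` of `G` with
`u(g) π(a) u(g)* = π(α_g a)`. -/
@[ext]
structure CovariantPair {G A : Type*} [Group G] [TopologicalSpace G] [NonUnitalCStarAlgebra A]
    (α : G →* (A ≃⋆ₐ[ℂ] A)) (H : Type*) [NormedAddCommGroup H] [InnerProductSpace ℂ H]
    [CompleteSpace H] where
  π : A →⋆ₙₐ[ℂ] (H →L[ℂ] H)
  u : G →* unitary (H →L[ℂ] H)
  continuous_u : ∀ ξ : H, Continuous fun g => (u g : H →L[ℂ] H) ξ
  covariant : ∀ g a,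
    (u g : H →L[ℂ] H) * π a * star (u g : H →L[ℂ] H) = π (α g a)

namespace CovariantPair

variable {G A : Type*} [Group G] [TopologicalSpace G] [NonUnitalCStarAlgebra A]
  {α : G →* (A ≃⋆ₐ[ℂ] A)} {H : Type*} [NormedAddCommGroup H] [InnerProductSpace ℂ H]
  [CompleteSpace H]

theorem norm_u_apply (c : CovariantPair α H) (g : G) (ξ : H) :
    ‖(c.u g : H →L[ℂ] H) ξ‖ = ‖ξ‖ := by
  have h := (ContinuousLinearMap.norm_map_iff_adjoint_comp_self (c.u g : H →L[ℂ] H)).2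
    (Unitary.star_mul_self_of_mem (c.u g).2)
  exact h ξ

variable [MeasurableSpace G] [BorelSpace G] (ν : Measure G) [IsFiniteMeasureOnCompacts ν]

theorem integrable_norm (f : C_c(G, A)) : Integrable (fun g => ‖f g‖) ν :=
  (f.continuous.norm).integrable_of_hasCompactSupport f.hasCompactSupport.norm

theorem continuous_integrand (c : CovariantPair α H) (f : C_c(G, A)) (ξ : H) :
    Continuous fun g => c.π (f g) ((c.u g : H →L[ℂ] H) ξ) :=
  (((AddMonoidHomClass.continuous_of_bound c.π 1 fun a => by
    simpa using NonUnitalStarAlgHom.norm_apply_le c.π a).comp f.continuous)).clm_apply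
    (c.continuous_u ξ)

theorem norm_integrand_le (c : CovariantPair α H) (f : C_c(G, A)) (ξ : H) (g : G) :
    ‖c.π (f g) ((c.u g : H →L[ℂ] H) ξ)‖ ≤ ‖f g‖ * ‖ξ‖ := by
  refine ((c.π (f g)).le_opNorm _).trans ?_
  rw [c.norm_u_apply]
  gcongr
  exact NonUnitalStarAlgHom.norm_apply_le _ _

theorem integrable_integrand (c : CovariantPair α H) (f : C_c(G, A)) (ξ : H) :
    Integrable (fun g => c.π (f g) ((c.u g : H →L[ℂ] H) ξ)) ν := by
  refine (c.continuous_integrand f ξ).integrable_of_hasCompactSupport ?_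
  refine f.hasCompactSupport.mono fun g hg => ?_
  contrapose! hg
  simp only [Function.mem_support, ne_eq, not_not] at hg ⊢
  simp [hg]

/-- The integrated form `∫ π(f(g)) u(g) dν(g)` of a covariant pair, the integral being taken in
the strong operator topology. -/
def integratedForm (c : CovariantPair α H) (f : C_c(G, A)) : H →L[ℂ] H :=
  LinearMap.mkContinuous
    { toFun := fun ξ => ∫ g, c.π (f g) ((c.u g : H →L[ℂ] H) ξ) ∂ν
      map_add' := fun ξ η => by
        simp only [map_add]
        exact integral_add (c.integrable_integrand ν f ξ) (c.integrable_integrand ν f η)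
      map_smul' := fun k ξ => by
        simp only [map_smul, RingHom.id_apply]
        exact integral_smul _ _ }
    (∫ g, ‖f g‖ ∂ν) fun ξ => by
      refine (norm_integral_le_of_norm_le ((integrable_norm ν f).mul_const ‖ξ‖)
        (Eventually.of_forall fun g => c.norm_integrand_le f ξ g)).trans ?_
      rw [integral_mul_const]

theorem integratedForm_apply (c : CovariantPair α H) (f : C_c(G, A)) (ξ : H) :
    c.integratedForm ν f ξ = ∫ g, c.π (f g) ((c.u g : H →L[ℂ] H) ξ) ∂ν := rfl

theorem norm_integratedForm_le (c : CovariantPair α H) (f : C_c(G, A)) :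
    ‖c.integratedForm ν f‖ ≤ ∫ g, ‖f g‖ ∂ν :=
  LinearMap.mkContinuous_norm_le _ (integral_nonneg fun _ => norm_nonneg _) _

end CovariantPair

section CrossedProduct

variable {G A : Type u} [Group G] [TopologicalSpace G] [NonUnitalCStarAlgebra A]
  (α : G →* (A ≃⋆ₐ[ℂ] A))

/-- The `C*`-algebra of all bounded families `(T_c)` of operators, indexed by all covariant pairs
`c` (on all Hilbert spaces in the universe of `G` and `A`), with the supremum norm. -/
def UniversalAlgebra : Type (u + 1) :=
  lp (fun c : Σ H : HilbertSpaceBundle.{u}, CovariantPair α H.carrier =>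
    c.1.carrier →L[ℂ] c.1.carrier) ∞

namespace UniversalAlgebra

instance : NonUnitalCStarAlgebra (UniversalAlgebra α) :=
  inferInstanceAs (NonUnitalCStarAlgebra
    (lp (fun c : Σ H : HilbertSpaceBundle.{u}, CovariantPair α H.carrier =>
      c.1.carrier →L[ℂ] c.1.carrier) ∞))

variable {α}

/-- The component of a bounded family at a covariant pair. -/
def eval (T : UniversalAlgebra α) {H : HilbertSpaceBundle.{u}} (c : CovariantPair α H.carrier) :
    H.carrier →L[ℂ] H.carrier :=
  T.1 ⟨H, c⟩

/-- The bounded family with given components. -/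
def mk (T : ∀ H : HilbertSpaceBundle.{u}, CovariantPair α H.carrier →
    (H.carrier →L[ℂ] H.carrier)) (C : ℝ) (hC : ∀ H c, ‖T H c‖ ≤ C) : UniversalAlgebra α :=
  ⟨fun c => T c.1 c.2, memℓp_infty ⟨C, by rintro _ ⟨c, rfl⟩; exact hC c.1 c.2⟩⟩

theorem ext {T T' : UniversalAlgebra α}
    (h : ∀ (H : HilbertSpaceBundle.{u}) (c : CovariantPair α H.carrier), T.eval c = T'.eval c) :
    T = T' :=
  lp.ext (funext fun c => h c.1 c.2)

theorem norm_eval_le (T : UniversalAlgebra α) {H : HilbertSpaceBundle.{u}}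
    (c : CovariantPair α H.carrier) : ‖T.eval c‖ ≤ ‖T‖ :=
  lp.norm_apply_le_norm ENNReal.top_ne_zero T ⟨H, c⟩

theorem norm_le {T : UniversalAlgebra α} {C : ℝ} (hC : 0 ≤ C)
    (h : ∀ (H : HilbertSpaceBundle.{u}) (c : CovariantPair α H.carrier), ‖T.eval c‖ ≤ C) :
    ‖T‖ ≤ C :=
  lp.norm_le_of_forall_le hC fun c => h c.1 c.2

end UniversalAlgebra

variable [MeasurableSpace G] [BorelSpace G] (ν : Measure G) [IsFiniteMeasureOnCompacts ν]

/-- The family of all integrated forms of `f ∈ C_c(G, A)`. Its norm is the universal norm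
`sup {‖(π ⋊ u)(f)‖}`, the supremum being over all covariant pairs. -/
def universalForm (f : C_c(G, A)) : UniversalAlgebra α :=
  UniversalAlgebra.mk (fun _ c => c.integratedForm ν f) (∫ g, ‖f g‖ ∂ν)
    fun _ c => c.norm_integratedForm_le ν f

/-- The (full) crossed product `G ⋉ A`: the `C*`-algebra generated by the functions
`f ∈ C_c(G, A)` in the universal norm. (The integrated forms turn the convolution product and the
involution of `C_c(G, A)` into product and adjoint of operators, so for a strongly continuous `α`
the functions themselves are dense.) -/
def crossedProduct : NonUnitalStarSubalgebra ℂ (UniversalAlgebra α) :=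
  (NonUnitalStarAlgebra.adjoin ℂ (Set.range (universalForm α ν))).topologicalClosure

end CrossedProduct

/-! ### Central extensions and twisted crossed products -/

/-- A `U(1)`-central extension `1 → U(1) → Γτ → Γ → 1` of topological groups. -/
structure CentralExtension (Γ Γτ : Type*) [Group Γ] [TopologicalSpace Γ] [Group Γτ]
    [TopologicalSpace Γτ] where
  incl : Circle →* Γτ
  proj : Γτ →* Γ
  continuous_incl : Continuous incl
  injective_incl : Function.Injective incl
  isOpenQuotientMap_proj : IsOpenQuotientMap proj
  exact : proj.ker = incl.range
  central : ∀ z g, incl z * g = g * incl z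

namespace CentralExtension

variable {Γ Γτ : Type*} [Group Γ] [TopologicalSpace Γ] [Group Γτ] [TopologicalSpace Γτ]

/-- The action of `S` on `Γτ` lifts the action of `S` on `Γ`, and `U(1)` is fixed by `S` (so that
`S ⋉ Γτ` is a `U(1)`-central extension of `S ⋉ Γ`). -/
structure IsLift (E : CentralExtension Γ Γτ) (S : Type*) [Group S] [MulDistribMulAction S Γ]
    [MulDistribMulAction S Γτ] : Prop where
  proj_smul : ∀ (s : S) (g : Γτ), E.proj (s • g) = s • E.proj g
  smul_incl : ∀ (s : S) (z : Circle), s • E.incl z = E.incl z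

/-- `a(z⁻¹ g) = zⁿ a(g)` for all `z ∈ U(1)`. -/
def IsHomogeneous {A : Type*} [NonUnitalCStarAlgebra A] (E : CentralExtension Γ Γτ) (n : ℤ)
    (a : C_c(Γτ, A)) : Prop :=
  ∀ (z : Circle) (g : Γτ), a ((E.incl z)⁻¹ * g) = ((z : ℂ) ^ n) • a g

end CentralExtension

section Twisted

variable {Γ : Type*} {Γτ A : Type u} [Group Γ] [TopologicalSpace Γ] [Group Γτ]
  [TopologicalSpace Γτ] [NonUnitalCStarAlgebra A] [MeasurableSpace Γτ] [BorelSpace Γτ]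

/-- The homogeneous ideal `(Γτ ⋉ A)_(n)` of `Γτ ⋉ A`, generated as a `C*`-algebra by the
homogeneous functions of weight `n` in `C_c(Γτ, A)`; it is the norm closure of this set of
functions, which is closed under convolution and involution. The central circle acts trivially
on `A`. -/
def homogeneousIdeal (E : CentralExtension Γ Γτ) (ν : Measure Γτ) [IsFiniteMeasureOnCompacts ν]
    (α : Γ →* (A ≃⋆ₐ[ℂ] A)) (n : ℤ) :
    NonUnitalStarSubalgebra ℂ (UniversalAlgebra (α.comp E.proj)) :=
  (NonUnitalStarAlgebra.adjoin ℂ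
    (universalForm (α.comp E.proj) ν '' {a | E.IsHomogeneous n a})).topologicalClosure

theorem homogeneousIdeal_le_crossedProduct (E : CentralExtension Γ Γτ) (ν : Measure Γτ)
    [IsFiniteMeasureOnCompacts ν] (α : Γ →* (A ≃⋆ₐ[ℂ] A)) (n : ℤ) :
    homogeneousIdeal E ν α n ≤ crossedProduct (α.comp E.proj) ν :=
  NonUnitalStarSubalgebra.topologicalClosure_mono
    (NonUnitalStarAlgebra.adjoin_mono (Set.image_subset_range _ _))

/-- The twisted crossed product `Γ ⋉_τ A = (Γτ ⋉ A)_(1)`. -/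
abbrev twistedCrossedProduct (E : CentralExtension Γ Γτ) (ν : Measure Γτ)
    [IsFiniteMeasureOnCompacts ν] (α : Γ →* (A ≃⋆ₐ[ℂ] A)) :
    NonUnitalStarSubalgebra ℂ (UniversalAlgebra (α.comp E.proj)) :=
  homogeneousIdeal E ν α 1

/-- The canonical map from the weight one part of `C_c(Γτ, A)` to `Γ ⋉_τ A`. -/
def toTwistedCrossedProduct (E : CentralExtension Γ Γτ) (ν : Measure Γτ)
    [IsFiniteMeasureOnCompacts ν] (α : Γ →* (A ≃⋆ₐ[ℂ] A)) (a : C_c(Γτ, A))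
    (ha : E.IsHomogeneous 1 a) : twistedCrossedProduct E ν α :=
  ⟨universalForm (α.comp E.proj) ν a, NonUnitalStarSubalgebra.le_topologicalClosure _
    (NonUnitalStarAlgebra.subset_adjoin ℂ _ ⟨a, ha, rfl⟩)⟩

end Twisted

/-! ### The action of `S` on a twisted crossed product -/

section SAction

variable {S G A : Type*} [Group S] [Group G] [TopologicalSpace G] [NonUnitalCStarAlgebra A]
  [MulDistribMulAction S G]

section

variable [TopologicalSpace S] [ContinuousSMul S G]

/-- The function `(s · a)(g) = s.a(s⁻¹ g s)` for `a ∈ C_c(G, A)`, where `s⁻¹ g s` is the action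
of `s⁻¹` on `g`. -/
def actOnFunction (β : S →* (A ≃⋆ₐ[ℂ] A)) (s : S) (a : C_c(G, A)) : C_c(G, A) where
  toFun g := β s (a (s⁻¹ • g))
  continuous_toFun := (StarAlgEquiv.isometry (β s)).continuous.comp
    (a.continuous.comp (continuous_const_smul s⁻¹))
  hasCompactSupport' := by
    have h : HasCompactSupport fun g => a (s⁻¹ • g) :=
      a.hasCompactSupport.comp_homeomorph (Homeomorph.smul s⁻¹)
    exact h.comp_left (map_zero (β s))

theorem actOnFunction_apply (β : S →* (A ≃⋆ₐ[ℂ] A)) (s : S) (a : C_c(G, A)) (g : G) :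
    actOnFunction β s a g = β s (a (s⁻¹ • g)) := rfl

/-- The covariant pair `(π ∘ β_s, u ∘ s)`. -/
def CovariantPair.twist {α : G →* (A ≃⋆ₐ[ℂ] A)} {H : Type*} [NormedAddCommGroup H]
    [InnerProductSpace ℂ H] [CompleteSpace H] (β : S →* (A ≃⋆ₐ[ℂ] A))
    (hβ : ∀ s g a, β s (α g a) = α (s • g) (β s a)) (s : S) (c : CovariantPair α H) :
    CovariantPair α H where
  π := c.π.comp (β s : A →⋆ₙₐ[ℂ] A)
  u := c.u.comp (MulDistribMulAction.toMonoidHom G s)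
  continuous_u ξ := (c.continuous_u ξ).comp (continuous_const_smul s)
  covariant g a := by
    have := c.covariant (s • g) (β s a)
    rw [← hβ] at this
    exact this

theorem CovariantPair.twist_one {α : G →* (A ≃⋆ₐ[ℂ] A)} {H : Type*} [NormedAddCommGroup H]
    [InnerProductSpace ℂ H] [CompleteSpace H] (β : S →* (A ≃⋆ₐ[ℂ] A))
    (hβ : ∀ s g a, β s (α g a) = α (s • g) (β s a)) (c : CovariantPair α H) :
    c.twist β hβ 1 = c := by
  apply CovariantPair.ext
  · apply NonUnitalStarAlgHom.ext
    intro a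
    change c.π (β 1 a) = c.π a
    simp
  · apply MonoidHom.ext
    intro g
    change c.u ((1 : S) • g) = c.u g
    rw [one_smul]

theorem CovariantPair.twist_mul {α : G →* (A ≃⋆ₐ[ℂ] A)} {H : Type*} [NormedAddCommGroup H]
    [InnerProductSpace ℂ H] [CompleteSpace H] (β : S →* (A ≃⋆ₐ[ℂ] A))
    (hβ : ∀ s g a, β s (α g a) = α (s • g) (β s a)) (s t : S) (c : CovariantPair α H) :
    c.twist β hβ (s * t) = (c.twist β hβ s).twist β hβ t := by
  apply CovariantPair.ext
  · apply NonUnitalStarAlgHom.ext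
    intro a
    change c.π (β (s * t) a) = c.π (β s (β t a))
    simp
  · apply MonoidHom.ext
    intro g
    change c.u ((s * t) • g) = c.u (s • t • g)
    rw [mul_smul]

end

end SAction

section SActionUniversal

variable {S : Type v} {Γ : Type*} {G A : Type u} [Group S] [TopologicalSpace S] [Group G]
  [TopologicalSpace G] [NonUnitalCStarAlgebra A] [MulDistribMulAction S G] [ContinuousSMul S G]
  {α : G →* (A ≃⋆ₐ[ℂ] A)} (β : S →* (A ≃⋆ₐ[ℂ] A))
  (hβ : ∀ s g a, β s (α g a) = α (s • g) (β s a))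

/-- The automorphism `(s · T)_(π, u) = T_(π ∘ β_s, u ∘ s)` of the algebra of bounded families. -/
def universalAct (s : S) : UniversalAlgebra α →⋆ₙₐ[ℂ] UniversalAlgebra α where
  toFun T := UniversalAlgebra.mk (fun _ c => T.eval (c.twist β hβ s)) ‖T‖
    fun _ _ => T.norm_eval_le _
  map_smul' _ _ := rfl
  map_zero' := rfl
  map_add' _ _ := rfl
  map_mul' _ _ := rfl
  map_star' _ := rfl

theorem universalAct_eval (s : S) (T : UniversalAlgebra α) {H : HilbertSpaceBundle.{u}}
    (c : CovariantPair α H.carrier) :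
    (universalAct β hβ s T).eval c = T.eval (c.twist β hβ s) := rfl

theorem universalAct_one (T : UniversalAlgebra α) : universalAct β hβ 1 T = T :=
  UniversalAlgebra.ext fun _ c => by rw [universalAct_eval, c.twist_one]

theorem universalAct_mul (s t : S) (T : UniversalAlgebra α) :
    universalAct β hβ (s * t) T = universalAct β hβ s (universalAct β hβ t T) :=
  UniversalAlgebra.ext fun _ c => by simp only [universalAct_eval, c.twist_mul]

theorem continuous_universalAct (s : S) : Continuous (universalAct β hβ s) := by
  refine AddMonoidHomClass.continuous_of_bound _ 1 fun T => ?_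
  rw [one_mul]
  exact UniversalAlgebra.norm_le (norm_nonneg _) fun _ _ => T.norm_eval_le _

variable [MeasurableSpace G] [BorelSpace G] (ν : Measure G) [IsFiniteMeasureOnCompacts ν]

theorem universalAct_universalForm (s : S) (hs : MeasurePreserving (fun g : G => s • g) ν ν)
    (a : C_c(G, A)) :
    universalAct β hβ s (universalForm α ν a) = universalForm α ν (actOnFunction β s a) := by
  refine UniversalAlgebra.ext fun H c => ContinuousLinearMap.ext fun ξ => ?_
  change ∫ g, c.π (β s (a g)) ((c.u (s • g) : H.carrier →L[ℂ] H.carrier) ξ) ∂ν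
    = ∫ g, c.π (β s (a (s⁻¹ • g))) ((c.u g : H.carrier →L[ℂ] H.carrier) ξ) ∂ν
  refine Eq.trans ?_ (hs.integral_comp (Homeomorph.smul s).measurableEmbedding
    fun g => c.π (β s (a (s⁻¹ • g))) ((c.u g : H.carrier →L[ℂ] H.carrier) ξ))
  simp only [inv_smul_smul]

end SActionUniversal

section STwisted

variable {S : Type v} {Γ : Type*} {Γτ A : Type u} [Group S] [TopologicalSpace S] [Group Γ]
  [TopologicalSpace Γ] [Group Γτ] [TopologicalSpace Γτ] [NonUnitalCStarAlgebra A]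
  [MulDistribMulAction S Γ] [MulDistribMulAction S Γτ] [ContinuousSMul S Γτ]
  [MeasurableSpace Γτ] [BorelSpace Γτ] {E : CentralExtension Γ Γτ}

theorem CentralExtension.IsHomogeneous.actOnFunction {n : ℤ} {a : C_c(Γτ, A)}
    (ha : E.IsHomogeneous n a) (hE : E.IsLift S) (β : S →* (A ≃⋆ₐ[ℂ] A)) (s : S) : E.IsHomogeneous n (actOnFunction β s a) := by
  intro z g
  rw [actOnFunction_apply, actOnFunction_apply, smul_mul', smul_inv', hE.smul_incl, ha, map_smul]

theorem CentralExtension.IsLift.compat (hE : E.IsLift S)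
    {α : Γ →* (A ≃⋆ₐ[ℂ] A)} (β : S →* (A ≃⋆ₐ[ℂ] A))
    (hβ : ∀ s γ a, β s (α γ a) = α (s • γ) (β s a))
    (s : S) (g : Γτ) (a : A) :
    β s (α.comp E.proj g a) = α.comp E.proj (s • g) (β s a) := by
  simp only [MonoidHom.comp_apply, hE.proj_smul, hβ]

theorem universalAct_mem (hE : E.IsLift S) (ν : Measure Γτ) [IsFiniteMeasureOnCompacts ν]
    (hν : ∀ s : S, MeasurePreserving (fun g : Γτ => s • g) ν ν)
    {α : Γ →* (A ≃⋆ₐ[ℂ] A)} (β : S →* (A ≃⋆ₐ[ℂ] A))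
    (hβ : ∀ s γ a, β s (α γ a) = α (s • γ) (β s a))
    (n : ℤ) (s : S) {T : UniversalAlgebra (α.comp E.proj)}
    (hT : T ∈ homogeneousIdeal E ν α n) :
    universalAct β (hE.compat β hβ) s T ∈ homogeneousIdeal E ν α n := by
  have h : homogeneousIdeal E ν α n ≤
      (homogeneousIdeal E ν α n).comap (universalAct β (hE.compat β hβ) s) := by
    refine NonUnitalStarSubalgebra.topologicalClosure_minimal _ ?_ ?_
    · refine NonUnitalStarAlgebra.adjoin_le ?_
      rintro _ ⟨a, ha, rfl⟩
      change universalAct β (hE.compat β hβ) s _ ∈ homogeneousIdeal E ν α n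
      rw [universalAct_universalForm _ _ _ _ (hν s)]
      exact NonUnitalStarSubalgebra.le_topologicalClosure _
        (NonUnitalStarAlgebra.subset_adjoin ℂ _ ⟨_, ha.actOnFunction hE β s, rfl⟩)
    · exact (NonUnitalStarSubalgebra.isClosed_topologicalClosure _).preimage
        (continuous_universalAct β (hE.compat β hβ) s)
  exact h hT

/-- The action of `S` on `Γ ⋉_τ A`. -/
def twistedAct (hE : E.IsLift S) (ν : Measure Γτ) [IsFiniteMeasureOnCompacts ν]
    (hν : ∀ s : S, MeasurePreserving (fun g : Γτ => s • g) ν ν)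
    {α : Γ →* (A ≃⋆ₐ[ℂ] A)} (β : S →* (A ≃⋆ₐ[ℂ] A))
    (hβ : ∀ s γ a, β s (α γ a) = α (s • γ) (β s a)) :
    S →* (twistedCrossedProduct E ν α ≃⋆ₐ[ℂ] twistedCrossedProduct E ν α) where
  toFun s :=
    { toFun := fun T => ⟨universalAct β (hE.compat β hβ) s T,
        universalAct_mem hE ν hν β hβ 1 s T.2⟩
      invFun := fun T => ⟨universalAct β (hE.compat β hβ) s⁻¹ T,
        universalAct_mem hE ν hν β hβ 1 s⁻¹ T.2⟩
      left_inv := fun T => Subtype.ext <| by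
        change universalAct _ _ _ (universalAct _ _ _ _) = _
        rw [← universalAct_mul, inv_mul_cancel, universalAct_one]
      right_inv := fun T => Subtype.ext <| by
        change universalAct _ _ _ (universalAct _ _ _ _) = _
        rw [← universalAct_mul, mul_inv_cancel, universalAct_one]
      map_mul' := fun T T' => Subtype.ext (map_mul _ _ _)
      map_add' := fun T T' => Subtype.ext (map_add _ _ _)
      map_star' := fun T => Subtype.ext (map_star _ _)
      map_smul' := fun k T => Subtype.ext (map_smul _ _ _) }
  map_one' := StarAlgEquiv.ext fun T => Subtype.ext (universalAct_one _ _ _)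
  map_mul' s t := StarAlgEquiv.ext fun T => Subtype.ext (universalAct_mul _ _ _ _ _)

/-- On functions the action of `S` on `Γ ⋉_τ A` is `(s · a)(g) = s.a(s⁻¹ g s)`. -/
theorem twistedAct_toTwistedCrossedProduct (hE : E.IsLift S) (ν : Measure Γτ) [IsFiniteMeasureOnCompacts ν]
    (hν : ∀ s : S, MeasurePreserving (fun g : Γτ => s • g) ν ν)
    {α : Γ →* (A ≃⋆ₐ[ℂ] A)} (β : S →* (A ≃⋆ₐ[ℂ] A))
    (hβ : ∀ s γ a, β s (α γ a) = α (s • γ) (β s a))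
    (s : S) (a : C_c(Γτ, A)) (ha : E.IsHomogeneous 1 a) :
    twistedAct hE ν hν β hβ s (toTwistedCrossedProduct E ν α a ha) =
      toTwistedCrossedProduct E ν α (actOnFunction β s a) (ha.actOnFunction hE β s) :=
  Subtype.ext (universalAct_universalForm _ _ _ _ (hν s) _)

end STwisted

/-! ### The twisted regular representation -/

section TwistedL2

variable {Γ Γτ : Type*} [Group Γ] [TopologicalSpace Γ] [Group Γτ] [TopologicalSpace Γτ]
  [IsTopologicalGroup Γτ] [MeasurableSpace Γτ] [BorelSpace Γτ]

/-- `L²_τ(Γ)`: the `f ∈ L²(Γτ)` with `f(z⁻¹ g) = z f(g)` for all `z ∈ U(1)`. -/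
def twistedL2Submodule (E : CentralExtension Γ Γτ) (ν : Measure Γτ) [ν.IsMulLeftInvariant] :
    Submodule ℂ (Lp ℂ 2 ν) where
  carrier := {f | ∀ z : Circle, (fun g => f ((E.incl z)⁻¹ * g)) =ᵐ[ν] fun g => (z : ℂ) * f g}
  zero_mem' z := by
    have h := Lp.coeFn_zero ℂ 2 ν
    filter_upwards [h, (measurePreserving_mul_left ν (E.incl z)⁻¹).quasiMeasurePreserving.ae h]
      with g h1 h2
    rw [h1, h2]; simp
  add_mem' {f₁ f₂} hf₁ hf₂ z := by
    have h := Lp.coeFn_add f₁ f₂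
    filter_upwards [h, (measurePreserving_mul_left ν (E.incl z)⁻¹).quasiMeasurePreserving.ae h,
      hf₁ z, hf₂ z] with g h1 h2 h3 h4
    rw [h1, h2, Pi.add_apply, Pi.add_apply, h3, h4, mul_add]
  smul_mem' k f hf z := by
    have h := Lp.coeFn_smul k f
    filter_upwards [h, (measurePreserving_mul_left ν (E.incl z)⁻¹).quasiMeasurePreserving.ae h,
      hf z] with g h1 h2 h3
    rw [h1, h2, Pi.smul_apply, Pi.smul_apply, h3, smul_eq_mul, smul_eq_mul, mul_left_comm]

theorem isClosed_twistedL2Submodule (E : CentralExtension Γ Γτ) (ν : Measure Γτ) [ν.IsMulLeftInvariant] :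
    IsClosed (twistedL2Submodule E ν : Set (Lp ℂ 2 ν)) := by
  have h : (twistedL2Submodule E ν : Set (Lp ℂ 2 ν)) = ⋂ z : Circle, {f : Lp ℂ 2 ν |
      Lp.compMeasurePreservingₗᵢ ℂ (fun g => (E.incl z)⁻¹ * g)
        (measurePreserving_mul_left ν (E.incl z)⁻¹) f = (z : ℂ) • f} := by
    ext f
    simp only [SetLike.mem_coe, Set.mem_iInter, Set.mem_ofPred_eq]
    refine forall_congr' fun z => ?_
    have h1 := Lp.coeFn_compMeasurePreserving f (measurePreserving_mul_left ν (E.incl z)⁻¹)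
    have h2 := Lp.coeFn_smul (z : ℂ) f
    constructor
    · intro hf
      apply Lp.ext
      filter_upwards [h1, h2, hf] with g h1 h2 h3
      rw [h2, Pi.smul_apply, smul_eq_mul, ← h3]
      exact h1
    · intro hf
      have h3 : ⇑(Lp.compMeasurePreserving (fun g => (E.incl z)⁻¹ * g)
        (measurePreserving_mul_left ν (E.incl z)⁻¹) f) =ᵐ[ν] ⇑((z : ℂ) • f) := by
        have : Lp.compMeasurePreserving (fun g => (E.incl z)⁻¹ * g)
          (measurePreserving_mul_left ν (E.incl z)⁻¹) f = (z : ℂ) • f := hf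
        rw [this]
      filter_upwards [h1, h2, h3] with g h1 h2 h3
      rw [h1, h2] at h3
      exact h3
  rw [h]
  exact isClosed_iInter fun z =>
    isClosed_eq (LinearIsometry.continuous _) (continuous_const_smul _)

/-- The Hilbert space `L²_τ(Γ)`. -/
def TwistedL2 (E : CentralExtension Γ Γτ) (ν : Measure Γτ) [ν.IsMulLeftInvariant] : Type _ :=
  twistedL2Submodule E ν

namespace TwistedL2

variable (E : CentralExtension Γ Γτ) (ν : Measure Γτ) [ν.IsMulLeftInvariant]

instance : NormedAddCommGroup (TwistedL2 E ν) :=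
  inferInstanceAs (NormedAddCommGroup (twistedL2Submodule E ν))

instance : InnerProductSpace ℂ (TwistedL2 E ν) :=
  inferInstanceAs (InnerProductSpace ℂ (twistedL2Submodule E ν))

instance : CompleteSpace (TwistedL2 E ν) :=
  (isClosed_twistedL2Submodule E ν).completeSpace_coe

variable {E ν}

/-- The element of `L²(Γτ)` underlying an element of `L²_τ(Γ)`. -/
def toLp (f : TwistedL2 E ν) : Lp ℂ 2 ν := f.1

theorem ext {f f' : TwistedL2 E ν} (h : f.toLp =ᵐ[ν] f'.toLp) : f = f' :=
  Subtype.ext (Lp.ext h)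

theorem toLp_add (f f' : TwistedL2 E ν) : (f + f').toLp = f.toLp + f'.toLp := rfl

theorem toLp_smul (k : ℂ) (f : TwistedL2 E ν) : (k • f).toLp = k • f.toLp := rfl

theorem inner_def (f f' : TwistedL2 E ν) : inner ℂ f f' = inner ℂ f.toLp f'.toLp := rfl

end TwistedL2

end TwistedL2

section Rho

variable {S Γ Γτ : Type*} [Group S] [TopologicalSpace S] [Group Γ] [TopologicalSpace Γ]
  [Group Γτ] [TopologicalSpace Γτ] [IsTopologicalGroup Γτ] [LocallyCompactSpace Γτ]
  [SecondCountableTopology Γτ] [MeasurableSpace Γτ] [BorelSpace Γτ]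
  [MulDistribMulAction S Γ] [MulDistribMulAction S Γτ] [ContinuousSMul S Γτ]

/-- The homeomorphism `g₁ ↦ (s⁻¹ g₁ s) g` of `Γτ`. -/
def rhoHomeomorph (s : S) (g : Γτ) : Γτ ≃ₜ Γτ :=
  (Homeomorph.smul s⁻¹).trans (Homeomorph.mulRight g)

theorem rhoHomeomorph_apply (s : S) (g g₁ : Γτ) : rhoHomeomorph s g g₁ = (s⁻¹ • g₁) * g := rfl

/-- The automorphism of the topological group `Γτ` given by `s ∈ S`. -/
def smulContinuousMulEquiv (s : S) : Γτ ≃ₜ* Γτ :=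
  { MulDistribMulAction.toMulEquiv Γτ s with
    continuous_toFun := continuous_const_smul s
    continuous_invFun := continuous_const_smul s⁻¹ }

theorem exists_map_rhoHomeomorph (ν : Measure Γτ) [ν.IsHaarMeasure] (s : S) (g : Γτ) :
    ∃ c : ℝ≥0, c ≠ 0 ∧ ν.map (rhoHomeomorph s g) = c • ν := by
  have h1 : (ν.map (fun x : Γτ => s⁻¹ • x)).IsHaarMeasure :=
    ContinuousMulEquiv.isHaarMeasure_map ν (smulContinuousMulEquiv s⁻¹)
  have h2 : ν.map (rhoHomeomorph s g) = (ν.map (fun x : Γτ => s⁻¹ • x)).map (· * g) := by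
    rw [Measure.map_map (measurable_mul_const g) (continuous_const_smul s⁻¹).measurable]
    rfl
  have h3 : (ν.map (rhoHomeomorph s g)).IsHaarMeasure := by rw [h2]; infer_instance
  exact ⟨_, (Measure.haarScalarFactor_pos_of_isHaarMeasure _ ν).ne',
    Measure.isMulLeftInvariant_eq_smul _ ν⟩

theorem quasiMeasurePreserving_rhoHomeomorph (ν : Measure Γτ) [ν.IsHaarMeasure] (s : S)
    (g : Γτ) : Measure.QuasiMeasurePreserving (rhoHomeomorph s g) ν ν := by
  obtain ⟨c, -, hc⟩ := exists_map_rhoHomeomorph ν s g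
  refine ⟨(rhoHomeomorph s g).continuous.measurable, ?_⟩
  rw [hc]
  exact Measure.smul_absolutelyContinuous

theorem memLp_comp_rhoHomeomorph (ν : Measure Γτ) [ν.IsHaarMeasure] (s : S) (g : Γτ)
    (f : Lp ℂ 2 ν) : MemLp (f ∘ rhoHomeomorph s g) 2 ν := by
  obtain ⟨c, -, hc⟩ := exists_map_rhoHomeomorph ν s g
  refine MemLp.comp_of_map ?_ (rhoHomeomorph s g).continuous.measurable.aemeasurable
  rw [hc]
  exact (Lp.memLp f).smul_measure ENNReal.coe_ne_top

variable {E : CentralExtension Γ Γτ}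

/-- `ρ(s, g) f (g₁) = f((s⁻¹ g₁ s) g)` on `L²_τ(Γ)`, as a linear map. -/
def rhoLinear (hE : E.IsLift S) (ν : Measure Γτ) [ν.IsHaarMeasure] (s : S) (g : Γτ) :
    TwistedL2 E ν →ₗ[ℂ] TwistedL2 E ν where
  toFun f := ⟨(memLp_comp_rhoHomeomorph ν s g f.toLp).toLp, fun z => by
    have hq := quasiMeasurePreserving_rhoHomeomorph ν s g
    have h := (memLp_comp_rhoHomeomorph ν s g f.toLp).coeFn_toLp
    filter_upwards [h,
      (measurePreserving_mul_left ν (E.incl z)⁻¹).quasiMeasurePreserving.ae h,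
      hq.ae (f.2 z)] with x h1 h2 h3
    refine h2.trans (Eq.trans ?_ (h3.trans (congrArg (fun w => (z : ℂ) * w) h1.symm)))
    simp only [Function.comp_apply, rhoHomeomorph_apply, smul_mul', smul_inv', hE.smul_incl,
      mul_assoc]
    rfl⟩
  map_add' f₁ f₂ := by
    apply TwistedL2.ext
    have hq := quasiMeasurePreserving_rhoHomeomorph ν s g
    filter_upwards [(memLp_comp_rhoHomeomorph ν s g (f₁ + f₂).toLp).coeFn_toLp,
      Lp.coeFn_add (memLp_comp_rhoHomeomorph ν s g f₁.toLp).toLp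
        (memLp_comp_rhoHomeomorph ν s g f₂.toLp).toLp,
      (memLp_comp_rhoHomeomorph ν s g f₁.toLp).coeFn_toLp,
      (memLp_comp_rhoHomeomorph ν s g f₂.toLp).coeFn_toLp,
      hq.ae (Lp.coeFn_add f₁.toLp f₂.toLp)] with x h1 h2 h3 h4 h5
    refine h1.trans ?_
    refine Eq.trans ?_ h2.symm
    rw [Pi.add_apply, h3, h4]
    exact h5
  map_smul' k f := by
    apply TwistedL2.ext
    have hq := quasiMeasurePreserving_rhoHomeomorph ν s g
    filter_upwards [(memLp_comp_rhoHomeomorph ν s g (k • f).toLp).coeFn_toLp,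
      Lp.coeFn_smul k (memLp_comp_rhoHomeomorph ν s g f.toLp).toLp,
      (memLp_comp_rhoHomeomorph ν s g f.toLp).coeFn_toLp,
      hq.ae (Lp.coeFn_smul k f.toLp)] with x h1 h2 h3 h4
    refine h1.trans ?_
    refine Eq.trans ?_ h2.symm
    rw [Pi.smul_apply, h3]
    exact h4

theorem rhoLinear_coeFn (hE : E.IsLift S) (ν : Measure Γτ) [ν.IsHaarMeasure] (s : S) (g : Γτ)
    (f : TwistedL2 E ν) :
    ⇑(rhoLinear hE ν s g f).toLp =ᵐ[ν] fun g₁ => f.toLp ((s⁻¹ • g₁) * g) :=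
  (memLp_comp_rhoHomeomorph ν s g f.toLp).coeFn_toLp

theorem rhoLinear_mul (hE : E.IsLift S) (ν : Measure Γτ) [ν.IsHaarMeasure] (s s' : S)
    (g g' : Γτ) (f : TwistedL2 E ν) :
    rhoLinear hE ν s g (rhoLinear hE ν s' g' f) =
      rhoLinear hE ν (s * s') ((s'⁻¹ • g) * g') f := by
  apply TwistedL2.ext
  filter_upwards [rhoLinear_coeFn hE ν s g (rhoLinear hE ν s' g' f),
    (quasiMeasurePreserving_rhoHomeomorph ν s g).ae (rhoLinear_coeFn hE ν s' g' f),
    rhoLinear_coeFn hE ν (s * s') ((s'⁻¹ • g) * g') f] with x h1 h2 h3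
  rw [h1, h3]
  refine h2.trans ?_
  rw [rhoHomeomorph_apply, smul_mul', mul_inv_rev, mul_smul, mul_assoc]

theorem rhoLinear_one (hE : E.IsLift S) (ν : Measure Γτ) [ν.IsHaarMeasure]
    (f : TwistedL2 E ν) : rhoLinear hE ν (1 : S) (1 : Γτ) f = f := by
  apply TwistedL2.ext
  filter_upwards [rhoLinear_coeFn hE ν (1 : S) 1 f] with x h1
  rw [h1, inv_one, one_smul, mul_one]

theorem exists_inner_rhoLinear (hE : E.IsLift S) (ν : Measure Γτ) [ν.IsHaarMeasure] (s : S)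
    (g : Γτ) : ∃ c : ℝ≥0, c ≠ 0 ∧ ∀ f₁ f₂ : TwistedL2 E ν,
      inner ℂ (rhoLinear hE ν s g f₁) (rhoLinear hE ν s g f₂) = (c : ℂ) * inner ℂ f₁ f₂ := by
  obtain ⟨c, hc0, hc⟩ := exists_map_rhoHomeomorph ν s g
  refine ⟨c, hc0, fun f₁ f₂ => ?_⟩
  rw [TwistedL2.inner_def, TwistedL2.inner_def, L2.inner_def, L2.inner_def]
  have h1 : ∫ a, inner ℂ ((rhoLinear hE ν s g f₁).toLp a) ((rhoLinear hE ν s g f₂).toLp a) ∂ν =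
      ∫ a, inner ℂ (f₁.toLp (rhoHomeomorph s g a)) (f₂.toLp (rhoHomeomorph s g a)) ∂ν := by
    refine integral_congr_ae ?_
    filter_upwards [rhoLinear_coeFn hE ν s g f₁, rhoLinear_coeFn hE ν s g f₂] with x h1 h2
    rw [h1, h2]
    rfl
  rw [h1, ← (rhoHomeomorph s g).measurableEmbedding.integral_map
    (fun a => inner ℂ (f₁.toLp a) (f₂.toLp a)), hc,
    integral_smul_nnreal_measure, NNReal.smul_def, Complex.real_smul]

theorem continuous_rhoLinear (hE : E.IsLift S) (ν : Measure Γτ) [ν.IsHaarMeasure] (s : S)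
    (g : Γτ) : Continuous (rhoLinear hE ν s g) := by
  obtain ⟨c, -, hc⟩ := exists_inner_rhoLinear hE ν s g
  refine AddMonoidHomClass.continuous_of_bound _ (Real.sqrt c) fun f => ?_
  have h := hc f f
  rw [inner_self_eq_norm_sq_to_K (𝕜 := ℂ), inner_self_eq_norm_sq_to_K (𝕜 := ℂ)] at h
  have h' : ‖rhoLinear hE ν s g f‖ ^ 2 = c * ‖f‖ ^ 2 := by
    apply Complex.ofReal_injective
    push_cast
    exact h
  rw [← Real.sqrt_sq (norm_nonneg (rhoLinear hE ν s g f)), h', Real.sqrt_mul c.coe_nonneg,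
    Real.sqrt_sq (norm_nonneg f)]

/-- The representation `ρ(s, g) f (g₁) = f(s⁻¹ g₁ s g)` of `S ⋉ Γτ` on `L²_τ(Γ)`, extending the
right `(-τ)`-twisted regular representation of `Γ`. (It is unitary up to positive scalars.) -/
def rho (hE : E.IsLift S) (ν : Measure Γτ) [ν.IsHaarMeasure] (s : S) (g : Γτ) :
    TwistedL2 E ν ≃L[ℂ] TwistedL2 E ν where
  toLinearMap := rhoLinear hE ν s g
  invFun := rhoLinear hE ν s⁻¹ (s • g⁻¹)
  left_inv f := by
    refine (rhoLinear_mul hE ν s⁻¹ s (s • g⁻¹) g f).trans ?_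
    rw [inv_mul_cancel, inv_smul_smul, inv_mul_cancel, rhoLinear_one]
  right_inv f := by
    refine (rhoLinear_mul hE ν s s⁻¹ g (s • g⁻¹) f).trans ?_
    rw [mul_inv_cancel, inv_inv, ← smul_mul', mul_inv_cancel, smul_one, rhoLinear_one]
  continuous_toFun := continuous_rhoLinear hE ν s g
  continuous_invFun := continuous_rhoLinear hE ν s⁻¹ (s • g⁻¹)

theorem rho_coeFn (hE : E.IsLift S) (ν : Measure Γτ) [ν.IsHaarMeasure] (s : S) (g : Γτ)
    (f : TwistedL2 E ν) :
    ⇑(rho hE ν s g f).toLp =ᵐ[ν] fun g₁ => f.toLp ((s⁻¹ • g₁) * g) :=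
  rhoLinear_coeFn hE ν s g f

theorem rho_mul (hE : E.IsLift S) (ν : Measure Γτ) [ν.IsHaarMeasure] (s s' : S)
    (g g' : Γτ) (f : TwistedL2 E ν) :
    rho hE ν s g (rho hE ν s' g' f) = rho hE ν (s * s') ((s'⁻¹ • g) * g') f :=
  rhoLinear_mul hE ν s s' g g' f

/-- The adjoint action `Ad(ρ(s, g)) T = ρ(s, g) T ρ(s, g)⁻¹`. -/
def adRho (hE : E.IsLift S) (ν : Measure Γτ) [ν.IsHaarMeasure] (s : S) (g : Γτ)
    (T : TwistedL2 E ν →L[ℂ] TwistedL2 E ν) : TwistedL2 E ν →L[ℂ] TwistedL2 E ν :=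
  (rho hE ν s g : TwistedL2 E ν →L[ℂ] TwistedL2 E ν) ∘L T ∘L
    ((rho hE ν s g).symm : TwistedL2 E ν →L[ℂ] TwistedL2 E ν)

theorem adRho_apply (hE : E.IsLift S) (ν : Measure Γτ) [ν.IsHaarMeasure] (s : S) (g : Γτ)
    (T : TwistedL2 E ν →L[ℂ] TwistedL2 E ν) (f : TwistedL2 E ν) :
    adRho hE ν s g T f = rho hE ν s g (T ((rho hE ν s g).symm f)) := rfl

theorem adRho_adRho (hE : E.IsLift S) (ν : Measure Γτ) [ν.IsHaarMeasure] (s s' : S) (g g' : Γτ)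
    (T : TwistedL2 E ν →L[ℂ] TwistedL2 E ν) :
    adRho hE ν s g (adRho hE ν s' g' T) = adRho hE ν (s * s') ((s'⁻¹ • g) * g') T := by
  ext1 f
  obtain ⟨f, rfl⟩ := (rho hE ν (s * s') ((s'⁻¹ • g) * g')).surjective f
  rw [adRho_apply hE ν (s * s') ((s'⁻¹ • g) * g'), ContinuousLinearEquiv.symm_apply_apply,
    ← rho_mul, ← rho_mul, adRho_apply, adRho_apply, ContinuousLinearEquiv.symm_apply_apply,
    ContinuousLinearEquiv.symm_apply_apply]

theorem adRho_one (hE : E.IsLift S) (ν : Measure Γτ) [ν.IsHaarMeasure]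
    (T : TwistedL2 E ν →L[ℂ] TwistedL2 E ν) : adRho hE ν (1 : S) 1 T = T := by
  have h : ∀ f, rho hE ν (1 : S) 1 f = f := rhoLinear_one hE ν
  ext1 f
  obtain ⟨f, rfl⟩ := (rho hE ν (1 : S) 1).surjective f
  rw [adRho_apply, ContinuousLinearEquiv.symm_apply_apply, h, h]

theorem adRho_add (hE : E.IsLift S) (ν : Measure Γτ) [ν.IsHaarMeasure] (s : S) (g : Γτ)
    (T T' : TwistedL2 E ν →L[ℂ] TwistedL2 E ν) :
    adRho hE ν s g (T + T') = adRho hE ν s g T + adRho hE ν s g T' := by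
  ext1 f; simp [adRho_apply]

theorem adRho_smul (hE : E.IsLift S) (ν : Measure Γτ) [ν.IsHaarMeasure] (s : S) (g : Γτ)
    (k : ℂ) (T : TwistedL2 E ν →L[ℂ] TwistedL2 E ν) :
    adRho hE ν s g (k • T) = k • adRho hE ν s g T := by
  ext1 f; simp [adRho_apply]

theorem adRho_mul (hE : E.IsLift S) (ν : Measure Γτ) [ν.IsHaarMeasure] (s : S) (g : Γτ)
    (T T' : TwistedL2 E ν →L[ℂ] TwistedL2 E ν) :
    adRho hE ν s g (T * T') = adRho hE ν s g T * adRho hE ν s g T' := by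
  ext1 f; simp [adRho_apply]

theorem adRho_star (hE : E.IsLift S) (ν : Measure Γτ) [ν.IsHaarMeasure] (s : S) (g : Γτ)
    (T : TwistedL2 E ν →L[ℂ] TwistedL2 E ν) :
    adRho hE ν s g (star T) = star (adRho hE ν s g T) := by
  obtain ⟨c, -, hc⟩ := exists_inner_rhoLinear hE ν s g
  have hc' : ∀ f₁ f₂ : TwistedL2 E ν,
      inner ℂ (rho hE ν s g f₁) (rho hE ν s g f₂) = (c : ℂ) * inner ℂ f₁ f₂ := hc
  ext1 f₁
  refine ext_inner_right ℂ fun f₂ => ?_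
  rw [ContinuousLinearMap.star_eq_adjoint, ContinuousLinearMap.star_eq_adjoint,
    ContinuousLinearMap.adjoint_inner_left]
  obtain ⟨f₁, rfl⟩ := (rho hE ν s g).surjective f₁
  obtain ⟨f₂, rfl⟩ := (rho hE ν s g).surjective f₂
  simp only [adRho_apply, ContinuousLinearEquiv.symm_apply_apply, hc',
    ContinuousLinearMap.adjoint_inner_left]

theorem continuous_adRho (hE : E.IsLift S) (ν : Measure Γτ) [ν.IsHaarMeasure] (s : S) (g : Γτ) :
    Continuous (adRho hE ν s g) :=
  continuous_const.clm_comp (continuous_id.clm_comp continuous_const)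

theorem isCompactOperator_adRho (hE : E.IsLift S) (ν : Measure Γτ) [ν.IsHaarMeasure] (s : S)
    (g : Γτ) {T : TwistedL2 E ν →L[ℂ] TwistedL2 E ν} (hT : IsCompactOperator T) :
    IsCompactOperator (adRho hE ν s g T) :=
  (hT.comp_clm ((rho hE ν s g).symm : TwistedL2 E ν →L[ℂ] TwistedL2 E ν)).clm_comp
    (rho hE ν s g : TwistedL2 E ν →L[ℂ] TwistedL2 E ν)

end Rho

/-! ### Compact operators and the generalized fixed point algebra -/

theorem isCompactOperator_star {H : Type*} [NormedAddCommGroup H] [InnerProductSpace ℂ H]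
    [CompleteSpace H] {T : H →L[ℂ] H} (hT : IsCompactOperator T) :
    IsCompactOperator (star T : H →L[ℂ] H) := by
  have h1 : IsCompactOperator (T ∘L star T) := hT.comp_clm (star T)
  have h2 : TotallyBounded ((T ∘L star T) '' Metric.closedBall 0 1) :=
    (IsCompactOperator.isCompact_closure_image_closedBall
      (f := (T ∘L star T).toLinearMap) h1 1).totallyBounded.subset subset_closure
  refine (isCompactOperator_iff_isCompact_closure_image_closedBall
    (star T).toLinearMap zero_lt_one).2 ?_
  refine TotallyBounded.isCompact_of_isClosed (TotallyBounded.closure ?_) isClosed_closure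
  rw [Metric.totallyBounded_iff]
  intro ε hε
  obtain ⟨t, ht, htf, hcov⟩ := Metric.finite_approx_of_totallyBounded h2 (ε ^ 2 / 2) (by positivity)
  obtain ⟨u, hu, huf, rfl⟩ := Set.exists_subset_image_finite_and.1 ⟨t, ht, htf, rfl⟩
  refine ⟨(fun v => (star T : H →L[ℂ] H) v) '' u, huf.image _, ?_⟩
  rintro _ ⟨x, hx, rfl⟩
  have hx' := hcov ⟨x, hx, rfl⟩
  simp only [Set.mem_iUnion, exists_prop, Set.mem_image, exists_exists_and_eq_and] at hx' ⊢
  obtain ⟨y, hy, hxy⟩ := hx'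
  refine ⟨y, hy, ?_⟩
  have hy1 := hu hy
  rw [Metric.mem_ball, dist_eq_norm] at hxy ⊢
  rw [mem_closedBall_zero_iff] at hx hy1
  have hn : ‖x - y‖ ≤ 2 := (norm_sub_le _ _).trans (by linarith)
  have e : ‖star T (x - y)‖ ^ 2 ≤ ‖T (star T (x - y))‖ * ‖x - y‖ := by
    have h := ContinuousLinearMap.adjoint_inner_left T (star T (x - y)) (x - y)
    have h' := inner_self_eq_norm_sq_to_K (𝕜 := ℂ) (star T (x - y))
    rw [ContinuousLinearMap.star_eq_adjoint] at h' ⊢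
    rw [ContinuousLinearMap.star_eq_adjoint, h'] at h
    have h3 := norm_inner_le_norm (𝕜 := ℂ) (x - y) (T (ContinuousLinearMap.adjoint T (x - y)))
    rw [← h] at h3
    rw [mul_comm]
    refine le_trans (le_of_eq ?_) h3
    simp
  have e2 : (star T).toLinearMap x - star T y = star T (x - y) := (map_sub (star T) x y).symm
  have e3 : (T ∘L star T) x - (T ∘L star T) y = T (star T (x - y)) := by simp
  rw [e2]
  rw [e3] at hxy
  refine lt_of_pow_lt_pow_left₀ 2 hε.le (e.trans_lt ?_)
  nlinarith [norm_nonneg (T (star T (x - y))), norm_nonneg (x - y)]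

section OperatorFunctions

/-- The `C*`-algebra of bounded (norm) continuous functions from `X` to the bounded operators on
a Hilbert space `H`. -/
def OperatorFunctions (X H : Type*) [TopologicalSpace X] [NormedAddCommGroup H]
    [InnerProductSpace ℂ H] : Type _ :=
  BoundedContinuousFunction X (H →L[ℂ] H)

namespace OperatorFunctions

variable {X H : Type*} [TopologicalSpace X] [NormedAddCommGroup H] [InnerProductSpace ℂ H]

instance [CompleteSpace H] : NonUnitalCStarAlgebra (OperatorFunctions X H) :=
  inferInstanceAs (NonUnitalCStarAlgebra (BoundedContinuousFunction X (H →L[ℂ] H)))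

instance : FunLike (OperatorFunctions X H) X (H →L[ℂ] H) :=
  inferInstanceAs (FunLike (BoundedContinuousFunction X (H →L[ℂ] H)) X (H →L[ℂ] H))

theorem ext {F F' : OperatorFunctions X H} (h : ∀ x, F x = F' x) : F = F' :=
  BoundedContinuousFunction.ext h

theorem continuous (F : OperatorFunctions X H) : Continuous F :=
  BoundedContinuousFunction.continuous F

/-- A bounded continuous function as an element of `OperatorFunctions X H`. -/
def mk (F : X → (H →L[ℂ] H)) (hF : Continuous F) (C : ℝ) (hC : ∀ x, ‖F x‖ ≤ C) :
    OperatorFunctions X H :=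
  BoundedContinuousFunction.ofNormedAddCommGroup F hF C hC

variable [CompleteSpace H]

theorem norm_apply_le (F : OperatorFunctions X H) (x : X) : ‖F x‖ ≤ ‖F‖ :=
  BoundedContinuousFunction.norm_coe_le_norm (β := H →L[ℂ] H) F x

theorem norm_le {F : OperatorFunctions X H} {C : ℝ} (hC : 0 ≤ C) (h : ∀ x, ‖F x‖ ≤ C) :
    ‖F‖ ≤ C :=
  (BoundedContinuousFunction.norm_le (β := H →L[ℂ] H) (f := F) hC).2 h

theorem zero_apply (x : X) : (0 : OperatorFunctions X H) x = 0 := rfl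

theorem add_apply (F F' : OperatorFunctions X H) (x : X) : (F + F') x = F x + F' x := rfl

theorem mul_apply (F F' : OperatorFunctions X H) (x : X) : (F * F') x = F x * F' x := rfl

theorem smul_apply (k : ℂ) (F : OperatorFunctions X H) (x : X) : (k • F) x = k • F x := rfl

theorem star_apply (F : OperatorFunctions X H) (x : X) : (star F) x = star (F x) := rfl

end OperatorFunctions

end OperatorFunctions

section FixedPoint

variable {S Γ Γτ X : Type*} [Group S] [TopologicalSpace S] [Group Γ] [TopologicalSpace Γ]
  [Group Γτ] [TopologicalSpace Γτ] [IsTopologicalGroup Γτ] [LocallyCompactSpace Γτ]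
  [SecondCountableTopology Γτ] [MeasurableSpace Γτ] [BorelSpace Γτ]
  [MulDistribMulAction S Γ] [MulDistribMulAction S Γτ] [ContinuousSMul S Γτ]
  {E : CentralExtension Γ Γτ} [TopologicalSpace X] [MulAction Γ X]

/-- The generalized fixed point algebra `C₀(X ×_Γ 𝕂)` for `𝕂 = 𝕂(L²_τ(Γ))`: the continuous maps
`F : X → 𝕂` which are `Γ`-equivariant for the adjoint action (the action of `Γτ` by `Ad ρ`
descends to `Γ`) and vanish at infinity in `X/Γ`. (Such maps are automatically bounded.) -/
def fixedPointAlgebra (hE : E.IsLift S) (ν : Measure Γτ) [ν.IsHaarMeasure] (X : Type*)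
    [TopologicalSpace X] [MulAction Γ X] :
    NonUnitalStarSubalgebra ℂ (OperatorFunctions X (TwistedL2 E ν)) where
  carrier := {F | (∀ x, IsCompactOperator (F x)) ∧
    (∀ (g : Γτ) (x : X), F (E.proj g • x) = adRho hE ν (1 : S) g (F x)) ∧
    Tendsto F (comap (Quotient.mk (MulAction.orbitRel Γ X))
      (cocompact (MulAction.orbitRel.Quotient Γ X))) (𝓝 0)}
  zero_mem' := ⟨fun _ => isCompactOperator_zero, fun g x => by
    ext1 f; simp [adRho_apply, OperatorFunctions.zero_apply], tendsto_const_nhds⟩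
  add_mem' {F F'} h h' := ⟨fun x => (h.1 x).add (h'.1 x), fun g x => by
    simp only [OperatorFunctions.add_apply, h.2.1, h'.2.1, adRho_add], by
    have := h.2.2.add h'.2.2
    rw [add_zero] at this
    exact this⟩
  mul_mem' {F F'} h h' := ⟨fun x => (h.1 x).comp_clm (F' x), fun g x => by
    simp only [OperatorFunctions.mul_apply, h.2.1, h'.2.1, adRho_mul], by
    have := h.2.2.mul h'.2.2
    rw [mul_zero] at this
    exact this⟩
  smul_mem' k F h := ⟨fun x => (h.1 x).smul k, fun g x => by
    simp only [OperatorFunctions.smul_apply, h.2.1, adRho_smul], by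
    have := h.2.2.const_smul k
    rw [smul_zero] at this
    exact this⟩
  star_mem' {F} h := ⟨fun x => isCompactOperator_star (h.1 x), fun g x => by
    simp only [OperatorFunctions.star_apply, h.2.1, adRho_star], by
    have := h.2.2.star
    rw [star_zero] at this
    exact this⟩

variable [MulAction S X] [ContinuousSMul S X]

/-- `(s · F)(x) = Ad(ρ(s)) (F (s⁻¹ x))` on bounded operator valued functions. -/
def boundedAct (hE : E.IsLift S) (ν : Measure Γτ) [ν.IsHaarMeasure] (s : S)
    (F : OperatorFunctions X (TwistedL2 E ν)) : OperatorFunctions X (TwistedL2 E ν) :=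
  OperatorFunctions.mk (fun x => adRho hE ν s 1 (F (s⁻¹ • x)))
    ((continuous_adRho hE ν s 1).comp (F.continuous.comp (continuous_const_smul s⁻¹)))
    (‖(rho hE ν s 1 : TwistedL2 E ν →L[ℂ] TwistedL2 E ν)‖ *
      (‖F‖ * ‖((rho hE ν s 1).symm : TwistedL2 E ν →L[ℂ] TwistedL2 E ν)‖)) fun x => by
      refine (ContinuousLinearMap.opNorm_comp_le _ _).trans ?_
      gcongr
      refine (ContinuousLinearMap.opNorm_comp_le _ _).trans ?_
      gcongr
      exact F.norm_apply_le _

theorem boundedAct_apply (hE : E.IsLift S) (ν : Measure Γτ) [ν.IsHaarMeasure] (s : S)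
    (F : OperatorFunctions X (TwistedL2 E ν)) (x : X) :
    boundedAct hE ν s F x = adRho hE ν s 1 (F (s⁻¹ • x)) := rfl

/-- The homeomorphism of `X/Γ` induced by `s ∈ S`. -/
def quotientHomeomorph (hX : ∀ (s : S) (γ : Γ) (x : X), s • γ • x = (s • γ) • s • x) (s : S) :
    MulAction.orbitRel.Quotient Γ X ≃ₜ MulAction.orbitRel.Quotient Γ X :=
  have h : ∀ (s : S) (x y : X), MulAction.orbitRel Γ X x y →
      MulAction.orbitRel Γ X (s • x) (s • y) := by
    rintro s _ y ⟨γ, rfl⟩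
    exact ⟨s • γ, (hX s γ y).symm⟩
  { toFun := Quotient.map (fun x => s • x) (h s)
    invFun := Quotient.map (fun x => s⁻¹ • x) (h s⁻¹)
    left_inv := by
      rintro ⟨x⟩
      exact congrArg (Quotient.mk _) (inv_smul_smul s x)
    right_inv := by
      rintro ⟨x⟩
      exact congrArg (Quotient.mk _) (smul_inv_smul s x)
    continuous_toFun := (continuous_const_smul s).quotient_map' (h s)
    continuous_invFun := (continuous_const_smul s⁻¹).quotient_map' (h s⁻¹) }

theorem boundedAct_mem (hE : E.IsLift S) (ν : Measure Γτ) [ν.IsHaarMeasure]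
    (hX : ∀ (s : S) (γ : Γ) (x : X), s • γ • x = (s • γ) • s • x) (s : S)
    {F : OperatorFunctions X (TwistedL2 E ν)}
    (hF : F ∈ fixedPointAlgebra hE ν X) : boundedAct hE ν s F ∈ fixedPointAlgebra hE ν X := by
  refine ⟨fun x => isCompactOperator_adRho hE ν s 1 (hF.1 _), fun g x => ?_, ?_⟩
  · rw [boundedAct_apply, boundedAct_apply, hX, ← hE.proj_smul, hF.2.1, adRho_adRho, adRho_adRho]
    simp
  · have h1 : Tendsto (fun x : X => s⁻¹ • x)
        (comap (Quotient.mk (MulAction.orbitRel Γ X)) (cocompact (MulAction.orbitRel.Quotient Γ X)))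
        (comap (Quotient.mk (MulAction.orbitRel Γ X))
          (cocompact (MulAction.orbitRel.Quotient Γ X))) :=
      tendsto_comap_iff.2 (((quotientHomeomorph hX s⁻¹).isClosedEmbedding.tendsto_cocompact).comp
        tendsto_comap)
    have h2 := ((continuous_adRho hE ν s 1).tendsto 0).comp (hF.2.2.comp h1)
    have h3 : adRho hE ν s (1 : Γτ) 0 = 0 := by ext1 f; simp [adRho_apply]
    rw [h3] at h2
    exact h2

/-- The action of `S` on `C₀(X ×_Γ 𝕂)`, `(s · F)(x) = Ad(ρ(s)) (F (s⁻¹ x))`. -/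
def fixedPointAct (hE : E.IsLift S) (ν : Measure Γτ) [ν.IsHaarMeasure]
    (hX : ∀ (s : S) (γ : Γ) (x : X), s • γ • x = (s • γ) • s • x) :
    S →* (fixedPointAlgebra hE ν X ≃⋆ₐ[ℂ] fixedPointAlgebra hE ν X) where
  toFun s :=
    { toFun := fun F => ⟨boundedAct hE ν s F, boundedAct_mem hE ν hX s F.2⟩
      invFun := fun F => ⟨boundedAct hE ν s⁻¹ F, boundedAct_mem hE ν hX s⁻¹ F.2⟩
      left_inv := fun F => Subtype.ext <| OperatorFunctions.ext fun x => by
        simp [boundedAct_apply, adRho_adRho, adRho_one]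
      right_inv := fun F => Subtype.ext <| OperatorFunctions.ext fun x => by
        simp [boundedAct_apply, adRho_adRho, adRho_one]
      map_mul' := fun F F' => Subtype.ext <| OperatorFunctions.ext fun x =>
        adRho_mul hE ν s 1 _ _
      map_add' := fun F F' => Subtype.ext <| OperatorFunctions.ext fun x =>
        adRho_add hE ν s 1 _ _
      map_star' := fun F => Subtype.ext <| OperatorFunctions.ext fun x =>
        adRho_star hE ν s 1 _
      map_smul' := fun k F => Subtype.ext <| OperatorFunctions.ext fun x =>
        adRho_smul hE ν s 1 k _ }
  map_one' := StarAlgEquiv.ext fun F => Subtype.ext <| OperatorFunctions.ext fun x => by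
    change adRho hE ν 1 1 (F.1 ((1 : S)⁻¹ • x)) = F.1 x
    rw [inv_one, one_smul, adRho_one]
  map_mul' s t := StarAlgEquiv.ext fun F => Subtype.ext <|
    OperatorFunctions.ext fun x => by
    change adRho hE ν (s * t) 1 (F.1 ((s * t)⁻¹ • x)) =
      adRho hE ν s 1 (adRho hE ν t 1 (F.1 (t⁻¹ • s⁻¹ • x)))
    rw [adRho_adRho, smul_one, mul_one, mul_inv_rev, mul_smul]

end FixedPoint

/-! ### Functions on `X` -/

section Functions

variable {G X : Type*} [Group G] [MulAction G X] [TopologicalSpace X] [ContinuousConstSMul G X]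

/-- The action `(g · f)(x) = f(g⁻¹ x)` of `G` on `C₀(X)`. -/
def translationAct (G X : Type*) [Group G] [MulAction G X] [TopologicalSpace X]
    [ContinuousConstSMul G X] : G →* (C₀(X, ℂ) ≃⋆ₐ[ℂ] C₀(X, ℂ)) where
  toFun g :=
    { toFun := fun f => f.comp (Homeomorph.smul g⁻¹).toCocompactMap
      invFun := fun f => f.comp (Homeomorph.smul g).toCocompactMap
      left_inv := fun f => ZeroAtInftyContinuousMap.ext fun x => congrArg f (inv_smul_smul g x)
      right_inv := fun f => ZeroAtInftyContinuousMap.ext fun x => congrArg f (smul_inv_smul g x)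
      map_mul' := fun _ _ => rfl
      map_add' := fun _ _ => rfl
      map_star' := fun _ => rfl
      map_smul' := fun _ _ => rfl }
  map_one' := StarAlgEquiv.ext fun f => ZeroAtInftyContinuousMap.ext fun x => by
    change f ((1 : G)⁻¹ • x) = f x
    rw [inv_one, one_smul]
  map_mul' g h := StarAlgEquiv.ext fun f => ZeroAtInftyContinuousMap.ext fun x => by
    change f ((g * h)⁻¹ • x) = f (h⁻¹ • g⁻¹ • x)
    rw [mul_inv_rev, mul_smul]

theorem translationAct_apply (g : G) (f : C₀(X, ℂ)) (x : X) :
    translationAct G X g f x = f (g⁻¹ • x) := rfl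

theorem translationAct_compat {S Γ : Type*} [Group S] [Group Γ] [MulDistribMulAction S Γ]
    [MulAction Γ X] [MulAction S X] [ContinuousConstSMul Γ X] [ContinuousConstSMul S X]
    (hX : ∀ (s : S) (γ : Γ) (x : X), s • γ • x = (s • γ) • s • x) (s : S) (γ : Γ)
    (f : C₀(X, ℂ)) :
    translationAct S X s (translationAct Γ X γ f) =
      translationAct Γ X (s • γ) (translationAct S X s f) := by
  refine ZeroAtInftyContinuousMap.ext fun x => ?_
  simp only [translationAct_apply]
  rw [hX, smul_inv', inv_smul_smul]

end Functions

/-! ### Haar measure on the central extension -/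

theorem CentralExtension.IsLift.measurePreserving {S Γ Γτ : Type*} [Group S] [TopologicalSpace S]
    [Group Γ] [TopologicalSpace Γ] [IsTopologicalGroup Γ] [MeasurableSpace Γ]
    [BorelSpace Γ] [Group Γτ] [TopologicalSpace Γτ]
    [IsTopologicalGroup Γτ] [LocallyCompactSpace Γτ] [SecondCountableTopology Γτ]
    [MeasurableSpace Γτ] [BorelSpace Γτ] [MulDistribMulAction S Γ] [MulDistribMulAction S Γτ]
    [LocallyCompactSpace Γ] [ContinuousSMul S Γ] [ContinuousSMul S Γτ]
    {E : CentralExtension Γ Γτ} (hE : E.IsLift S)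
    {μ : Measure Γ} [μ.IsHaarMeasure]
    (hμ : ∀ s : S, MeasurePreserving (fun γ : Γ => s • γ) μ μ) {ν : Measure Γτ}
    [ν.IsHaarMeasure] (hν : ν.map E.proj = μ) (s : S) :
    MeasurePreserving (fun g : Γτ => s • g) ν ν := by
  have hp : Measurable E.proj := E.isOpenQuotientMap_proj.continuous.measurable
  have hs : Measurable (fun g : Γτ => s • g) := (continuous_const_smul s).measurable
  have h1 : (ν.map (fun g : Γτ => s • g)).IsHaarMeasure :=
    ContinuousMulEquiv.isHaarMeasure_map ν (smulContinuousMulEquiv s)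
  have h2 := Measure.isMulLeftInvariant_eq_smul (ν.map (fun g : Γτ => s • g)) ν
  set c := Measure.haarScalarFactor (ν.map (fun g : Γτ => s • g)) ν
  have h3 : (ν.map (fun g : Γτ => s • g)).map E.proj = μ := by
    rw [Measure.map_map hp hs]
    have : (E.proj ∘ fun g : Γτ => s • g) = (fun γ : Γ => s • γ) ∘ E.proj :=
      funext fun g => hE.proj_smul s g
    rw [this, ← Measure.map_map (hμ s).measurable hp, hν, (hμ s).map_eq]
  have h4 : c • μ = μ := by rw [← hν, ← Measure.map_smul, ← h2, h3, hν]
  obtain ⟨K⟩ : Nonempty (TopologicalSpace.PositiveCompacts Γ) := inferInstance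
  have h5 : (c : ℝ≥0∞) * μ K = 1 * μ K := by
    rw [one_mul]
    exact congrArg (fun m : Measure Γ => m K) h4
  have h6 : c = 1 := by
    have := (ENNReal.mul_left_inj (Measure.measure_pos_of_nonempty_interior μ K.interior_nonempty).ne'
      K.isCompact.measure_ne_top).1 h5
    exact_mod_cast this
  exact ⟨hs, by rw [h2, h6, one_smul]⟩

/-- Strong continuity of an action of `S` on `B` by `*`-automorphisms. An `S`-`C*`-algebra is a
`C*`-algebra with such an action. -/
def IsStronglyContinuous {S B : Type*} [Group S] [TopologicalSpace S] [TopologicalSpace B]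
    [Mul B] [Add B] [Star B] [SMul ℂ B] (θ : S →* (B ≃⋆ₐ[ℂ] B)) : Prop :=
  ∀ b : B, Continuous fun s => θ s b

end

/-! Each point `x` of `X` carries a covariant pair on `L²_τ(Γ)`, `fiberPair`: a function `φ` acts as
multiplication by `g ↦ φ(p(g) x)`, and `Γτ` acts by left translation. Its integrated form is
Rieffel's operator (`integratedForm_fiberPair_coeFn`). So evaluating a universal family at these
pairs gives the map `Φ`, which is a `*`-homomorphism for free (`sectionHom`). Right translation by
`g` intertwines the pairs at `x` and `p(g) x`, and `ρ(s)` intertwines the pair at `s⁻¹ x` with the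
twist by `s` of the pair at `x` (`intertwines_rho_right`, `intertwines_rho_left`). Such relations
extend from the generators to the whole crossed product (`CovariantPair.Intertwines.eval`), which
yields `Γ`-equivariance of the sections and `S`-equivariance of `Φ`. Properness of the `Γ`-action
does the rest on this side. After cutting off by a compactly supported function on `X` the fibre
operator has a continuous compactly supported kernel, so it is compact; it depends continuously on
`x` and is zero on orbits missing the support of the cutoff.

Injectivity says that the fibre pairs detect every other covariant pair `(π, u)`. For `a`, a
homogeneous `b` and a compactly supported `χ`, a Cauchy–Schwarz estimate in commutative coefficients
bounds the integrated form of the convolution `a * b`, applied to `π(χ) v`, by two square integrals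
along orbits (`CovariantPair.norm_integratedForm_π_apply_sq_le`). The one of `χ` is bounded by
properness. The one of `a * b` is at most the square of the norm of the fibre operator of `a`
applied to the restriction of `b` to the orbit (`integral_norm_convolution_orbit_sq_le`). If `Φ(T) =
0` and `a` approximates `T`, these fibre operators are small. Hence `T b π(χ) = 0`, then `T b = 0`
on removing the cutoff, and finally `T T* = 0` (`injective_sectionHom`).

An injective `*`-homomorphism of `C*`-algebras is isometric and has closed range, so surjectivity
reduces to density. Given an equivariant `F`, take `χ ≥ 0` of compact support with integral one
along each orbit on which `F` is not small. Equivariance gives `F(x) = ∫ Ad ρ(h) ((χ F)(h⁻¹ x)) dh`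
on those orbits. The compactly supported function `χ F` is close to a finite sum of terms `φ T`,
with `T` a combination of rank one operators on continuous compactly supported vectors. The average
of `φ` times a rank one operator is the fibre operator of an explicit homogeneous function
(`averagedRankOne`, `isAverage_averagedRankOne`). The averages are taken weakly, on dense vectors,
and `exists_norm_sub_integratedForm_le` assembles the estimate.

Strong continuity on the crossed product is an `L¹` estimate on the dense set of functions. On the
fixed point algebra it is transported along `Φ`. -/

noncomputable section

set_option linter.unusedSectionVars false

/-! ### The modular function -/

section Modular

open MeasureTheory.Measure

variable {G : Type*} [Group G] [TopologicalSpace G] [IsTopologicalGroup G]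
  [LocallyCompactSpace G] [SecondCountableTopology G] [MeasurableSpace G] [BorelSpace G]

theorem map_mul_right_eq_modularCharacterFun_smul (ν : Measure G) [ν.IsHaarMeasure] (g : G) :
    ν.map (· * g) = modularCharacterFun g • ν := by
  rw [modularCharacterFun_eq_haarScalarFactor ν g]
  exact isMulLeftInvariant_eq_smul _ ν

theorem lintegral_mul_right_eq (ν : Measure G) [ν.IsHaarMeasure] (f : G → ℝ≥0∞)
    (hf : Measurable f) (g : G) :
    ∫⁻ k, f (k * g) ∂ν = modularCharacterFun g * ∫⁻ k, f k ∂ν := by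
  rw [← lintegral_map hf (measurable_mul_const g), map_mul_right_eq_modularCharacterFun_smul]
  exact lintegral_smul_measure _ _

theorem integral_mul_right_eq {F : Type*} [NormedAddCommGroup F] [NormedSpace ℝ F]
    (ν : Measure G) [ν.IsHaarMeasure] (f : G → F) (g : G) :
    ∫ k, f (k * g) ∂ν = (modularCharacterFun g : ℝ) • ∫ k, f k ∂ν := by
  refine ((Homeomorph.mulRight g).measurableEmbedding.integral_map f).symm.trans ?_
  change ∫ k, f k ∂(ν.map (· * g)) = _
  rw [map_mul_right_eq_modularCharacterFun_smul, integral_smul_nnreal_measure]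
  rfl

/-- The modular function is the ratio of the integral of a right translated bump function to that of
the bump function itself, and the numerator varies continuously with the translation. -/
theorem continuous_modularCharacterFun : Continuous (modularCharacterFun : G → ℝ≥0) := by
  let ν : Measure G := MeasureTheory.Measure.haar
  obtain ⟨⟨f, f_cont⟩, f_comp, f_nonneg, f_one⟩ :
    ∃ f : C(G, ℝ), HasCompactSupport f ∧ 0 ≤ f ∧ f 1 ≠ 0 := exists_continuous_nonneg_pos 1
  have hpos : 0 < ∫ x, f x ∂ν :=
    f_cont.integral_pos_of_hasCompactSupport_nonneg_nonzero f_comp f_nonneg f_one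
  have h : ∀ g : G, (modularCharacterFun g : ℝ) = (∫ k, f (k * g) ∂ν) / ∫ k, f k ∂ν := fun g => by
    rw [integral_mul_right_eq, smul_eq_mul, mul_div_cancel_right₀ _ hpos.ne']
  rw [NNReal.isEmbedding_coe.continuous_iff]
  change Continuous fun g => (modularCharacterFun g : ℝ)
  simp only [h]
  refine Continuous.div_const (continuous_iff_continuousAt.2 fun g₀ => ?_) _
  obtain ⟨t, ht, htn⟩ := exists_compact_mem_nhds g₀
  have A : ContinuousOn (fun g => ∫ k, f (k * g) ∂ν) t := by
    apply continuousOn_integral_of_compact_support (f_comp.isCompact.mul ht.inv)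
    · exact (f_cont.comp (continuous_snd.mul continuous_fst)).continuousOn
    · intro g k hg hk
      contrapose! hk
      exact ⟨k * g, subset_tsupport _ hk, g⁻¹, Set.inv_mem_inv.2 hg, by simp⟩
  exact A.continuousAt htn

theorem modularCharacterFun_ne_zero (g : G) : modularCharacterFun g ≠ 0 :=
  (modularCharacterFun_pos g).ne'

/-- Right translation by a central element is left translation, which preserves Haar measure. This
makes the modular function of `Γτ` invariant under `U(1)`. -/
theorem modularCharacterFun_of_central {g : G} (hg : ∀ k, g * k = k * g) :
    modularCharacterFun g = 1 := by
  let ν : Measure G := MeasureTheory.Measure.haar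
  have h := map_mul_right_eq_modularCharacterFun_smul ν g
  have h1 : (fun k : G => k * g) = fun k => g * k := funext fun k => (hg k).symm
  rw [h1, map_mul_left_eq_self] at h
  obtain ⟨K⟩ : Nonempty (TopologicalSpace.PositiveCompacts G) := inferInstance
  have h5 : (modularCharacterFun g : ℝ≥0∞) * ν K = 1 * ν K := by
    rw [one_mul]
    exact (congrArg (fun m : Measure G => m K) h).symm
  have := (ENNReal.mul_left_inj (Measure.measure_pos_of_nonempty_interior ν K.interior_nonempty).ne'
      K.isCompact.measure_ne_top).1 h5
  exact_mod_cast this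

theorem measurable_modularCharacterFun : Measurable (modularCharacterFun : G → ℝ≥0) :=
  continuous_modularCharacterFun.measurable

/-- By uniqueness of Haar measure in explicit form: with `I` the left-hand side, a double integral
evaluated in two orders gives `I f * ∫ h = I f * I h`, and one `f` with `I f` finite and nonzero
allows cancelling. -/
theorem lintegral_inv_mul_modularCharacterFun (ν : Measure G) [ν.IsHaarMeasure] (f : G → ℝ≥0∞)
    (hf : Measurable f) :
    ∫⁻ g, f g⁻¹ * modularCharacterFun g ∂ν = ∫⁻ g, f g ∂ν := by
  have hD : Measurable fun g : G => (modularCharacterFun g : ℝ≥0∞) :=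
    measurable_modularCharacterFun.coe_nnreal_ennreal
  set I : (G → ℝ≥0∞) → ℝ≥0∞ := fun f => ∫⁻ g, f g⁻¹ * modularCharacterFun g ∂ν with hI
  -- Left invariance turns `∫ h(k) dk` into `∫ h(g⁻¹ k) dk`. After exchanging the integrals, `g ↦ k
  -- g` frees `h` from `k`, and right translation by `g` supplies the factor that `I h` needs.
  have key : ∀ f h : G → ℝ≥0∞, Measurable f → Measurable h →
      I f * ∫⁻ k, h k ∂ν = I f * I h := by
    intro f h hf hh
    have m1 : Measurable fun g => f g⁻¹ * (modularCharacterFun g : ℝ≥0∞) :=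
      (hf.comp measurable_inv).mul hD
    calc I f * ∫⁻ k, h k ∂ν
        = ∫⁻ g, f g⁻¹ * modularCharacterFun g * ∫⁻ k, h k ∂ν ∂ν :=
          (lintegral_mul_const _ m1).symm
      _ = ∫⁻ g, ∫⁻ k, f g⁻¹ * modularCharacterFun g * h (g⁻¹ * k) ∂ν ∂ν := by
          refine lintegral_congr fun g => ?_
          rw [lintegral_const_mul _ (by fun_prop), lintegral_mul_left_eq_self]
      _ = ∫⁻ k, ∫⁻ g, f g⁻¹ * modularCharacterFun g * h (g⁻¹ * k) ∂ν ∂ν := by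
          refine lintegral_lintegral_swap (Measurable.aemeasurable ?_)
          exact (m1.comp measurable_fst).mul
            (hh.comp (measurable_fst.inv.mul measurable_snd))
      _ = ∫⁻ k, ∫⁻ g, f (g⁻¹ * k⁻¹) * (modularCharacterFun k * modularCharacterFun g) * h g⁻¹
            ∂ν ∂ν := by
          refine lintegral_congr fun k => ?_
          rw [← lintegral_mul_left_eq_self _ k]
          refine lintegral_congr fun g => ?_
          rw [mul_inv_rev, modularCharacterFun_map_mul, ENNReal.coe_mul, inv_mul_cancel_right]
      _ = ∫⁻ g, ∫⁻ k, f (g⁻¹ * k⁻¹) * (modularCharacterFun k * modularCharacterFun g) * h g⁻¹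
            ∂ν ∂ν := by
          refine lintegral_lintegral_swap (Measurable.aemeasurable ?_)
          exact ((hf.comp (measurable_snd.inv.mul measurable_fst.inv)).mul
            ((hD.comp measurable_fst).mul (hD.comp measurable_snd))).mul
            (hh.comp measurable_snd.inv)
      _ = ∫⁻ g, I f * (h g⁻¹ * modularCharacterFun g) ∂ν := by
          refine lintegral_congr fun g => ?_
          have : ∀ k, f (g⁻¹ * k⁻¹) * (modularCharacterFun k * modularCharacterFun g) * h g⁻¹ =
              (fun k => f k⁻¹ * modularCharacterFun k) (k * g) * h g⁻¹ := fun k => by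
            simp only [mul_inv_rev, modularCharacterFun_map_mul, ENNReal.coe_mul]
          simp only [this]
          refine (lintegral_mul_const _ (m1.comp (measurable_mul_const g))).trans ?_
          refine (congrArg (· * h g⁻¹) (lintegral_mul_right_eq ν _ m1 g)).trans ?_
          change (modularCharacterFun g : ℝ≥0∞) * I f * h g⁻¹ = _
          ring
      _ = I f * I h := by
          rw [lintegral_const_mul]
          exact (hh.comp measurable_inv).mul hD
  obtain ⟨K⟩ : Nonempty (TopologicalSpace.PositiveCompacts G) := inferInstance
  have hKm : MeasurableSet (closure (K : Set G)) := isClosed_closure.measurableSet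
  -- The indicator of a compact set with interior: the modular function is bounded on the inverse
  -- set, so `I f₀` is finite, and positive there, so `I f₀` is not zero.
  set f₀ : G → ℝ≥0∞ := (closure (K : Set G)).indicator 1 with hf₀
  have hf₀m : Measurable f₀ := measurable_one.indicator hKm
  have hI' : I f₀ = ∫⁻ g in (closure (K : Set G))⁻¹, modularCharacterFun g ∂ν := by
    rw [← lintegral_indicator hKm.inv]
    refine lintegral_congr fun g => ?_
    by_cases hg : g⁻¹ ∈ closure (K : Set G)
    · rw [Set.indicator_of_mem (Set.mem_inv.2 hg), hf₀, Set.indicator_of_mem hg]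
      simp
    · rw [Set.indicator_of_notMem (by rwa [Set.mem_inv]), hf₀, Set.indicator_of_notMem hg]
      simp
  have hKc : IsCompact (closure (K : Set G))⁻¹ := K.isCompact.closure.inv
  have htop : I f₀ ≠ ⊤ := by
    rw [hI']
    obtain ⟨C, hC⟩ := hKc.bddAbove_image (continuous_modularCharacterFun (G := G)).continuousOn
    refine ne_top_of_le_ne_top ?_ (setLIntegral_mono (g := fun _ => (C : ℝ≥0∞)) measurable_const
      fun g hg => ?_)
    · rw [setLIntegral_const]
      exact ENNReal.mul_ne_top ENNReal.coe_ne_top hKc.measure_ne_top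
    · exact_mod_cast hC ⟨g, hg, rfl⟩
  have hzero : I f₀ ≠ 0 := by
    rw [hI', ← pos_iff_ne_zero, setLIntegral_pos_iff hD]
    have hs : Function.support (fun g : G => (modularCharacterFun g : ℝ≥0∞)) = Set.univ := by
      ext g
      simp [modularCharacterFun_ne_zero]
    rw [hs, Set.univ_inter]
    refine Measure.measure_pos_of_nonempty_interior ν ?_
    obtain ⟨x, hx⟩ := K.interior_nonempty.mono (interior_mono subset_closure)
    refine ⟨x⁻¹, mem_interior_iff_mem_nhds.2 ?_⟩
    have := continuous_inv.continuousAt (x := x⁻¹)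
      (by rw [inv_inv]; exact mem_interior_iff_mem_nhds.1 hx)
    exact this
  have := key f₀ f hf₀m hf
  rw [ENNReal.mul_right_inj hzero htop] at this
  exact this.symm

theorem map_inv_withDensity_modularCharacterFun (ν : Measure G) [ν.IsHaarMeasure] :
    (ν.withDensity fun g => (modularCharacterFun g : ℝ≥0∞)).map (·⁻¹) = ν := by
  refine Measure.ext_of_lintegral _ fun f hf => ?_
  rw [lintegral_map hf measurable_inv]
  refine (lintegral_withDensity_eq_lintegral_mul _
    measurable_modularCharacterFun.coe_nnreal_ennreal (hf.comp measurable_inv)).trans ?_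
  rw [← lintegral_inv_mul_modularCharacterFun ν f hf]
  refine lintegral_congr fun g => ?_
  rw [Pi.mul_apply, mul_comm]
  rfl

theorem integral_modularCharacterFun_smul_inv {F : Type*} [NormedAddCommGroup F]
    [NormedSpace ℝ F] (ν : Measure G) [ν.IsHaarMeasure] (f : G → F) :
    ∫ g, (modularCharacterFun g : ℝ) • f g⁻¹ ∂ν = ∫ g, f g ∂ν := by
  conv_rhs => rw [← map_inv_withDensity_modularCharacterFun ν]
  refine Eq.trans ?_ ((Homeomorph.inv G).measurableEmbedding.integral_map f).symm
  rw [integral_withDensity_eq_integral_smul measurable_modularCharacterFun]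
  rfl

end Modular

/-! ### Operators on `L²` spaces -/

section LpTools

variable {Y Z : Type*} [MeasurableSpace Y] [MeasurableSpace Z] {μ : Measure Y} {ν : Measure Z}

theorem setIntegral_norm_le_mul_norm_Lp {s : Set Z} (hs : MeasurableSet s) (hνs : ν s ≠ ∞)
    (f : Lp ℂ 2 ν) :
    ∫ z in s, ‖f z‖ ∂ν ≤ ‖indicatorConstLp 2 hs hνs (1 : ℝ)‖ * ‖f‖ := by
  have hf := (Lp.memLp f).norm
  have h1 : ∫ z in s, ‖f z‖ ∂ν = inner ℝ (indicatorConstLp 2 hs hνs (1 : ℝ)) hf.toLp := by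
    rw [L2.inner_indicatorConstLp_one hs hνs]
    exact integral_congr_ae (ae_restrict_of_ae hf.coeFn_toLp.symm)
  have h2 : ‖hf.toLp‖ = ‖f‖ := by
    rw [Lp.norm_toLp, eLpNorm_norm, Lp.norm_def]
  rw [h1, ← h2]
  exact real_inner_le_norm _ _

/-- A Bochner integral of `L²` functions is given almost everywhere by the pointwise integral. -/
theorem Lp.coeFn_integral_ae_eq [SigmaFinite μ] [SigmaFinite ν] {Φ : Y → Lp ℂ 2 ν}
    (hΦ : Integrable Φ μ) {F : Y → Z → ℂ}
    (hF : AEStronglyMeasurable (Function.uncurry F) (μ.prod ν))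
    (h : ∀ᵐ y ∂μ, Φ y =ᵐ[ν] F y) :
    ⇑(∫ y, Φ y ∂μ) =ᵐ[ν] fun z => ∫ y, F y z ∂μ := by
  -- Cauchy–Schwarz on a set of finite measure bounds the `L¹` norm of each slice by a multiple of
  -- `‖Φ y‖`, so Fubini applies over such sets.
  have hint : ∀ s, MeasurableSet s → ν s < ∞ →
      Integrable (Function.uncurry F) (μ.prod (ν.restrict s)) := by
    intro s hs hνs
    have hF' : AEStronglyMeasurable (Function.uncurry F) (μ.prod (ν.restrict s)) :=
      hF.mono_ac (Measure.AbsolutelyContinuous.rfl.prod Measure.absolutelyContinuous_restrict)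
    rw [integrable_prod_iff hF']
    constructor
    · filter_upwards [h] with y hy
      exact ((integrableOn_Lp_of_measure_ne_top (Φ y) (Fact.out) hνs.ne).congr
        (ae_restrict_of_ae hy))
    · refine (hΦ.norm.const_mul ‖indicatorConstLp 2 hs hνs.ne (1 : ℝ)‖).mono'
        hF'.norm.integral_prod_right' ?_
      filter_upwards [h] with y hy
      rw [Real.norm_of_nonneg (integral_nonneg fun _ => norm_nonneg _)]
      refine le_trans (le_of_eq ?_) (setIntegral_norm_le_mul_norm_Lp hs hνs.ne (Φ y))
      refine integral_congr_ae (ae_restrict_of_ae ?_)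
      filter_upwards [hy] with z hz
      rw [hz]
      rfl
  -- Both sides are compared by their integrals over sets of finite measure. Such an integral is an
  -- inner product with an indicator, hence commutes with the Bochner integral.
  refine ae_eq_of_forall_setIntegral_eq_of_sigmaFinite
    (fun s hs hνs => integrableOn_Lp_of_measure_ne_top _ (Fact.out) hνs.ne)
    (fun s hs hνs => (hint s hs hνs).integral_prod_right) fun s hs hνs => ?_
  rw [← L2.inner_indicatorConstLp_one (𝕜 := ℂ) hs hνs.ne, ← integral_inner hΦ,
    ← integral_integral_swap (hint s hs hνs)]
  refine integral_congr_ae ?_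
  filter_upwards [h] with y hy
  rw [L2.inner_indicatorConstLp_one hs hνs.ne]
  exact integral_congr_ae (ae_restrict_of_ae hy)

variable {H : Type*} [NormedAddCommGroup H] [NormedSpace ℂ H]

/-- Hilbert–Schmidt operators `f ↦ (y ↦ τ y f)` are compact. -/
theorem isCompactOperator_compLpL₂_flip (τ : Lp (H →L[ℂ] ℂ) 2 μ) :
    IsCompactOperator
      ((ContinuousLinearMap.compLpL₂ 2 μ (ContinuousLinearMap.apply ℂ ℂ)).flip τ :
        H →L[ℂ] Lp ℂ 2 μ) := by
  set Ψ : Lp (H →L[ℂ] ℂ) 2 μ →L[ℂ] H →L[ℂ] Lp ℂ 2 μ :=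
    (ContinuousLinearMap.compLpL₂ 2 μ (ContinuousLinearMap.apply ℂ ℂ)).flip with hΨ
  have hΨ' : ∀ τ f, Ψ τ f = ContinuousLinearMap.compLp
    ((ContinuousLinearMap.apply ℂ ℂ : H →L[ℂ] (H →L[ℂ] ℂ) →L[ℂ] ℂ) f) τ := fun _ _ => rfl
  clear_value Ψ
  -- An indicator times a functional gives a rank one operator; compact operators are closed under
  -- sums and norm limits.
  refine Lp.induction ENNReal.ofNat_ne_top (motive := fun τ => IsCompactOperator (Ψ τ)) ?_ ?_ ?_ τ
  · intro c s hs hμs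
    have : Ψ (Lp.simpleFunc.indicatorConst 2 hs hμs.ne c : Lp (H →L[ℂ] ℂ) 2 μ) =
        (ContinuousLinearMap.toSpanSingleton ℂ
          (indicatorConstLp 2 hs hμs.ne (1 : ℂ) : Lp ℂ 2 μ)) ∘L c := by
      ext1 f
      rw [hΨ']
      apply Lp.ext
      rw [Lp.simpleFunc.coe_indicatorConst]
      filter_upwards [ContinuousLinearMap.coeFn_compLp
          ((ContinuousLinearMap.apply ℂ ℂ : H →L[ℂ] (H →L[ℂ] ℂ) →L[ℂ] ℂ) f)
          (indicatorConstLp 2 hs hμs.ne c : Lp (H →L[ℂ] ℂ) 2 μ),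
        indicatorConstLp_coeFn (p := 2) (hs := hs) (hμs := hμs.ne) (c := c),
        indicatorConstLp_coeFn (p := 2) (hs := hs) (hμs := hμs.ne) (c := (1 : ℂ)),
        Lp.coeFn_smul (c f) (indicatorConstLp 2 hs hμs.ne (1 : ℂ) : Lp ℂ 2 μ)] with z h1 h2 h3 h4
      rw [h1, h2]
      change _ = (c f • (indicatorConstLp 2 hs hμs.ne (1 : ℂ) : Lp ℂ 2 μ) : Lp ℂ 2 μ) z
      rw [h4, Pi.smul_apply, h3]
      by_cases hz : z ∈ s <;> simp [hz]
    rw [this]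
    exact (isCompactOperator_of_locallyCompactSpace_rng (ContinuousLinearMap.toSpanSingleton ℂ
      (indicatorConstLp 2 hs hμs.ne (1 : ℂ) : Lp ℂ 2 μ))).comp_clm c
  · intro f g hf hg _ h1 h2
    simp only [map_add]
    exact h1.add h2
  · exact isClosed_setOfPred_isCompactOperator.preimage Ψ.continuous

theorem Lp.norm_sq_eq_integral (f : Lp ℂ 2 ν) : ‖f‖ ^ 2 = ∫ z, ‖f z‖ ^ 2 ∂ν := by
  have h := L2.inner_def (𝕜 := ℂ) f f
  rw [inner_self_eq_norm_sq_to_K] at h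
  apply Complex.ofReal_injective
  rw [← integral_complex_ofReal]
  refine Eq.trans ?_ (h.trans (integral_congr_ae (Eventually.of_forall fun z => ?_)))
  · push_cast; rfl
  · change inner ℂ (f z) (f z) = _
    rw [inner_self_eq_norm_sq_to_K]
    push_cast; rfl

end LpTools

section Kernels

variable {Y Z : Type*} [TopologicalSpace Y] [MeasurableSpace Y] [BorelSpace Y]
  [SecondCountableTopology Y] {μ : Measure Y} [IsFiniteMeasureOnCompacts μ]
  [TopologicalSpace Z] [MeasurableSpace Z] [BorelSpace Z]
  [SecondCountableTopology Z] {ν : Measure Z} [IsFiniteMeasureOnCompacts ν]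

/-- A continuous compactly supported kernel defines a compact operator on `L²`. -/
theorem exists_isCompactOperator_of_kernel [T2Space Y] [T2Space Z] {K : Y → Z → ℂ}
    (hK : Continuous (Function.uncurry K)) (hKc : HasCompactSupport (Function.uncurry K)) :
    ∃ T : Lp ℂ 2 ν →L[ℂ] Lp ℂ 2 μ, IsCompactOperator T ∧
      ∀ f : Lp ℂ 2 ν, T f =ᵐ[μ] fun y => ∫ z, K y z * f z ∂ν := by
  set C := Prod.snd '' tsupport (Function.uncurry K) with hC
  have hCc : IsCompact C := hKc.isCompact.image continuous_snd
  set B := Prod.fst '' tsupport (Function.uncurry K) with hB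
  have hBc : IsCompact B := hKc.isCompact.image continuous_fst
  have hzC : ∀ y z, z ∉ C → K y z = 0 := fun y z hz => by
    by_contra h
    exact hz ⟨(y, z), subset_tsupport _ h, rfl⟩
  have hzB : ∀ y z, y ∉ B → K y z = 0 := fun y z hz => by
    by_contra h
    exact hz ⟨(y, z), subset_tsupport _ h, rfl⟩
  have hcont : ∀ y, Continuous fun z => star (K y z) := fun y =>
    (hK.comp (Continuous.prodMk_right y)).star
  have hmem : ∀ y, MemLp (fun z => star (K y z)) 2 ν := fun y =>
    (hcont y).memLp_of_hasCompactSupport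
      (HasCompactSupport.intro hCc fun z hz => by rw [hzC y z hz, star_zero])
  -- The rows of the kernel are conjugated because the inner product is conjugate linear in the
  -- first variable.
  let τ : Y → Lp ℂ 2 ν := fun y => (hmem y).toLp
  -- Continuity of the rows in `L²` norm makes `y ↦ ⟨τ y, ·⟩` a continuous compactly supported
  -- function, hence a square integrable one, as the Hilbert–Schmidt criterion requires.
  have hτ : Continuous τ := by
    rw [continuous_iff_continuousAt]
    intro y₀
    have hn : ∀ y, ‖τ y - τ y₀‖ ^ 2 = ∫ z, ‖K y z - K y₀ z‖ ^ 2 ∂ν := fun y => by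
      rw [Lp.norm_sq_eq_integral]
      refine integral_congr_ae ?_
      filter_upwards [Lp.coeFn_sub (τ y) (τ y₀), (hmem y).coeFn_toLp, (hmem y₀).coeFn_toLp]
        with z h1 h2 h3
      rw [h1, Pi.sub_apply, h2, h3, ← star_sub, norm_star]
    have hc : Continuous fun y => ∫ z, ‖K y z - K y₀ z‖ ^ 2 ∂ν := by
      rw [← continuousOn_univ]
      refine continuousOn_integral_of_compact_support hCc ?_ ?_
      · have h2 : Continuous fun q : Y × Z => K y₀ q.2 :=
          hK.comp (continuous_const.prodMk continuous_snd)
        exact ((hK.sub h2).norm.pow 2).continuousOn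
      · intro y z _ hz
        rw [hzC y z hz, hzC y₀ z hz]
        simp
    have h0 : Tendsto (fun y => ‖τ y - τ y₀‖ ^ 2) (𝓝 y₀) (𝓝 0) := by
      simp only [hn]
      have := hc.tendsto y₀
      simpa using this
    have h1 := (Real.continuous_sqrt.tendsto 0).comp h0
    rw [Real.sqrt_zero] at h1
    refine tendsto_iff_norm_sub_tendsto_zero.2 (h1.congr fun y => ?_)
    exact Real.sqrt_sq (norm_nonneg _)
  let σ : Y → (Lp ℂ 2 ν →L[ℂ] ℂ) := fun y => innerSL ℂ (τ y)
  have hσ : Continuous σ := (innerSL ℂ).continuous.comp hτ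
  have hσB : HasCompactSupport σ := HasCompactSupport.intro hBc fun y hy => by
    have : τ y = 0 := by
      apply Lp.ext
      filter_upwards [(hmem y).coeFn_toLp, Lp.coeFn_zero ℂ 2 ν] with z h1 h2
      rw [h1, h2, hzB y z hy]
      simp
    simp only [σ, this, map_zero]
  have hσm : MemLp σ 2 μ := hσ.memLp_of_hasCompactSupport hσB
  refine ⟨_, isCompactOperator_compLpL₂_flip hσm.toLp, fun f => ?_⟩
  rw [ContinuousLinearMap.flip_apply, ContinuousLinearMap.compLpL₂_apply_apply]
  filter_upwards [ContinuousLinearMap.coeFn_compLp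
    ((ContinuousLinearMap.apply ℂ ℂ : _ →L[ℂ] (Lp ℂ 2 ν →L[ℂ] ℂ) →L[ℂ] ℂ) f) hσm.toLp,
    hσm.coeFn_toLp] with y h1 h2
  rw [h1, h2]
  change inner ℂ (τ y) f = _
  rw [L2.inner_def]
  refine integral_congr_ae ?_
  filter_upwards [(hmem y).coeFn_toLp] with z h3
  rw [h3, RCLike.inner_apply, mul_comm]
  congr 1
  exact star_star (K y z)

end Kernels

/-! ### The covariant pair on `L²_τ(Γ)` attached to a point -/

theorem ZeroAtInftyContinuousMap.norm_apply_le {X : Type*} [TopologicalSpace X] (φ : C₀(X, ℂ))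
    (x : X) : ‖φ x‖ ≤ ‖φ‖ :=
  φ.toBCF.norm_coe_le_norm x

theorem ZeroAtInftyContinuousMap.norm_le_of_forall_le {X : Type*} [TopologicalSpace X]
    {φ : C₀(X, ℂ)} {C : ℝ} (hC : 0 ≤ C) (h : ∀ x, ‖φ x‖ ≤ C) : ‖φ‖ ≤ C :=
  (BoundedContinuousFunction.norm_le (f := φ.toBCF) hC).2 h

theorem ZeroAtInftyContinuousMap.continuous_eval' {X : Type*} [TopologicalSpace X] :
    Continuous fun q : C₀(X, ℂ) × X => q.1 q.2 :=
  ((ZeroAtInftyContinuousMap.isometry_toBCF.continuous.comp continuous_fst).eval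
    continuous_snd : Continuous fun q : C₀(X, ℂ) × X => q.1.toBCF q.2)

namespace CentralExtension

variable {Γ Γτ : Type*} [Group Γ] [TopologicalSpace Γ] [Group Γτ] [TopologicalSpace Γτ]
  (E : CentralExtension Γ Γτ)

theorem proj_incl (z : Circle) : E.proj (E.incl z) = 1 := by
  have : E.incl z ∈ E.proj.ker := by rw [E.exact]; exact ⟨z, rfl⟩
  exact this

theorem proj_incl_inv_mul (z : Circle) (g : Γτ) : E.proj ((E.incl z)⁻¹ * g) = E.proj g := by
  rw [map_mul, map_inv, proj_incl, inv_one, one_mul]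

theorem incl_inv_central (z : Circle) (g : Γτ) : (E.incl z)⁻¹ * g = g * (E.incl z)⁻¹ := by
  rw [← map_inv, E.central]

end CentralExtension

section FiberPair

variable {Γ Γτ X : Type*} [Group Γ] [TopologicalSpace Γ] [Group Γτ] [TopologicalSpace Γτ]
  [IsTopologicalGroup Γτ] [LocallyCompactSpace Γτ] [T2Space Γτ] [SecondCountableTopology Γτ]
  [MeasurableSpace Γτ] [BorelSpace Γτ] [TopologicalSpace X] [MulAction Γ X] [ContinuousSMul Γ X]
  (E : CentralExtension Γ Γτ) (ν : Measure Γτ) [ν.IsHaarMeasure]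

/-- The inclusion of `L²_τ(Γ)` in `L²(Γτ)`. -/
def TwistedL2.toLpₗᵢ : TwistedL2 E ν →ₗᵢ[ℂ] Lp ℂ 2 ν := (twistedL2Submodule E ν).subtypeₗᵢ

theorem TwistedL2.norm_toLp (f : TwistedL2 E ν) : ‖f.toLp‖ = ‖f‖ := rfl

variable {E ν} in
theorem TwistedL2.homogeneous (f : TwistedL2 E ν) (z : Circle) :
    (fun g => f.toLp ((E.incl z)⁻¹ * g)) =ᵐ[ν] fun g => (z : ℂ) * f.toLp g := f.2 z

theorem continuous_orbit_eval (x : X) (φ : C₀(X, ℂ)) :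
    Continuous fun g : Γτ => φ (E.proj g • x) :=
  φ.continuous.comp (E.isOpenQuotientMap_proj.continuous.smul continuous_const)

theorem memLp_fiberMul (x : X) (φ : C₀(X, ℂ)) (f : Lp ℂ 2 ν) :
    MemLp (fun g => φ (E.proj g • x) * f g) 2 ν := by
  refine (Lp.memLp f).of_le_mul (c := ‖φ‖)
    ((continuous_orbit_eval E x φ).aestronglyMeasurable.mul (Lp.aestronglyMeasurable f))
    (Eventually.of_forall fun g => ?_)
  rw [norm_mul]
  gcongr
  exact φ.norm_apply_le _

/-- Multiplication by `g ↦ φ(g x)` on `L²_τ(Γ)`. -/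
def fiberMulLinear (x : X) (φ : C₀(X, ℂ)) : TwistedL2 E ν →ₗ[ℂ] TwistedL2 E ν where
  toFun f := ⟨(memLp_fiberMul E ν x φ f.toLp).toLp, fun z => by
    have h := (memLp_fiberMul E ν x φ f.toLp).coeFn_toLp
    filter_upwards [h, (measurePreserving_mul_left ν (E.incl z)⁻¹).quasiMeasurePreserving.ae h,
      f.homogeneous z] with g h1 h2 h3
    refine h2.trans ?_
    rw [h3, E.proj_incl_inv_mul]
    refine Eq.trans ?_ (congrArg (fun w => (z : ℂ) * w) h1.symm)
    ring⟩
  map_add' f₁ f₂ := by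
    apply TwistedL2.ext
    filter_upwards [(memLp_fiberMul E ν x φ (f₁ + f₂).toLp).coeFn_toLp,
      (memLp_fiberMul E ν x φ f₁.toLp).coeFn_toLp, (memLp_fiberMul E ν x φ f₂.toLp).coeFn_toLp,
      Lp.coeFn_add (memLp_fiberMul E ν x φ f₁.toLp).toLp (memLp_fiberMul E ν x φ f₂.toLp).toLp,
      Lp.coeFn_add f₁.toLp f₂.toLp] with g h1 h2 h3 h4 h5
    refine h1.trans (Eq.trans ?_ h4.symm)
    rw [Pi.add_apply, h2, h3, TwistedL2.toLp_add, h5, Pi.add_apply, mul_add]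
  map_smul' k f := by
    apply TwistedL2.ext
    filter_upwards [(memLp_fiberMul E ν x φ (k • f).toLp).coeFn_toLp,
      (memLp_fiberMul E ν x φ f.toLp).coeFn_toLp,
      Lp.coeFn_smul k (memLp_fiberMul E ν x φ f.toLp).toLp,
      Lp.coeFn_smul k f.toLp] with g h1 h2 h3 h4
    refine h1.trans (Eq.trans ?_ h3.symm)
    rw [Pi.smul_apply, h2, TwistedL2.toLp_smul, h4, Pi.smul_apply, smul_eq_mul, smul_eq_mul]
    ring

theorem fiberMulLinear_coeFn (x : X) (φ : C₀(X, ℂ)) (f : TwistedL2 E ν) :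
    (fiberMulLinear E ν x φ f).toLp =ᵐ[ν] fun g => φ (E.proj g • x) * f.toLp g :=
  (memLp_fiberMul E ν x φ f.toLp).coeFn_toLp

/-- Only the values of `φ` on the orbit of `x` enter, so the operator vanishes when the orbit misses
the support of `φ`; the bound by `‖φ‖` alone would not give this. -/
theorem norm_fiberMulLinear_le {x : X} {φ : C₀(X, ℂ)} {C : ℝ}
    (h : ∀ γ : Γ, ‖φ (γ • x)‖ ≤ C) (f : TwistedL2 E ν) :
    ‖fiberMulLinear E ν x φ f‖ ≤ C * ‖f‖ := by
  rw [← TwistedL2.norm_toLp, ← TwistedL2.norm_toLp E ν f]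
  refine Lp.norm_le_mul_norm_of_ae_le_mul ?_
  filter_upwards [fiberMulLinear_coeFn E ν x φ f] with g hg
  rw [hg, norm_mul]
  gcongr
  exact h _

/-- Multiplication by `g ↦ φ(g x)` on `L²_τ(Γ)` as a bounded operator. -/
def fiberMul (x : X) (φ : C₀(X, ℂ)) : TwistedL2 E ν →L[ℂ] TwistedL2 E ν :=
  (fiberMulLinear E ν x φ).mkContinuous ‖φ‖
    (norm_fiberMulLinear_le E ν fun _ => φ.norm_apply_le _)

theorem fiberMul_coeFn (x : X) (φ : C₀(X, ℂ)) (f : TwistedL2 E ν) :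
    (fiberMul E ν x φ f).toLp =ᵐ[ν] fun g => φ (E.proj g • x) * f.toLp g :=
  fiberMulLinear_coeFn E ν x φ f

/-- The representation of `C₀(X)` on `L²_τ(Γ)` through the orbit map of `x`. -/
def fiberRep (x : X) : C₀(X, ℂ) →⋆ₙₐ[ℂ] (TwistedL2 E ν →L[ℂ] TwistedL2 E ν) where
  toFun := fiberMul E ν x
  map_smul' k φ := by
    ext1 f
    apply TwistedL2.ext
    filter_upwards [fiberMul_coeFn E ν x (k • φ) f, fiberMul_coeFn E ν x φ f,
      Lp.coeFn_smul k (fiberMul E ν x φ f).toLp] with g h1 h2 h3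
    refine h1.trans (Eq.trans ?_ h3.symm)
    rw [Pi.smul_apply, h2, ZeroAtInftyContinuousMap.smul_apply, smul_eq_mul, smul_eq_mul, mul_assoc]
  map_zero' := by
    ext1 f
    apply TwistedL2.ext
    filter_upwards [fiberMul_coeFn E ν x 0 f, Lp.coeFn_zero ℂ 2 ν] with g h1 h2
    refine h1.trans (Eq.trans ?_ h2.symm)
    simp
  map_add' φ ψ := by
    ext1 f
    apply TwistedL2.ext
    filter_upwards [fiberMul_coeFn E ν x (φ + ψ) f, fiberMul_coeFn E ν x φ f,
      fiberMul_coeFn E ν x ψ f,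
      Lp.coeFn_add (fiberMul E ν x φ f).toLp (fiberMul E ν x ψ f).toLp] with g h1 h2 h3 h4
    refine h1.trans (Eq.trans ?_ h4.symm)
    rw [Pi.add_apply, h2, h3, ZeroAtInftyContinuousMap.add_apply, add_mul]
  map_mul' φ ψ := by
    ext1 f
    apply TwistedL2.ext
    filter_upwards [fiberMul_coeFn E ν x (φ * ψ) f, fiberMul_coeFn E ν x φ (fiberMul E ν x ψ f),
      fiberMul_coeFn E ν x ψ f] with g h1 h2 h3
    refine h1.trans (Eq.trans ?_ h2.symm)
    rw [h3, ZeroAtInftyContinuousMap.mul_apply, mul_assoc]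
  map_star' φ := by
    rw [ContinuousLinearMap.star_eq_adjoint, ContinuousLinearMap.eq_adjoint_iff]
    intro f f'
    rw [TwistedL2.inner_def, TwistedL2.inner_def, L2.inner_def, L2.inner_def]
    refine integral_congr_ae ?_
    filter_upwards [fiberMul_coeFn E ν x (star φ) f, fiberMul_coeFn E ν x φ f'] with g h1 h2
    rw [h1, h2, ZeroAtInftyContinuousMap.star_apply, RCLike.inner_apply, RCLike.inner_apply,
      map_mul, ← Complex.star_def, star_star]
    ring

theorem fiberRep_coeFn (x : X) (φ : C₀(X, ℂ)) (f : TwistedL2 E ν) :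
    (fiberRep E ν x φ f).toLp =ᵐ[ν] fun g => φ (E.proj g • x) * f.toLp g :=
  fiberMul_coeFn E ν x φ f

theorem norm_fiberRep_le {x : X} {φ : C₀(X, ℂ)} {C : ℝ} (hC : 0 ≤ C)
    (h : ∀ γ : Γ, ‖φ (γ • x)‖ ≤ C) : ‖fiberRep E ν x φ‖ ≤ C :=
  ContinuousLinearMap.opNorm_le_bound _ hC (norm_fiberMulLinear_le E ν h)

/-- Left translation on `L²_τ(Γ)` as a linear isometry. -/
def leftTranslationₗᵢ (g : Γτ) : TwistedL2 E ν →ₗᵢ[ℂ] TwistedL2 E ν where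
  toFun f := ⟨Lp.compMeasurePreserving (fun k => g⁻¹ * k) (measurePreserving_mul_left ν g⁻¹) f.toLp,
    fun z => by
      have hq := measurePreserving_mul_left ν g⁻¹
      have h := Lp.coeFn_compMeasurePreserving f.toLp hq
      filter_upwards [h, (measurePreserving_mul_left ν (E.incl z)⁻¹).quasiMeasurePreserving.ae h,
        hq.quasiMeasurePreserving.ae (f.homogeneous z)] with k h1 h2 h3
      rw [h1, h2]
      refine Eq.trans ?_ h3
      rw [Function.comp_apply, ← mul_assoc, ← E.incl_inv_central, mul_assoc]⟩
  map_add' _ _ := Subtype.ext (map_add _ _ _)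
  map_smul' k f := Subtype.ext
    (map_smul (Lp.compMeasurePreservingₗᵢ ℂ _ (measurePreserving_mul_left ν g⁻¹)) k f.toLp)
  norm_map' f := Lp.norm_compMeasurePreserving f.toLp (measurePreserving_mul_left ν g⁻¹)

theorem leftTranslationₗᵢ_coeFn (g : Γτ) (f : TwistedL2 E ν) :
    (leftTranslationₗᵢ E ν g f).toLp =ᵐ[ν] fun k => f.toLp (g⁻¹ * k) :=
  Lp.coeFn_compMeasurePreserving f.toLp (measurePreserving_mul_left ν g⁻¹)

theorem leftTranslationₗᵢ_mul (g h : Γτ) (f : TwistedL2 E ν) :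
    leftTranslationₗᵢ E ν (g * h) f = leftTranslationₗᵢ E ν g (leftTranslationₗᵢ E ν h f) := by
  apply TwistedL2.ext
  filter_upwards [leftTranslationₗᵢ_coeFn E ν (g * h) f,
    leftTranslationₗᵢ_coeFn E ν g (leftTranslationₗᵢ E ν h f),
    (measurePreserving_mul_left ν g⁻¹).quasiMeasurePreserving.ae (leftTranslationₗᵢ_coeFn E ν h f)]
    with k h1 h2 h3
  rw [h1, h2]
  refine Eq.trans ?_ h3.symm
  rw [mul_inv_rev, mul_assoc]

theorem leftTranslationₗᵢ_one (f : TwistedL2 E ν) : leftTranslationₗᵢ E ν 1 f = f := by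
  apply TwistedL2.ext
  filter_upwards [leftTranslationₗᵢ_coeFn E ν 1 f] with k h1
  rw [h1, inv_one, one_mul]

/-- Left translation on `L²_τ(Γ)`. -/
def leftTranslation : Γτ →* (TwistedL2 E ν ≃ₗᵢ[ℂ] TwistedL2 E ν) where
  toFun g :=
    { leftTranslationₗᵢ E ν g with
      invFun := leftTranslationₗᵢ E ν g⁻¹
      left_inv := fun f => by
        change leftTranslationₗᵢ E ν g⁻¹ (leftTranslationₗᵢ E ν g f) = f
        rw [← leftTranslationₗᵢ_mul, inv_mul_cancel, leftTranslationₗᵢ_one]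
      right_inv := fun f => by
        change leftTranslationₗᵢ E ν g (leftTranslationₗᵢ E ν g⁻¹ f) = f
        rw [← leftTranslationₗᵢ_mul, mul_inv_cancel, leftTranslationₗᵢ_one] }
  map_one' := LinearIsometryEquiv.ext (leftTranslationₗᵢ_one E ν)
  map_mul' g h := LinearIsometryEquiv.ext (leftTranslationₗᵢ_mul E ν g h)

theorem leftTranslation_coeFn (g : Γτ) (f : TwistedL2 E ν) :
    (leftTranslation E ν g f).toLp =ᵐ[ν] fun k => f.toLp (g⁻¹ * k) :=
  leftTranslationₗᵢ_coeFn E ν g f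

theorem continuous_leftTranslation (f : TwistedL2 E ν) :
    Continuous fun g => leftTranslation E ν g f := by
  rw [(TwistedL2.toLpₗᵢ E ν).isometry.isEmbedding.continuous_iff]
  let c : C(Γτ, C(Γτ, Γτ)) :=
    (ContinuousMap.mk (fun q : Γτ × Γτ => q.1⁻¹ * q.2) (by fun_prop)).curry
  exact (continuous_const (y := f.toLp)).compMeasurePreservingLp c.continuous
    (fun g => measurePreserving_mul_left ν g⁻¹) ENNReal.ofNat_ne_top

/-- The covariant pair on `L²_τ(Γ)` attached to `x ∈ X`: functions act through the orbit map of
`x`, and `Γτ` acts by left translation. -/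
def fiberPair (x : X) : CovariantPair ((translationAct Γ X).comp E.proj) (TwistedL2 E ν) where
  π := fiberRep E ν x
  u := (Unitary.linearIsometryEquiv (𝕜 := ℂ)).symm.toMonoidHom.comp (leftTranslation E ν)
  continuous_u f := continuous_leftTranslation E ν f
  covariant g φ := by
    have hU : (((Unitary.linearIsometryEquiv (𝕜 := ℂ)).symm.toMonoidHom.comp
        (leftTranslation E ν) g : unitary (TwistedL2 E ν →L[ℂ] TwistedL2 E ν)) :
        TwistedL2 E ν →L[ℂ] TwistedL2 E ν) =
        ((leftTranslation E ν g : TwistedL2 E ν ≃L[ℂ] TwistedL2 E ν) :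
        TwistedL2 E ν →L[ℂ] TwistedL2 E ν) := rfl
    -- Covariance is checked in the form `U π(φ) = π(g · φ) U`, an identity of functions almost
    -- everywhere; multiplying by `U*` on the right gives the required one.
    have key : ((leftTranslation E ν g : TwistedL2 E ν ≃L[ℂ] TwistedL2 E ν) :
        TwistedL2 E ν →L[ℂ] TwistedL2 E ν) * fiberRep E ν x φ =
        fiberRep E ν x ((translationAct Γ X).comp E.proj g φ) *
          ((leftTranslation E ν g : TwistedL2 E ν ≃L[ℂ] TwistedL2 E ν) :
        TwistedL2 E ν →L[ℂ] TwistedL2 E ν) := by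
      ext1 f
      apply TwistedL2.ext
      filter_upwards [leftTranslation_coeFn E ν g (fiberRep E ν x φ f),
        (measurePreserving_mul_left ν g⁻¹).quasiMeasurePreserving.ae (fiberRep_coeFn E ν x φ f),
        fiberRep_coeFn E ν x ((translationAct Γ X).comp E.proj g φ) (leftTranslation E ν g f),
        leftTranslation_coeFn E ν g f] with k h1 h2 h3 h4
      refine h1.trans (h2.trans (Eq.trans ?_ h3.symm))
      rw [h4, MonoidHom.comp_apply, translationAct_apply, map_mul, map_inv, mul_smul]
    rw [hU, key, mul_assoc, ← hU, Unitary.mul_star_self_of_mem (SetLike.coe_mem _), mul_one]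

theorem fiberPair_π (x : X) : (fiberPair E ν x).π = fiberRep E ν x := rfl

theorem continuous_uncurry_eval (a : C_c(Γτ, C₀(X, ℂ))) :
    Continuous fun q : Γτ × X => a q.1 q.2 :=
  ZeroAtInftyContinuousMap.continuous_eval'.comp
    ((a.continuous.comp continuous_fst).prodMk continuous_snd)

/-- The integrated form is a Bochner integral in `L²_τ(Γ)`. Pushing it into `L²(Γτ)` and using
`Lp.coeFn_integral_ae_eq` turns it into a pointwise integral, which is Rieffel's formula. -/
theorem integratedForm_fiberPair_coeFn (x : X) (a : C_c(Γτ, C₀(X, ℂ))) (f : TwistedL2 E ν) :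
    ((fiberPair E ν x).integratedForm ν a f).toLp =ᵐ[ν]
      fun k => ∫ g, a g (E.proj k • x) * f.toLp (g⁻¹ * k) ∂ν := by
  have hint := (fiberPair E ν x).integrable_integrand ν a f
  have h1 : ((fiberPair E ν x).integratedForm ν a f).toLp =
      ∫ g, TwistedL2.toLpₗᵢ E ν ((fiberPair E ν x).π (a g)
        (((fiberPair E ν x).u g : TwistedL2 E ν →L[ℂ] TwistedL2 E ν) f)) ∂ν :=
    (ContinuousLinearMap.integral_comp_comm (TwistedL2.toLpₗᵢ E ν).toContinuousLinearMap hint).symm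
  rw [h1]
  refine Lp.coeFn_integral_ae_eq
    ((TwistedL2.toLpₗᵢ E ν).toContinuousLinearMap.integrable_comp hint) ?_ ?_
  · refine AEStronglyMeasurable.mul (Continuous.aestronglyMeasurable ?_) ?_
    · exact (continuous_uncurry_eval a).comp (continuous_fst.prodMk
        ((E.isOpenQuotientMap_proj.continuous.comp continuous_snd).smul continuous_const))
    · exact ((Lp.stronglyMeasurable f.toLp).comp_measurable
        (measurable_fst.inv.mul measurable_snd)).aestronglyMeasurable
  · refine Eventually.of_forall fun g => ?_
    filter_upwards [fiberRep_coeFn E ν x (a g) (leftTranslation E ν g f),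
      leftTranslation_coeFn E ν g f] with k h2 h3
    rw [h3] at h2
    exact h2

end FiberPair

/-! ### Intertwining operators -/

section Intertwining

variable {G A : Type u} [Group G] [TopologicalSpace G] [NonUnitalCStarAlgebra A]
  {α : G →* (A ≃⋆ₐ[ℂ] A)}

/-- Evaluation of bounded families at a covariant pair. -/
def UniversalAlgebra.evalHom {H : HilbertSpaceBundle.{u}} (c : CovariantPair α H.carrier) :
    UniversalAlgebra α →⋆ₙₐ[ℂ] (H.carrier →L[ℂ] H.carrier) where
  toFun T := T.eval c
  map_smul' _ _ := rfl
  map_zero' := rfl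
  map_add' _ _ := rfl
  map_mul' _ _ := rfl
  map_star' _ := rfl

theorem UniversalAlgebra.continuous_evalHom {H : HilbertSpaceBundle.{u}}
    (c : CovariantPair α H.carrier) : Continuous (UniversalAlgebra.evalHom c) :=
  AddMonoidHomClass.continuous_of_bound _ 1 fun T => by
    rw [one_mul]; exact T.norm_eval_le c

variable {H₁ H₂ : Type*} [NormedAddCommGroup H₁] [InnerProductSpace ℂ H₁] [CompleteSpace H₁]
  [NormedAddCommGroup H₂] [InnerProductSpace ℂ H₂] [CompleteSpace H₂]

/-- `V` intertwines the covariant pairs `c₁` and `c₂`. -/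
structure CovariantPair.Intertwines (c₁ : CovariantPair α H₁) (c₂ : CovariantPair α H₂)
    (V : H₁ →L[ℂ] H₂) : Prop where
  π_apply : ∀ a ξ, V (c₁.π a ξ) = c₂.π a (V ξ)
  u_apply : ∀ g ξ, V ((c₁.u g : H₁ →L[ℂ] H₁) ξ) = (c₂.u g : H₂ →L[ℂ] H₂) (V ξ)

theorem CovariantPair.coe_u_inv (c : CovariantPair α H₁) (g : G) :
    ((c.u g⁻¹ : unitary (H₁ →L[ℂ] H₁)) : H₁ →L[ℂ] H₁) = star (c.u g : H₁ →L[ℂ] H₁) := by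
  rw [map_inv]
  rfl

/-- The ranges of `π` and `u` are closed under adjoints. It supplies the relation for `T*` when
intertwining is extended from functions to `T` in the crossed product. -/
theorem CovariantPair.Intertwines.adjoint {c₁ : CovariantPair α H₁} {c₂ : CovariantPair α H₂}
    {V : H₁ →L[ℂ] H₂} (h : c₁.Intertwines c₂ V) :
    c₂.Intertwines c₁ (ContinuousLinearMap.adjoint V) where
  π_apply a ξ := by
    refine ext_inner_right ℂ fun η => ?_
    have e1 : c₂.π a = ContinuousLinearMap.adjoint (c₂.π (star a)) := by
      rw [map_star, ContinuousLinearMap.star_eq_adjoint, ContinuousLinearMap.adjoint_adjoint]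
    have e2 : c₁.π a = ContinuousLinearMap.adjoint (c₁.π (star a)) := by
      rw [map_star, ContinuousLinearMap.star_eq_adjoint, ContinuousLinearMap.adjoint_adjoint]
    rw [e1, e2]
    simp only [ContinuousLinearMap.adjoint_inner_left, h.π_apply]
  u_apply g ξ := by
    refine ext_inner_right ℂ fun η => ?_
    have e1 : (c₂.u g : H₂ →L[ℂ] H₂) = ContinuousLinearMap.adjoint (c₂.u g⁻¹ : H₂ →L[ℂ] H₂) := by
      rw [c₂.coe_u_inv, ContinuousLinearMap.star_eq_adjoint, ContinuousLinearMap.adjoint_adjoint]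
    have e2 : (c₁.u g : H₁ →L[ℂ] H₁) = ContinuousLinearMap.adjoint (c₁.u g⁻¹ : H₁ →L[ℂ] H₁) := by
      rw [c₁.coe_u_inv, ContinuousLinearMap.star_eq_adjoint, ContinuousLinearMap.adjoint_adjoint]
    rw [e1, e2]
    simp only [ContinuousLinearMap.adjoint_inner_left, h.u_apply]

variable [MeasurableSpace G] [BorelSpace G] (ν : Measure G) [IsFiniteMeasureOnCompacts ν]

theorem CovariantPair.Intertwines.integratedForm {c₁ : CovariantPair α H₁}
    {c₂ : CovariantPair α H₂} {V : H₁ →L[ℂ] H₂} (h : c₁.Intertwines c₂ V) (f : C_c(G, A)) :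
    V ∘L c₁.integratedForm ν f = c₂.integratedForm ν f ∘L V := by
  ext1 ξ
  change V (c₁.integratedForm ν f ξ) = c₂.integratedForm ν f (V ξ)
  rw [c₁.integratedForm_apply ν, c₂.integratedForm_apply ν,
    ← ContinuousLinearMap.integral_comp_comm V (c₁.integrable_integrand ν f ξ)]
  simp only [h.π_apply, h.u_apply]

/-- The families `T` such that both `T` and `T*` satisfy the relation form a closed `*`-subalgebra.
It contains the integrated forms: for the adjoint of an integrated form, take adjoints in the
relation for `V*`. -/
theorem CovariantPair.Intertwines.eval {H₁ H₂ : HilbertSpaceBundle.{u}}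
    {c₁ : CovariantPair α H₁.carrier} {c₂ : CovariantPair α H₂.carrier}
    {V : H₁.carrier →L[ℂ] H₂.carrier} (h : c₁.Intertwines c₂ V) {T : UniversalAlgebra α}
    (hT : T ∈ crossedProduct α ν) : V ∘L T.eval c₁ = T.eval c₂ ∘L V := by
  let B : NonUnitalStarSubalgebra ℂ (UniversalAlgebra α) :=
    { carrier := {T | V ∘L UniversalAlgebra.evalHom c₁ T = UniversalAlgebra.evalHom c₂ T ∘L V ∧
        V ∘L UniversalAlgebra.evalHom c₁ (star T) = UniversalAlgebra.evalHom c₂ (star T) ∘L V}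
      zero_mem' := by simp
      add_mem' := fun {T T'} hT hT' => by
        simp only [Set.mem_ofPred_eq, map_add, star_add, ContinuousLinearMap.comp_add,
          ContinuousLinearMap.add_comp] at hT hT' ⊢
        exact ⟨by rw [hT.1, hT'.1], by rw [hT.2, hT'.2]⟩
      smul_mem' := fun k T hT => by
        simp only [Set.mem_ofPred_eq, map_smul, star_smul, ContinuousLinearMap.comp_smul,
          ContinuousLinearMap.smul_comp] at hT ⊢
        exact ⟨by rw [hT.1], by rw [hT.2]⟩
      mul_mem' := fun {T T'} hT hT' => by
        simp only [Set.mem_ofPred_eq, map_mul, star_mul, ContinuousLinearMap.mul_def] at hT hT' ⊢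
        refine ⟨?_, ?_⟩
        · rw [← ContinuousLinearMap.comp_assoc, hT.1, ContinuousLinearMap.comp_assoc, hT'.1,
            ContinuousLinearMap.comp_assoc]
        · rw [← ContinuousLinearMap.comp_assoc, hT'.2, ContinuousLinearMap.comp_assoc, hT.2,
            ContinuousLinearMap.comp_assoc]
      star_mem' := fun {T} hT => ⟨hT.2, by rw [star_star]; exact hT.1⟩ }
  have hB : IsClosed (B : Set (UniversalAlgebra α)) := by
    have c1 := UniversalAlgebra.continuous_evalHom c₁
    have c2 := UniversalAlgebra.continuous_evalHom c₂
    refine (isClosed_eq (continuous_const.clm_comp c1) (c2.clm_comp continuous_const)).inter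
      (isClosed_eq (continuous_const.clm_comp (c1.comp continuous_star))
        ((c2.comp continuous_star).clm_comp continuous_const))
  have hle : crossedProduct α ν ≤ B := by
    refine NonUnitalStarSubalgebra.topologicalClosure_minimal _ ?_ hB
    refine NonUnitalStarAlgebra.adjoin_le ?_
    rintro _ ⟨f, rfl⟩
    refine ⟨h.integratedForm ν f, ?_⟩
    have h' := congrArg ContinuousLinearMap.adjoint (h.adjoint.integratedForm ν f)
    rw [ContinuousLinearMap.adjoint_comp, ContinuousLinearMap.adjoint_comp,
      ContinuousLinearMap.adjoint_adjoint] at h'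
    rw [map_star, map_star]
    exact h'.symm
  exact (hle hT).1

end Intertwining

section FiberIntertwining

variable {S : Type v} {Γ Γτ X : Type u} [Group S] [TopologicalSpace S]
  [Group Γ] [TopologicalSpace Γ] [Group Γτ] [TopologicalSpace Γτ]
  [IsTopologicalGroup Γτ] [LocallyCompactSpace Γτ] [T2Space Γτ] [SecondCountableTopology Γτ]
  [MeasurableSpace Γτ] [BorelSpace Γτ] [MulDistribMulAction S Γ] [MulDistribMulAction S Γτ]
  [ContinuousSMul S Γτ]
  [TopologicalSpace X] [MulAction Γ X] [ContinuousSMul Γ X] [MulAction S X] [ContinuousSMul S X]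
  {E : CentralExtension Γ Γτ} (hE : E.IsLift S) (ν : Measure Γτ) [ν.IsHaarMeasure]

/-- The value at `x` of a family of operators: its component at the covariant pair of `x`. -/
def evalFiber (x : X) (T : UniversalAlgebra ((translationAct Γ X).comp E.proj)) :
    TwistedL2 E ν →L[ℂ] TwistedL2 E ν :=
  T.eval (H := ⟨TwistedL2 E ν⟩) (fiberPair E ν x)

/-- Right translation commutes with left translation and carries the orbit map of `x` to that of
`p(g) x`. -/
theorem intertwines_rho_right (x : X) (g : Γτ) :
    (fiberPair E ν x).Intertwines (fiberPair E ν (E.proj g • x))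
      (rho hE ν 1 g : TwistedL2 E ν →L[ℂ] TwistedL2 E ν) where
  π_apply φ f := by
    apply TwistedL2.ext
    have hq := quasiMeasurePreserving_rhoHomeomorph ν (1 : S) g
    filter_upwards [rho_coeFn hE ν 1 g (fiberRep E ν x φ f), hq.ae (fiberRep_coeFn E ν x φ f),
      fiberRep_coeFn E ν (E.proj g • x) φ (rho hE ν 1 g f), rho_coeFn hE ν 1 g f] with k h1 h2 h3 h4
    refine h1.trans (h2.trans (Eq.trans ?_ h3.symm))
    rw [h4, rhoHomeomorph_apply, inv_one, one_smul, map_mul, mul_smul]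
  u_apply h f := by
    apply TwistedL2.ext
    have hq := quasiMeasurePreserving_rhoHomeomorph ν (1 : S) g
    filter_upwards [rho_coeFn hE ν 1 g (leftTranslation E ν h f),
      hq.ae (leftTranslation_coeFn E ν h f),
      leftTranslation_coeFn E ν h (rho hE ν 1 g f),
      (measurePreserving_mul_left ν h⁻¹).quasiMeasurePreserving.ae (rho_coeFn hE ν 1 g f)]
      with k h1 h2 h3 h4
    refine h1.trans (h2.trans (Eq.trans ?_ (h3.trans h4).symm))
    rw [rhoHomeomorph_apply, inv_one, one_smul, one_smul, mul_assoc]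

/-- On functions this is `hX` read along orbits: `p(s⁻¹ k) s⁻¹ x = s⁻¹ p(k) x`. On `Γτ` it holds
because `s` acts by automorphisms. -/
theorem intertwines_rho_left
    (hX : ∀ (s : S) (γ : Γ) (x : X), s • γ • x = (s • γ) • s • x) (x : X) (s : S) :
    (fiberPair E ν (s⁻¹ • x)).Intertwines ((fiberPair E ν x).twist (translationAct S X)
      (hE.compat (translationAct S X) (translationAct_compat hX)) s)
      (rho hE ν s 1 : TwistedL2 E ν →L[ℂ] TwistedL2 E ν) where
  π_apply φ f := by
    apply TwistedL2.ext
    have hq := quasiMeasurePreserving_rhoHomeomorph ν s (1 : Γτ)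
    filter_upwards [rho_coeFn hE ν s 1 (fiberRep E ν (s⁻¹ • x) φ f),
      hq.ae (fiberRep_coeFn E ν (s⁻¹ • x) φ f),
      fiberRep_coeFn E ν x (translationAct S X s φ) (rho hE ν s 1 f), rho_coeFn hE ν s 1 f]
      with k h1 h2 h3 h4
    refine h1.trans (h2.trans (Eq.trans ?_ h3.symm))
    rw [h4, rhoHomeomorph_apply, mul_one, translationAct_apply, hX, hE.proj_smul]
  u_apply h f := by
    apply TwistedL2.ext
    have hq := quasiMeasurePreserving_rhoHomeomorph ν s (1 : Γτ)
    filter_upwards [rho_coeFn hE ν s 1 (leftTranslation E ν h f),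
      hq.ae (leftTranslation_coeFn E ν h f),
      leftTranslation_coeFn E ν (s • h) (rho hE ν s 1 f),
      (measurePreserving_mul_left ν (s • h)⁻¹).quasiMeasurePreserving.ae (rho_coeFn hE ν s 1 f)]
      with k h1 h2 h3 h4
    refine h1.trans (h2.trans (Eq.trans ?_ (h3.trans h4).symm))
    rw [rhoHomeomorph_apply, mul_one, mul_one, smul_mul', smul_inv', inv_smul_smul]

theorem eq_adRho_of_comp_eq {s : S} {g : Γτ} {T T' : TwistedL2 E ν →L[ℂ] TwistedL2 E ν}
    (h : (rho hE ν s g : TwistedL2 E ν →L[ℂ] TwistedL2 E ν) ∘L T =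
      T' ∘L (rho hE ν s g : TwistedL2 E ν →L[ℂ] TwistedL2 E ν)) : T' = adRho hE ν s g T := by
  ext1 f
  obtain ⟨f, rfl⟩ := (rho hE ν s g).surjective f
  rw [adRho_apply, ContinuousLinearEquiv.symm_apply_apply]
  exact (congrArg (fun R => R f) h).symm

theorem evalFiber_smul {T : UniversalAlgebra ((translationAct Γ X).comp E.proj)}
    (hT : T ∈ crossedProduct ((translationAct Γ X).comp E.proj) ν) (x : X) (g : Γτ) :
    evalFiber ν (E.proj g • x) T = adRho hE ν 1 g (evalFiber ν x T) := by
  have h := (intertwines_rho_right hE ν x g).eval (H₁ := ⟨TwistedL2 E ν⟩)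
    (H₂ := ⟨TwistedL2 E ν⟩) ν hT
  exact eq_adRho_of_comp_eq hE ν h

theorem evalFiber_universalAct
    (hX : ∀ (s : S) (γ : Γ) (x : X), s • γ • x = (s • γ) • s • x)
    {T : UniversalAlgebra ((translationAct Γ X).comp E.proj)}
    (hT : T ∈ crossedProduct ((translationAct Γ X).comp E.proj) ν) (x : X) (s : S) :
    evalFiber ν x (universalAct (translationAct S X)
      (hE.compat (translationAct S X) (translationAct_compat hX)) s T) =
      adRho hE ν s 1 (evalFiber ν (s⁻¹ • x) T) := by
  have h := (intertwines_rho_left hE ν hX x s).eval (H₁ := ⟨TwistedL2 E ν⟩)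
    (H₂ := ⟨TwistedL2 E ν⟩) ν hT
  refine (universalAct_eval (translationAct S X)
    (hE.compat (translationAct S X) (translationAct_compat hX)) s T
    (H := ⟨TwistedL2 E ν⟩) (fiberPair E ν x)).trans ?_
  exact eq_adRho_of_comp_eq hE ν h

end FiberIntertwining

/-! ### Convolution and involution -/

/-- A strongly continuous action by automorphisms is jointly continuous. -/
theorem continuous_uncurry_of_stronglyContinuous {P A : Type*} [TopologicalSpace P]
    [NonUnitalCStarAlgebra A] {α : P → (A ≃⋆ₐ[ℂ] A)} (hα : ∀ a, Continuous fun g => α g a) :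
    Continuous fun q : P × A => α q.1 q.2 := by
  have := continuous_prod_of_continuous_lipschitzWith (fun q : A × P => α q.2 q.1) 1
    (fun a => hα a) (fun g => (StarAlgEquiv.isometry (α g)).lipschitz)
  exact this.comp continuous_swap

namespace CovariantPair

variable {G A H : Type*} [Group G] [TopologicalSpace G] [NonUnitalCStarAlgebra A]
  {α : G →* (A ≃⋆ₐ[ℂ] A)} [NormedAddCommGroup H] [InnerProductSpace ℂ H]
  [CompleteSpace H]

/-- The representation of `A` as a continuous linear map. -/
def πL (c : CovariantPair α H) : A →L[ℂ] (H →L[ℂ] H) :=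
  LinearMap.mkContinuous
    { toFun := c.π, map_add' := map_add c.π, map_smul' := map_smul c.π } 1 fun a => by
    simpa using NonUnitalStarAlgHom.norm_apply_le c.π a

theorem norm_π_le (c : CovariantPair α H) (a : A) : ‖c.π a‖ ≤ ‖a‖ :=
  NonUnitalStarAlgHom.norm_apply_le c.π a

theorem continuous_uncurry_u (c : CovariantPair α H) :
    Continuous fun q : G × H => (c.u q.1 : H →L[ℂ] H) q.2 := by
  have := continuous_prod_of_continuous_lipschitzWith
    (fun q : H × G => (c.u q.2 : H →L[ℂ] H) q.1) 1 c.continuous_u (fun g => by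
      refine LipschitzWith.of_dist_le_mul fun ξ η => ?_
      rw [dist_eq_norm, dist_eq_norm, ← map_sub, c.norm_u_apply, NNReal.coe_one, one_mul])
  exact this.comp continuous_swap

theorem u_apply_π_apply (c : CovariantPair α H) (g : G) (a : A) (ξ : H) :
    (c.u g : H →L[ℂ] H) (c.π a ξ) = c.π (α g a) ((c.u g : H →L[ℂ] H) ξ) := by
  rw [← c.covariant g a]
  simp only [mul_apply_eq_comp]
  rw [← mul_apply_eq_comp (star _), Unitary.star_mul_self_of_mem (SetLike.coe_mem _)]
  rfl

theorem inner_u_apply (c : CovariantPair α H) (g : G) (ξ η : H) :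
    inner ℂ ((c.u g : H →L[ℂ] H) ξ) η = inner ℂ ξ ((c.u g⁻¹ : H →L[ℂ] H) η) := by
  have : (c.u g⁻¹ : H →L[ℂ] H) = star (c.u g : H →L[ℂ] H) := by rw [map_inv]; rfl
  rw [this, ContinuousLinearMap.star_eq_adjoint, ContinuousLinearMap.adjoint_inner_right]

theorem inner_π_apply (c : CovariantPair α H) (a : A) (ξ η : H) :
    inner ℂ (c.π a ξ) η = inner ℂ ξ (c.π (star a) η) := by
  rw [map_star, ContinuousLinearMap.star_eq_adjoint, ContinuousLinearMap.adjoint_inner_right]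

end CovariantPair

section Convolution

variable {G A : Type*} [Group G] [TopologicalSpace G] [IsTopologicalGroup G]
  [LocallyCompactSpace G] [SecondCountableTopology G] [T2Space G]
  [NonUnitalCStarAlgebra A] {α : G →* (A ≃⋆ₐ[ℂ] A)} [MeasurableSpace G] [BorelSpace G]
  (ν : Measure G) [ν.IsHaarMeasure]

theorem continuous_convolution_integrand (hα : ∀ a, Continuous fun g => α g a) (a b : C_c(G, A)) :
    Continuous fun q : G × G => a q.2 * α q.2 (b (q.2⁻¹ * q.1)) :=
  (a.continuous.comp continuous_snd).mul ((continuous_uncurry_of_stronglyContinuous hα).comp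
    (continuous_snd.prodMk (b.continuous.comp (continuous_snd.inv.mul continuous_fst))))

/-- The twisted convolution `(a * b)(g) = ∫ a(h) α_h(b(h⁻¹ g)) dh` on `C_c(G, A)`. -/
def convolution (hα : ∀ a, Continuous fun g => α g a) (a b : C_c(G, A)) : C_c(G, A) where
  toFun g := ∫ h, a h * α h (b (h⁻¹ * g)) ∂ν
  continuous_toFun := by
    rw [← continuousOn_univ]
    refine continuousOn_integral_of_compact_support a.hasCompactSupport.isCompact
      (continuous_convolution_integrand hα a b).continuousOn fun g h _ hh => ?_
    rw [image_eq_zero_of_notMem_tsupport hh, zero_mul]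
  hasCompactSupport' := by
    refine HasCompactSupport.intro
      (a.hasCompactSupport.isCompact.mul b.hasCompactSupport.isCompact) fun g hg => ?_
    refine (integral_congr_ae (Eventually.of_forall fun h => ?_)).trans (integral_zero _ _)
    by_cases h1 : h ∈ tsupport a
    · have h2 : h⁻¹ * g ∉ tsupport b := fun h2 => hg ⟨h, h1, _, h2, mul_inv_cancel_left _ _⟩
      rw [image_eq_zero_of_notMem_tsupport h2, map_zero, mul_zero]
    · rw [image_eq_zero_of_notMem_tsupport h1, zero_mul]

theorem convolution_apply (hα : ∀ a, Continuous fun g => α g a) (a b : C_c(G, A)) (g : G) :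
    convolution ν hα a b g = ∫ h, a h * α h (b (h⁻¹ * g)) ∂ν := rfl

theorem integrable_convolution_integrand (hα : ∀ a, Continuous fun g => α g a) (a b : C_c(G, A))
    (g : G) : Integrable (fun h => a h * α h (b (h⁻¹ * g))) ν := by
  refine Continuous.integrable_of_hasCompactSupport
    ((continuous_convolution_integrand hα a b).comp (Continuous.prodMk_right g)) ?_
  exact HasCompactSupport.intro a.hasCompactSupport.isCompact fun h hh => by
    simp only [image_eq_zero_of_notMem_tsupport hh, zero_mul]

variable {H : Type*} [NormedAddCommGroup H] [InnerProductSpace ℂ H] [CompleteSpace H]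

/-- Fubini for a compactly supported integrand, then left invariance and covariance. Together with
`integratedForm_involution` it makes the set of functions already a `*`-subalgebra, so that no
products have to be adjoined. -/
theorem integratedForm_convolution (hα : ∀ a, Continuous fun g => α g a) (c : CovariantPair α H)
    (a b : C_c(G, A)) :
    c.integratedForm ν (convolution ν hα a b) = c.integratedForm ν a * c.integratedForm ν b := by
  ext1 ξ
  rw [mul_apply_eq_comp, c.integratedForm_apply ν, c.integratedForm_apply ν a]
  have e1 : ∀ g, c.π (convolution ν hα a b g) ((c.u g : H →L[ℂ] H) ξ) =
      ∫ h, c.π (a h * α h (b (h⁻¹ * g))) ((c.u g : H →L[ℂ] H) ξ) ∂ν := fun g => by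
    have := ContinuousLinearMap.integral_comp_comm
      ((ContinuousLinearMap.apply ℂ H ((c.u g : H →L[ℂ] H) ξ)) ∘L c.πL)
      (integrable_convolution_integrand ν hα a b g)
    exact this.symm
  have hswap := integral_integral_swap_of_hasCompactSupport (μ := ν) (ν := ν)
    (f := fun g h => c.π (a h * α h (b (h⁻¹ * g))) ((c.u g : H →L[ℂ] H) ξ)) ?_ ?_
  · simp only [e1]
    rw [hswap]
    refine integral_congr_ae (Eventually.of_forall fun h => ?_)
    simp only
    -- For fixed `h`, substituting `g ↦ h g` leaves `π(a h) π(α_h (b g)) u(h) u(g) ξ`, and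
    -- covariance moves `u(h)` to the left of `π(b g)`.
    rw [c.integratedForm_apply ν, ← ContinuousLinearMap.comp_apply,
      ← ContinuousLinearMap.integral_comp_comm _ (c.integrable_integrand ν b ξ),
      ← integral_mul_left_eq_self _ h]
    refine integral_congr_ae (Eventually.of_forall fun g => ?_)
    simp only [inv_mul_cancel_left, map_mul, mul_apply_eq_comp, 
      ContinuousLinearMap.comp_apply, Submonoid.coe_mul]
    rw [c.u_apply_π_apply]
  · exact ((c.πL.continuous.comp (continuous_convolution_integrand hα a b)).clm_apply
      ((c.continuous_u ξ).comp continuous_fst))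
  · refine HasCompactSupport.intro ((a.hasCompactSupport.isCompact.mul
      b.hasCompactSupport.isCompact).prod a.hasCompactSupport.isCompact) fun q hq => ?_
    have : a q.2 * α q.2 (b (q.2⁻¹ * q.1)) = 0 := by
      by_cases h1 : q.2 ∈ tsupport a
      · have h2 : q.2⁻¹ * q.1 ∉ tsupport b := fun h2 =>
          hq ⟨⟨q.2, h1, _, h2, mul_inv_cancel_left _ _⟩, h1⟩
        rw [image_eq_zero_of_notMem_tsupport h2, map_zero, mul_zero]
      · rw [image_eq_zero_of_notMem_tsupport h1, zero_mul]
    simp only [Function.uncurry]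
    rw [this, map_zero]
    rfl

open MeasureTheory.Measure in
/-- The involution `a*(g) = D(g) α_g(a(g⁻¹)*)` on `C_c(G, A)`, `D` being the modular function. -/
def involution (hα : ∀ a, Continuous fun g => α g a) (a : C_c(G, A)) : C_c(G, A) where
  toFun g := ((modularCharacterFun g : ℝ) : ℂ) • α g (star (a g⁻¹))
  continuous_toFun := by
    have h1 : Continuous fun g : G => ((modularCharacterFun g : ℝ) : ℂ) :=
      Complex.continuous_ofReal.comp (NNReal.continuous_coe.comp continuous_modularCharacterFun)
    exact h1.smul ((continuous_uncurry_of_stronglyContinuous hα).comp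
      (continuous_id.prodMk (a.continuous.comp continuous_inv).star))
  hasCompactSupport' := by
    refine HasCompactSupport.intro a.hasCompactSupport.isCompact.inv fun g hg => ?_
    rw [image_eq_zero_of_notMem_tsupport (f := a) (x := g⁻¹) (by rwa [← Set.mem_inv]), star_zero,
      map_zero, smul_zero]

open MeasureTheory.Measure in
theorem involution_apply (hα : ∀ a, Continuous fun g => α g a) (a : C_c(G, A)) (g : G) :
    involution hα a g = ((modularCharacterFun g : ℝ) : ℂ) • α g (star (a g⁻¹)) := rfl

/-- Taking adjoints replaces `g` by `g⁻¹`; the modular factor in the involution is the Jacobian of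
this inversion. -/
theorem integratedForm_involution (hα : ∀ a, Continuous fun g => α g a) (c : CovariantPair α H)
    (a : C_c(G, A)) :
    c.integratedForm ν (involution hα a) = star (c.integratedForm ν a) := by
  rw [ContinuousLinearMap.star_eq_adjoint, ContinuousLinearMap.eq_adjoint_iff]
  intro ξ η
  rw [c.integratedForm_apply ν, c.integratedForm_apply ν a,
    ← integral_inner (c.integrable_integrand ν a η)]
  have h1 : ∫ g, inner ℂ ξ (c.π (a g) ((c.u g : H →L[ℂ] H) η)) ∂ν =
      ∫ g, (Measure.modularCharacterFun g : ℝ) •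
        inner ℂ ξ (c.π (a g⁻¹) ((c.u g⁻¹ : H →L[ℂ] H) η)) ∂ν :=
    (integral_modularCharacterFun_smul_inv ν
      fun g => inner ℂ ξ (c.π (a g) ((c.u g : H →L[ℂ] H) η))).symm
  rw [h1, ← inner_conj_symm, ← integral_inner (c.integrable_integrand ν (involution hα a) ξ),
    ← integral_conj]
  refine integral_congr_ae (Eventually.of_forall fun g => ?_)
  simp only
  rw [inner_conj_symm, involution_apply, map_smul, smul_apply, inner_smul_left,
    ← c.u_apply_π_apply, c.inner_u_apply, c.inner_π_apply, star_star, Complex.conj_ofReal,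
    Complex.real_smul]

end Convolution

theorem CentralExtension.IsHomogeneous.apply_mul {Γ Γτ A : Type*} [Group Γ] [TopologicalSpace Γ]
    [Group Γτ] [TopologicalSpace Γτ] [NonUnitalCStarAlgebra A] {E : CentralExtension Γ Γτ} {n : ℤ}
    {a : C_c(Γτ, A)}
    (ha : E.IsHomogeneous n a) (z : Circle) (g : Γτ) :
    a (E.incl z * g) = (star (z : ℂ)) ^ n • a g := by
  have := ha z (E.incl z * g)
  rw [inv_mul_cancel_left] at this
  rw [this, smul_smul, ← mul_zpow]
  have h : star (z : ℂ) * z = 1 := by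
    rw [Complex.star_def, ← Complex.normSq_eq_conj_mul_self]; simp
  rw [h, one_zpow, one_smul]

section HomogeneousFunctions

variable {Γ : Type*} {Γτ A : Type u} [Group Γ] [TopologicalSpace Γ] [Group Γτ]
  [TopologicalSpace Γτ] [IsTopologicalGroup Γτ]
  [LocallyCompactSpace Γτ] [SecondCountableTopology Γτ] [T2Space Γτ]
  [NonUnitalCStarAlgebra A] [MeasurableSpace Γτ] [BorelSpace Γτ]
  {E : CentralExtension Γ Γτ} (ν : Measure Γτ) [ν.IsHaarMeasure]
  {α : Γ →* (A ≃⋆ₐ[ℂ] A)}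

theorem CentralExtension.modularCharacterFun_incl (z : Circle) (g : Γτ) :
    Measure.modularCharacterFun ((E.incl z)⁻¹ * g) = Measure.modularCharacterFun g := by
  rw [Measure.modularCharacterFun_map_mul, ← map_inv, modularCharacterFun_of_central (E.central _),
    one_mul]

/-- Central elements move past `h` into the argument of `b`, so the weight of the second factor
alone decides, and `U(1)` acts trivially on the coefficients. -/
theorem CentralExtension.IsHomogeneous.convolution {n : ℤ} {a b : C_c(Γτ, A)}
    (hα : ∀ a, Continuous fun g => α.comp E.proj g a) (hb : E.IsHomogeneous n b) :
    E.IsHomogeneous n (convolution ν hα a b) := by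
  intro z g
  rw [convolution_apply, convolution_apply, ← integral_smul]
  refine integral_congr_ae (Eventually.of_forall fun h => ?_)
  simp only
  rw [← mul_assoc, ← E.incl_inv_central, mul_assoc, hb, map_smul, mul_smul_comm]

/-- Inverting the argument conjugates the weight and the star conjugates it back, while the modular
function does not see `U(1)`. -/
theorem CentralExtension.IsHomogeneous.involution {n : ℤ} {a : C_c(Γτ, A)}
    (hα : ∀ a, Continuous fun g => α.comp E.proj g a) (ha : E.IsHomogeneous n a) :
    E.IsHomogeneous n (involution hα a) := by
  intro z g
  rw [involution_apply, involution_apply, E.modularCharacterFun_incl, mul_inv_rev, inv_inv,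
    ← E.central, ha.apply_mul, star_smul, star_zpow₀, star_star, MonoidHom.comp_apply,
    E.proj_incl_inv_mul, map_smul, smul_comm]
  rfl

theorem universalForm_add (a b : C_c(Γτ, A)) :
    universalForm (α.comp E.proj) ν (a + b) =
      universalForm (α.comp E.proj) ν a + universalForm (α.comp E.proj) ν b := by
  refine UniversalAlgebra.ext fun H c => ContinuousLinearMap.ext fun ξ => ?_
  change ∫ g, c.π ((a + b) g) _ ∂ν = ∫ g, c.π (a g) _ ∂ν + ∫ g, c.π (b g) _ ∂ν
  rw [← integral_add (c.integrable_integrand ν a ξ) (c.integrable_integrand ν b ξ)]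
  simp only [CompactlySupportedContinuousMap.coe_add, Pi.add_apply, map_add,
    add_apply]

theorem universalForm_smul (k : ℂ) (a : C_c(Γτ, A)) :
    universalForm (α.comp E.proj) ν (k • a) = k • universalForm (α.comp E.proj) ν a := by
  refine UniversalAlgebra.ext fun H c => ContinuousLinearMap.ext fun ξ => ?_
  change ∫ g, c.π ((k • a) g) _ ∂ν = k • ∫ g, c.π (a g) _ ∂ν
  rw [← integral_smul]
  simp only [CompactlySupportedContinuousMap.coe_smul, Pi.smul_apply, map_smul,
    smul_apply]

theorem universalForm_convolution (hα : ∀ a, Continuous fun g => α.comp E.proj g a)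
    (a b : C_c(Γτ, A)) :
    universalForm (α.comp E.proj) ν (convolution ν hα a b) =
      universalForm (α.comp E.proj) ν a * universalForm (α.comp E.proj) ν b :=
  UniversalAlgebra.ext fun _ c => integratedForm_convolution ν hα c a b

theorem universalForm_involution (hα : ∀ a, Continuous fun g => α.comp E.proj g a)
    (a : C_c(Γτ, A)) :
    universalForm (α.comp E.proj) ν (involution hα a) =
      star (universalForm (α.comp E.proj) ν a) :=
  UniversalAlgebra.ext fun _ c => integratedForm_involution ν hα c a

theorem norm_universalForm_le (a : C_c(Γτ, A)) :
    ‖universalForm (α.comp E.proj) ν a‖ ≤ ∫ g, ‖a g‖ ∂ν :=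
  UniversalAlgebra.norm_le (integral_nonneg fun _ => norm_nonneg _)
    fun _ c => c.norm_integratedForm_le ν a

/-- The homogeneous functions are dense in the homogeneous ideal. -/
theorem mem_closure_of_mem_homogeneousIdeal (hα : ∀ a, Continuous fun g => α.comp E.proj g a)
    {n : ℤ} {T : UniversalAlgebra (α.comp E.proj)} (hT : T ∈ homogeneousIdeal E ν α n) :
    T ∈ closure (universalForm (α.comp E.proj) ν '' {a | E.IsHomogeneous n a}) := by
  -- The homogeneous functions themselves form a `*`-subalgebra, hence contain the one generated by
  -- them.
  let B : NonUnitalStarSubalgebra ℂ (UniversalAlgebra (α.comp E.proj)) :=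
    { carrier := universalForm (α.comp E.proj) ν '' {a | E.IsHomogeneous n a}
      zero_mem' := ⟨0, fun z g => by simp, by
        have := universalForm_smul (E := E) (α := α) ν 0 0
        rwa [zero_smul, zero_smul] at this⟩
      add_mem' := by
        rintro _ _ ⟨a, ha, rfl⟩ ⟨b, hb, rfl⟩
        refine ⟨a + b, fun z g => ?_, universalForm_add ν a b⟩
        simp only [CompactlySupportedContinuousMap.coe_add, Pi.add_apply, ha z g, hb z g, smul_add]
      smul_mem' := by
        rintro k _ ⟨a, ha, rfl⟩
        refine ⟨k • a, fun z g => ?_, universalForm_smul ν k a⟩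
        simp only [CompactlySupportedContinuousMap.coe_smul, Pi.smul_apply, ha z g]
        rw [smul_comm]
      mul_mem' := by
        rintro _ _ ⟨a, ha, rfl⟩ ⟨b, hb, rfl⟩
        exact ⟨_, hb.convolution ν hα, universalForm_convolution ν hα a b⟩
      star_mem' := by
        rintro _ ⟨a, ha, rfl⟩
        exact ⟨_, ha.involution hα, universalForm_involution ν hα a⟩ }
  have hle : NonUnitalStarAlgebra.adjoin ℂ
      (universalForm (α.comp E.proj) ν '' {a | E.IsHomogeneous n a}) ≤ B :=
    NonUnitalStarAlgebra.adjoin_le (le_refl _)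
  exact closure_mono hle hT

end HomogeneousFunctions

open scoped Pointwise




/-! ### Uniform continuity and properness -/

section Topology

variable {X : Type*} [TopologicalSpace X]

theorem ZeroAtInftyContinuousMap.exists_isCompact_norm_lt (φ : C₀(X, ℂ)) {ε : ℝ} (hε : 0 < ε) :
    ∃ K : Set X, IsCompact K ∧ ∀ x ∉ K, ‖φ x‖ < ε := by
  have h := φ.zero_at_infty'
  have h1 : ∀ᶠ x in cocompact X, ‖φ x‖ < ε := by
    have := h.norm
    rw [norm_zero] at this
    exact this.eventually (gt_mem_nhds hε)
  obtain ⟨K, hK, hK'⟩ := mem_cocompact.1 h1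
  exact ⟨K, hK, fun x hx => hK' hx⟩

/-- Uniform continuity in two regimes: on the compact set `C` by compactness, and off `C`, where `m
p y` avoids the compact set carrying the large values of `φ` for every `p ∈ N`, because both values
are below `ε / 2`. It serves for translations on `X` and, under properness, for orbit maps. -/
theorem eventually_forall_norm_comp_sub_le {P Y : Type*} [TopologicalSpace P] [TopologicalSpace Y]
    {m : P → Y → X} (hm : Continuous fun q : P × Y => m q.1 q.2) {p₀ : P} {N : Set P}
    (hN : N ∈ 𝓝 p₀)
    (hK : ∀ K : Set X, IsCompact K → ∃ C : Set Y, IsCompact C ∧ ∀ p ∈ N, ∀ y ∉ C, m p y ∉ K)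
    (φ : C₀(X, ℂ)) {ε : ℝ} (hε : 0 < ε) :
    ∀ᶠ p in 𝓝 p₀, ∀ y, ‖φ (m p y) - φ (m p₀ y)‖ ≤ ε := by
  obtain ⟨K, hKc, hK'⟩ := φ.exists_isCompact_norm_lt (half_pos hε)
  obtain ⟨C, hC, hCN⟩ := hK K hKc
  have h1 : ∀ᶠ p in 𝓝 p₀, ∀ y ∈ C, ‖φ (m p y) - φ (m p₀ y)‖ < ε := by
    refine hC.eventually_forall_of_forall_eventually fun y _ => ?_
    have hc : Continuous fun q : P × Y => ‖φ (m q.1 q.2) - φ (m p₀ q.2)‖ :=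
      ((φ.continuous.comp hm).sub (φ.continuous.comp
        (hm.comp (continuous_const.prodMk continuous_snd)))).norm
    refine hc.continuousAt.eventually (gt_mem_nhds ?_)
    simpa using hε
  filter_upwards [h1, hN] with p hp hpN y
  by_cases hy : y ∈ C
  · exact (hp y hy).le
  · refine (norm_sub_le _ _).trans ?_
    have := hK' _ (hCN p hpN y hy)
    have := hK' _ (hCN p₀ (mem_of_mem_nhds hN) y hy)
    linarith

theorem continuous_translationAct {G : Type*} [Group G] [TopologicalSpace G]
    [IsTopologicalGroup G] [LocallyCompactSpace G] [MulAction G X]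
    [ContinuousSMul G X] (φ : C₀(X, ℂ)) : Continuous fun g => translationAct G X g φ := by
  rw [continuous_iff_continuousAt]
  intro g₀
  obtain ⟨N, hN, hN'⟩ := exists_compact_mem_nhds g₀
  rw [ContinuousAt, Metric.tendsto_nhds]
  intro ε hε
  filter_upwards [eventually_forall_norm_comp_sub_le (P := G) (Y := X) (m := fun g x => g⁻¹ • x)
    (by fun_prop) hN' (fun K hK => ⟨N • K, hN.smul_set hK, fun g hg x hx hx' =>
      hx ⟨g, hg, g⁻¹ • x, hx', smul_inv_smul g x⟩⟩) φ (half_pos hε)] with g hg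
  rw [dist_eq_norm]
  refine lt_of_le_of_lt (ZeroAtInftyContinuousMap.norm_le_of_forall_le (half_pos hε).le ?_)
    (half_lt_self hε)
  exact hg

/-- Compact sets of functions vanishing at infinity admit a common cutoff function. -/
theorem exists_hasCompactSupport_norm_sub_mul_le [LocallyCompactSpace X] [T2Space X]
    {C : Set C₀(X, ℂ)} (hC : IsCompact C) {ε : ℝ} (hε : 0 < ε) :
    ∃ χ : C₀(X, ℂ), HasCompactSupport χ ∧ ∀ ψ ∈ C, ‖ψ - ψ * χ‖ ≤ ε := by
  -- A finite `ε / 2`-net; the cutoff is one where some member of the net is at least `ε / 2` in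
  -- absolute value.
  obtain ⟨t, ht, hcov⟩ := Metric.totallyBounded_iff.1 hC.totallyBounded (ε / 2) (half_pos hε)
  choose K hK hK' using fun φ : C₀(X, ℂ) => φ.exists_isCompact_norm_lt (half_pos hε)
  have hKt : IsCompact (⋃ φ ∈ t, K φ) := ht.isCompact_biUnion fun φ _ => hK φ
  obtain ⟨χ, hχ1, -, hχc, hχ01⟩ := exists_continuous_one_zero_of_isCompact hKt isClosed_empty
    (Set.disjoint_empty _)
  let χ' : C₀(X, ℂ) := ⟨⟨fun x => (χ x : ℂ), by fun_prop⟩,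
    (HasCompactSupport.comp_left (g := fun r : ℝ => (r : ℂ)) hχc (by simp)).is_zero_at_infty⟩
  have hχ' : ∀ x, χ' x = (χ x : ℂ) := fun _ => rfl
  refine ⟨χ', HasCompactSupport.comp_left (g := fun r : ℝ => (r : ℂ)) hχc (by simp),
    fun ψ hψ => ZeroAtInftyContinuousMap.norm_le_of_forall_le hε.le fun x => ?_⟩
  rw [ZeroAtInftyContinuousMap.sub_apply, ZeroAtInftyContinuousMap.mul_apply, hχ']
  by_cases hx : x ∈ ⋃ φ ∈ t, K φ
  · rw [hχ1 hx]
    simpa using hε.le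
  · obtain ⟨φ, hφ, hφψ⟩ := Set.mem_iUnion₂.1 (hcov hψ)
    have h1 : ‖φ x‖ < ε / 2 := hK' φ x fun h => hx (Set.mem_iUnion₂.2 ⟨φ, hφ, h⟩)
    have h2 : ‖ψ x - φ x‖ < ε / 2 :=
      lt_of_le_of_lt ((ψ - φ).norm_apply_le x) (by simpa [dist_eq_norm] using hφψ)
    have h3 : ‖ψ x‖ ≤ ε := by
      have := norm_add_le (ψ x - φ x) (φ x)
      rw [sub_add_cancel] at this
      linarith
    have h4 : ‖(1 - χ x : ℂ)‖ ≤ 1 := by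
      have : (1 - χ x : ℂ) = ((1 - χ x : ℝ) : ℂ) := by push_cast; rfl
      rw [this, Complex.norm_real, Real.norm_eq_abs, abs_le]
      have := hχ01 x
      constructor <;> linarith [this.1, this.2]
    calc ‖ψ x - ψ x * χ x‖ = ‖ψ x‖ * ‖(1 - χ x : ℂ)‖ := by rw [← norm_mul]; ring_nf
      _ ≤ ε * 1 := by gcongr
      _ = ε := mul_one _

end Topology

section Proper

variable {Γ Γτ X : Type*} [Group Γ] [TopologicalSpace Γ] [T2Space Γ] [Group Γτ]
  [TopologicalSpace Γτ] [IsTopologicalGroup Γτ] [LocallyCompactSpace Γτ] [TopologicalSpace X]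
  [MulAction Γ X] (E : CentralExtension Γ Γτ)

/-- The projection is open with compact kernel `U(1)`. Finitely many compact sets of `Γτ` have
images covering `C`, and the preimage is a closed subset of their product with the circle. -/
theorem CentralExtension.isCompact_preimage_proj {C : Set Γ} (hC : IsCompact C) :
    IsCompact (E.proj ⁻¹' C) := by
  have hp := E.isOpenQuotientMap_proj
  choose K hK hKn using fun g : Γτ => exists_compact_mem_nhds g
  obtain ⟨t, ht⟩ := hC.elim_finite_subcover (fun g : Γτ => E.proj '' interior (K g))
    (fun g => hp.isOpenMap _ isOpen_interior) fun c _ => by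
      obtain ⟨g, rfl⟩ := hp.surjective c
      exact Set.mem_iUnion.2 ⟨g, g, mem_interior_iff_mem_nhds.2 (hKn g), rfl⟩
  have h1 : IsCompact ((⋃ g ∈ t, K g) * Set.range E.incl) :=
    (t.finite_toSet.isCompact_biUnion fun g _ => hK g).mul (isCompact_range E.continuous_incl)
  refine h1.of_isClosed_subset (hC.isClosed.preimage hp.continuous) fun k hk => ?_
  obtain ⟨g, hg, k', hk', he⟩ := Set.mem_iUnion₂.1 (ht hk)
  have : k'⁻¹ * k ∈ E.proj.ker := by
    rw [MonoidHom.mem_ker, map_mul, map_inv, he, inv_mul_cancel]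
  rw [E.exact] at this
  exact ⟨k', Set.mem_iUnion₂.2 ⟨g, hg, interior_subset hk'⟩, _, this, mul_inv_cancel_left _ _⟩

theorem CentralExtension.isCompact_setOf_smul_inter [ProperSMul Γ X] {U V : Set X}
    (hU : IsCompact U) (hV : IsCompact V) :
    IsCompact {g : Γτ | ∃ x ∈ U, E.proj g • x ∈ V} := by
  have h := E.isCompact_preimage_proj
    (ProperSMul.isCompact_setOfPred_inter_nonempty (G := Γ) hU hV)
  convert h using 1
  ext g
  constructor
  · rintro ⟨x, hx, hx'⟩
    exact ⟨_, ⟨x, hx, rfl⟩, hx'⟩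
  · rintro ⟨_, ⟨x, hx, rfl⟩, hx'⟩
    exact ⟨x, hx, hx'⟩

end Proper

section Cutoff

variable {Γ Γτ X : Type*} [Group Γ] [TopologicalSpace Γ] [IsTopologicalGroup Γ]
  [LocallyCompactSpace Γ] [Group Γτ]
  [TopologicalSpace Γτ] [TopologicalSpace X]
  [MulAction Γ X] [ContinuousSMul Γ X] {E : CentralExtension Γ Γτ}

theorem continuous_translationAct_proj (φ : C₀(X, ℂ)) :
    Continuous fun g => (translationAct Γ X).comp E.proj g φ :=
  (continuous_translationAct φ).comp E.isOpenQuotientMap_proj.continuous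

end Cutoff

/-! ### Compactly supported cutoffs of integrated forms -/

section CutoffIntegratedForm

variable {G X : Type*} [Group G] [TopologicalSpace G] [IsTopologicalGroup G] [MeasurableSpace G]
  [BorelSpace G] [TopologicalSpace X] [LocallyCompactSpace X] [T2Space X]
  {α : G →* (C₀(X, ℂ) ≃⋆ₐ[ℂ] C₀(X, ℂ))} (ν : Measure G) [IsFiniteMeasureOnCompacts ν]

/-- Cutting off with a function of compact support on `X` hardly changes an integrated form. -/
theorem exists_norm_integratedForm_sub_mul_le (hα : ∀ φ, Continuous fun g => α g φ)
    (b : C_c(G, C₀(X, ℂ))) {ε : ℝ} (hε : 0 < ε) :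
    ∃ χ : C₀(X, ℂ), HasCompactSupport χ ∧ ∀ (H : Type u) [NormedAddCommGroup H]
      [InnerProductSpace ℂ H] [CompleteSpace H] (c : CovariantPair α H),
      ‖c.integratedForm ν b - c.integratedForm ν b * c.π χ‖ ≤ ε := by
  -- By covariance `π(b g) u(g) = u(g) π(α_{g⁻¹}(b g))`, so the functions to be cut off are the
  -- `α_{g⁻¹}(b g)` for `g` in the support of `b`; they form a compact set.
  have hbc : Continuous fun g => α g⁻¹ (b g) := by
    have h1 := continuous_uncurry_of_stronglyContinuous (α := fun g => α g) hα
    exact h1.comp (continuous_inv.prodMk b.continuous)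
  have hC : IsCompact ((fun g => α g⁻¹ (b g)) '' tsupport b) :=
    b.hasCompactSupport.isCompact.image hbc
  -- The tolerance will be `ε / (M + 1)` rather than `ε / M`, since `M` may be zero.
  set M := (ν (tsupport b)).toReal
  have hM : 0 ≤ M := ENNReal.toReal_nonneg
  obtain ⟨χ, hχ, hb⟩ := exists_hasCompactSupport_norm_sub_mul_le hC
    (div_pos hε (by linarith : 0 < M + 1))
  refine ⟨χ, hχ, fun H _ _ _ c => ContinuousLinearMap.opNorm_le_bound _ hε.le fun ξ => ?_⟩
  have hbd : ∀ g, ‖c.π (b g) ((c.u g : H →L[ℂ] H) (ξ - c.π χ ξ))‖ ≤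
      (tsupport b).indicator (fun _ => ε / (M + 1) * ‖ξ‖) g := fun g => by
    by_cases hg : g ∈ tsupport b
    · have h0 : c.π (b g) ((c.u g : H →L[ℂ] H) (ξ - c.π χ ξ)) =
          c.π (b g - b g * α g χ) ((c.u g : H →L[ℂ] H) ξ) := by
        rw [map_sub, map_sub, c.u_apply_π_apply, map_sub c.π, map_mul c.π]
        rfl
      rw [Set.indicator_of_mem hg, h0]
      refine (ContinuousLinearMap.le_opNorm _ _).trans ?_
      rw [c.norm_u_apply]
      gcongr
      refine (c.norm_π_le _).trans ?_
      have h1 : α g⁻¹ (b g - b g * α g χ) = α g⁻¹ (b g) - α g⁻¹ (b g) * χ := by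
        rw [map_sub, map_mul]
        congr 2
        change (α g⁻¹ * α g) χ = χ
        rw [← map_mul, inv_mul_cancel, map_one]
        rfl
      rw [← StarAlgEquiv.norm_map (α g⁻¹), h1]
      exact hb _ ⟨g, hg, rfl⟩
    · rw [Set.indicator_of_notMem hg, image_eq_zero_of_notMem_tsupport hg, map_zero]
      simp
  have hm : MeasurableSet (tsupport b) := (isClosed_tsupport b).measurableSet
  have hfin : ν (tsupport b) ≠ ⊤ := b.hasCompactSupport.isCompact.measure_ne_top
  calc ‖(c.integratedForm ν b - c.integratedForm ν b * c.π χ) ξ‖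
      = ‖∫ g, c.π (b g) ((c.u g : H →L[ℂ] H) (ξ - c.π χ ξ)) ∂ν‖ := by
        rw [← c.integratedForm_apply ν, map_sub]
        rfl
    _ ≤ ∫ g, (tsupport b).indicator (fun _ => ε / (M + 1) * ‖ξ‖) g ∂ν :=
        norm_integral_le_of_norm_le ((integrable_indicator_iff hm).2 (integrableOn_const hfin))
          (Eventually.of_forall hbd)
    _ = M / (M + 1) * (ε * ‖ξ‖) := by
        rw [integral_indicator hm, setIntegral_const, smul_eq_mul]
        change M * _ = _
        ring
    _ ≤ 1 * (ε * ‖ξ‖) := by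
        gcongr
        rw [div_le_one (by linarith)]
        linarith
    _ = ε * ‖ξ‖ := one_mul _

end CutoffIntegratedForm



/-! ### Sections of compact operators from the twisted crossed product -/

section TwistedL2

variable {Γ Γτ : Type*} [Group Γ] [TopologicalSpace Γ] [Group Γτ] [TopologicalSpace Γτ]
  [IsTopologicalGroup Γτ] [MeasurableSpace Γτ] [BorelSpace Γτ]
  {E : CentralExtension Γ Γτ} (ν : Measure Γτ) [ν.IsMulLeftInvariant]

/-- The element of `L²_τ(Γ)` given by a homogeneous square integrable function. -/
def TwistedL2.mk (f : Γτ → ℂ) (hf : MemLp f 2 ν)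
    (h : ∀ (z : Circle) (g : Γτ), f ((E.incl z)⁻¹ * g) = z * f g) : TwistedL2 E ν :=
  ⟨hf.toLp, fun z => by
    filter_upwards [hf.coeFn_toLp,
      (measurePreserving_mul_left ν (E.incl z)⁻¹).quasiMeasurePreserving.ae hf.coeFn_toLp]
      with g h1 h2
    rw [h1, h2, h]⟩

theorem TwistedL2.mk_coeFn (f : Γτ → ℂ) (hf : MemLp f 2 ν)
    (h : ∀ (z : Circle) (g : Γτ), f ((E.incl z)⁻¹ * g) = z * f g) :
    (TwistedL2.mk ν f hf h).toLp =ᵐ[ν] f :=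
  hf.coeFn_toLp

end TwistedL2

section FiberContinuity

variable {Γ Γτ X : Type*} [Group Γ] [TopologicalSpace Γ] [IsTopologicalGroup Γ] [T2Space Γ]
  [Group Γτ] [TopologicalSpace Γτ]
  [IsTopologicalGroup Γτ] [LocallyCompactSpace Γτ] [T2Space Γτ] [SecondCountableTopology Γτ]
  [MeasurableSpace Γτ] [BorelSpace Γτ] [TopologicalSpace X] [LocallyCompactSpace X] [T2Space X]
  [MulAction Γ X] [ContinuousSMul Γ X] [ProperSMul Γ X]
  (E : CentralExtension Γ Γτ) (ν : Measure Γτ) [ν.IsHaarMeasure]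

theorem norm_fiberRep_sub_le {x y : X} {φ : C₀(X, ℂ)} {C : ℝ} (hC : 0 ≤ C)
    (h : ∀ γ : Γ, ‖φ (γ • y) - φ (γ • x)‖ ≤ C) :
    ‖fiberRep E ν y φ - fiberRep E ν x φ‖ ≤ C := by
  refine ContinuousLinearMap.opNorm_le_bound _ hC fun f => ?_
  have h0 : (fiberRep E ν y φ - fiberRep E ν x φ) f = fiberRep E ν y φ f - fiberRep E ν x φ f := rfl
  rw [h0, ← TwistedL2.norm_toLp, ← TwistedL2.norm_toLp]
  refine Lp.norm_le_mul_norm_of_ae_le_mul ?_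
  filter_upwards [fiberRep_coeFn E ν x φ f, fiberRep_coeFn E ν y φ f,
    Lp.coeFn_sub (fiberRep E ν y φ f).toLp (fiberRep E ν x φ f).toLp] with g h1 h2 h3
  have h4 : (fiberRep E ν y φ f - fiberRep E ν x φ f).toLp g =
      (φ (E.proj g • y) - φ (E.proj g • x)) * f.toLp g := by
    rw [sub_mul, ← h1, ← h2]
    exact h3
  rw [h4, norm_mul]
  gcongr
  exact h _

/-- Properness: for points in a compact neighbourhood of `x`, only a compact set of group elements
moves them to where `φ` is large, so `φ(γ y)` is close to `φ(γ x)` uniformly in `γ`. -/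
theorem continuous_fiberRep (φ : C₀(X, ℂ)) : Continuous fun x => fiberRep E ν x φ := by
  refine continuous_iff_continuousAt.2 fun x => ?_
  obtain ⟨N, hN, hxN⟩ := exists_compact_mem_nhds x
  rw [ContinuousAt, tendsto_iff_norm_sub_tendsto_zero]
  refine Metric.tendsto_nhds.2 fun ε hε => ?_
  have hm : Continuous fun q : X × Γ => q.2 • q.1 := continuous_snd.smul continuous_fst
  filter_upwards [eventually_forall_norm_comp_sub_le (m := fun (y : X) (γ : Γ) => γ • y) hm hxN
    (fun K hK => ⟨_, ProperSMul.isCompact_setOfPred_inter_nonempty (G := Γ) hN hK,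
      fun p hp γ hγ hK' => hγ ⟨_, ⟨p, hp, rfl⟩, hK'⟩⟩) φ (half_pos hε)] with y hy
  rw [dist_zero_right, norm_norm]
  exact (norm_fiberRep_sub_le E ν (half_pos hε).le hy).trans_lt (half_lt_self hε)

theorem continuous_uncurry_fiberRep :
    Continuous fun q : C₀(X, ℂ) × X => fiberRep E ν q.2 q.1 := by
  refine continuous_prod_of_continuous_lipschitzWith _ 1
    (fun φ => continuous_fiberRep E ν φ) (fun x => LipschitzWith.of_dist_le_mul fun φ ψ => ?_)
  rw [dist_eq_norm, dist_eq_norm, NNReal.coe_one, one_mul, ← map_sub]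
  exact (fiberPair E ν x).norm_π_le _

/-- All fibre pairs share the same unitary representation, so two integrated forms differ in norm by
at most `∫ ‖π_y(b g) - π_x(b g)‖ dg`, which is continuous in `y` and vanishes at `x`. -/
theorem continuous_integratedForm_fiberPair (b : C_c(Γτ, C₀(X, ℂ))) :
    Continuous fun x => (fiberPair E ν x).integratedForm ν b := by
  refine continuous_iff_continuousAt.2 fun x => ?_
  rw [ContinuousAt, tendsto_iff_norm_sub_tendsto_zero]
  have hF : Continuous fun q : X × Γτ => ‖fiberRep E ν q.1 (b q.2) - fiberRep E ν x (b q.2)‖ := by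
    refine Continuous.norm (Continuous.sub ?_ ?_)
    · exact (continuous_uncurry_fiberRep E ν).comp
        ((b.continuous.comp continuous_snd).prodMk continuous_fst)
    · exact (fiberPair E ν x).πL.continuous.comp (b.continuous.comp continuous_snd)
  have h1 : Continuous fun y => ∫ g, ‖fiberRep E ν y (b g) - fiberRep E ν x (b g)‖ ∂ν := by
    rw [← continuousOn_univ]
    refine continuousOn_integral_of_compact_support b.hasCompactSupport.isCompact
      hF.continuousOn fun y g _ hg => ?_
    simp [image_eq_zero_of_notMem_tsupport hg]
  have h2 := h1.tendsto x
  simp only [sub_self, norm_zero, integral_zero] at h2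
  refine squeeze_zero (fun _ => norm_nonneg _) (fun y => ?_) h2
  have hint : Integrable (fun g => ‖fiberRep E ν y (b g) - fiberRep E ν x (b g)‖) ν := by
    refine (hF.comp (by fun_prop : Continuous fun g : Γτ => (y, g))).integrable_of_hasCompactSupport
      ?_
    refine b.hasCompactSupport.mono fun g hg => ?_
    contrapose! hg
    simp only [Function.mem_support, ne_eq, not_not] at hg ⊢
    simp [hg]
  refine ContinuousLinearMap.opNorm_le_bound _ (integral_nonneg fun _ => norm_nonneg _) fun ξ => ?_
  rw [sub_apply, CovariantPair.integratedForm_apply, CovariantPair.integratedForm_apply,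
    ← integral_sub ((fiberPair E ν y).integrable_integrand ν b ξ)
      ((fiberPair E ν x).integrable_integrand ν b ξ), ← integral_mul_const]
  refine norm_integral_le_of_norm_le (hint.mul_const _) (Eventually.of_forall fun g => ?_)
  have h3 := (fiberRep E ν y (b g) - fiberRep E ν x (b g)).le_opNorm
    (((fiberPair E ν x).u g : TwistedL2 E ν →L[ℂ] TwistedL2 E ν) ξ)
  rw [(fiberPair E ν x).norm_u_apply] at h3
  exact h3

/-- Properness confines `g ↦ χ(p(g) x)` to a compact set, and the compact support of `b` then
confines the other variable, so the operator is given by a continuous kernel of compact support. -/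
theorem isCompactOperator_integratedForm_mul_fiberRep (b : C_c(Γτ, C₀(X, ℂ))) {χ : C₀(X, ℂ)}
    (hχ : HasCompactSupport χ) (x : X) :
    IsCompactOperator ((fiberPair E ν x).integratedForm ν b * fiberRep E ν x χ) := by
  set C : Set Γτ := {g | ∃ y ∈ ({x} : Set X), E.proj g • y ∈ tsupport χ}
  have hC : IsCompact C := E.isCompact_setOf_smul_inter isCompact_singleton hχ
  have hχC : ∀ g ∉ C, χ (E.proj g • x) = 0 := fun g hg =>
    image_eq_zero_of_notMem_tsupport fun h => hg ⟨x, rfl, h⟩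
  -- Rieffel's formula after replacing `g` by `k g⁻¹`, which brings in the modular function.
  let K : Γτ → Γτ → ℂ := fun k g =>
    (Measure.modularCharacterFun g : ℝ) * (b (k * g⁻¹) (E.proj k • x) * χ (E.proj g • x))
  have hp := E.isOpenQuotientMap_proj.continuous
  have hK : Continuous (Function.uncurry K) := by
    have h1 : Continuous fun q : Γτ × Γτ => b (q.1 * q.2⁻¹) (E.proj q.1 • x) :=
      (continuous_uncurry_eval b).comp ((continuous_fst.mul continuous_snd.inv).prodMk
        ((hp.comp continuous_fst).smul continuous_const))
    have h2 : Continuous fun q : Γτ × Γτ => χ (E.proj q.2 • x) :=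
      (continuous_orbit_eval E x χ).comp continuous_snd
    have h3 : Continuous fun q : Γτ × Γτ => ((Measure.modularCharacterFun q.2 : ℝ) : ℂ) :=
      Complex.continuous_ofReal.comp (NNReal.continuous_coe.comp
        (continuous_modularCharacterFun.comp continuous_snd))
    exact h3.mul (h1.mul h2)
  have hKc : HasCompactSupport (Function.uncurry K) := by
    refine HasCompactSupport.of_support_subset_isCompact
      ((b.hasCompactSupport.isCompact.mul hC).prod hC) fun q hq => ?_
    have h1 : q.2 ∈ C := by
      by_contra h
      exact hq (by simp [Function.uncurry, K, hχC _ h])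
    refine ⟨⟨q.1 * q.2⁻¹, ?_, q.2, h1, inv_mul_cancel_right _ _⟩, h1⟩
    by_contra h
    exact hq (by simp [Function.uncurry, K, image_eq_zero_of_notMem_tsupport h])
  obtain ⟨T, hT, hTK⟩ := exists_isCompactOperator_of_kernel (μ := ν) (ν := ν) hK hKc
  set ι := TwistedL2.toLpₗᵢ E ν
  -- The kernel acts on all of `L²(Γτ)`; compressing by the inclusion of `L²_τ(Γ)` and its adjoint
  -- recovers the fibre operator.
  have key : (fiberPair E ν x).integratedForm ν b * fiberRep E ν x χ =
      ContinuousLinearMap.adjoint ι.toContinuousLinearMap ∘L T ∘L ι.toContinuousLinearMap := by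
    ext1 f
    have h1 : T f.toLp = ((fiberPair E ν x).integratedForm ν b (fiberRep E ν x χ f)).toLp := by
      apply Lp.ext
      have hae : ∀ᵐ g ∂ν, (fiberRep E ν x χ f).toLp g = χ (E.proj g • x) * f.toLp g :=
        fiberRep_coeFn E ν x χ f
      filter_upwards [hTK f.toLp, integratedForm_fiberPair_coeFn E ν x b (fiberRep E ν x χ f)]
        with k h2 h3
      have h6 : ∀ F : Γτ → ℂ, ∫ g, F g ∂ν =
          ∫ g, (Measure.modularCharacterFun g : ℝ) • F (k * g⁻¹) ∂ν := fun F => by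
        rw [integral_modularCharacterFun_smul_inv ν fun g => F (k * g), integral_mul_left_eq_self]
      rw [h2, h3, h6 fun g => b g _ * _]
      refine integral_congr_ae ?_
      filter_upwards [hae] with g h4
      have h5 : (k * g⁻¹)⁻¹ * k = g := by group
      simp only [h5, h4, K, Complex.real_smul]
      ring
    refine ext_inner_left ℂ fun f' => ?_
    change inner ℂ f'.toLp ((fiberPair E ν x).integratedForm ν b (fiberRep E ν x χ f)).toLp = _
    rw [← h1]
    exact (ContinuousLinearMap.adjoint_inner_right ι.toContinuousLinearMap f' (T f.toLp)).symm
  rw [key]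
  exact (hT.comp_clm ι.toContinuousLinearMap).clm_comp
    (ContinuousLinearMap.adjoint ι.toContinuousLinearMap)

end FiberContinuity

section SectionAlgebra

variable {S : Type v} {Γ Γτ X : Type u} [Group S] [TopologicalSpace S]
  [Group Γ] [TopologicalSpace Γ] [IsTopologicalGroup Γ] [T2Space Γ] [LocallyCompactSpace Γ]
  [Group Γτ] [TopologicalSpace Γτ]
  [IsTopologicalGroup Γτ] [LocallyCompactSpace Γτ] [T2Space Γτ] [SecondCountableTopology Γτ]
  [MeasurableSpace Γτ] [BorelSpace Γτ] [TopologicalSpace X] [LocallyCompactSpace X] [T2Space X]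
  [MulAction Γ X] [ContinuousSMul Γ X] [ProperSMul Γ X]
  [MulDistribMulAction S Γ] [MulDistribMulAction S Γτ] [ContinuousSMul S Γτ]
  {E : CentralExtension Γ Γτ} (hE : E.IsLift S) (ν : Measure Γτ) [ν.IsHaarMeasure]

/-- The universal norm dominates every covariant pair, so a single function approximates `T` in all
fibres at once. Continuity, compactness and decay of the section then pass from functions to `T`. -/
theorem exists_norm_evalFiber_sub_le {T : UniversalAlgebra ((translationAct Γ X).comp E.proj)}
    (hT : T ∈ twistedCrossedProduct E ν (translationAct Γ X)) {ε : ℝ} (hε : 0 < ε) :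
    ∃ a : C_c(Γτ, C₀(X, ℂ)), E.IsHomogeneous 1 a ∧
      ∀ x, ‖evalFiber ν x T - (fiberPair E ν x).integratedForm ν a‖ ≤ ε := by
  obtain ⟨_, ⟨a, ha, rfl⟩, h⟩ := Metric.mem_closure_iff.1
    (mem_closure_of_mem_homogeneousIdeal ν continuous_translationAct_proj hT) ε hε
  refine ⟨a, ha, fun x => ?_⟩
  rw [dist_eq_norm] at h
  exact ((T - universalForm _ ν a).norm_eval_le (H := ⟨TwistedL2 E ν⟩) (fiberPair E ν x)).trans h.le

theorem continuous_evalFiber {T : UniversalAlgebra ((translationAct Γ X).comp E.proj)}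
    (hT : T ∈ twistedCrossedProduct E ν (translationAct Γ X)) :
    Continuous fun x => evalFiber ν x T := by
  refine continuous_of_uniform_approx_of_continuous fun u hu => ?_
  obtain ⟨ε, hε, hu⟩ := Metric.mem_uniformity_dist.1 hu
  obtain ⟨a, -, h⟩ := exists_norm_evalFiber_sub_le ν hT (half_pos hε)
  refine ⟨_, continuous_integratedForm_fiberPair E ν a, fun x => hu ?_⟩
  rw [dist_eq_norm]
  exact (h x).trans_lt (half_lt_self hε)

theorem isCompactOperator_evalFiber {T : UniversalAlgebra ((translationAct Γ X).comp E.proj)}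
    (hT : T ∈ twistedCrossedProduct E ν (translationAct Γ X)) (x : X) :
    IsCompactOperator (evalFiber ν x T) := by
  have hcl : IsClosed {A : TwistedL2 E ν →L[ℂ] TwistedL2 E ν | IsCompactOperator A} :=
    isClosed_setOfPred_isCompactOperator
  refine hcl.closure_subset (Metric.mem_closure_iff.2 fun ε hε => ?_)
  obtain ⟨a, -, h⟩ := exists_norm_evalFiber_sub_le ν hT (half_pos (half_pos hε))
  obtain ⟨χ, hχ, h'⟩ := exists_norm_integratedForm_sub_mul_le.{u} ν
    (continuous_translationAct_proj (E := E)) a (half_pos (half_pos hε))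
  refine ⟨_, isCompactOperator_integratedForm_mul_fiberRep E ν a hχ x, ?_⟩
  rw [dist_eq_norm]
  have h2 := h' (TwistedL2 E ν) (fiberPair E ν x)
  refine (norm_sub_le_norm_sub_add_norm_sub _ ((fiberPair E ν x).integratedForm ν a) _).trans_lt
    (((add_le_add (h x) h2)).trans_lt ?_)
  linarith

/-- Up to `ε` the fibre operator contains a factor `π_x(χ)` with `χ` of compact support, and this
factor is zero on orbits missing that support. -/
theorem tendsto_evalFiber {T : UniversalAlgebra ((translationAct Γ X).comp E.proj)}
    (hT : T ∈ twistedCrossedProduct E ν (translationAct Γ X)) :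
    Tendsto (fun x => evalFiber ν x T) (comap (Quotient.mk (MulAction.orbitRel Γ X))
      (cocompact (MulAction.orbitRel.Quotient Γ X))) (𝓝 0) := by
  rw [tendsto_zero_iff_norm_tendsto_zero]
  refine Metric.tendsto_nhds.2 fun ε hε => ?_
  obtain ⟨a, -, h⟩ := exists_norm_evalFiber_sub_le ν hT (half_pos (half_pos hε))
  obtain ⟨χ, hχ, h'⟩ := exists_norm_integratedForm_sub_mul_le.{u} ν
    (continuous_translationAct_proj (E := E)) a (half_pos (half_pos hε))
  have hq : Continuous (Quotient.mk (MulAction.orbitRel Γ X)) := continuous_quotient_mk'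
  refine eventually_comap.2 ?_
  filter_upwards [(hχ.isCompact.image hq).compl_mem_cocompact] with q hq x hx
  have h3 : fiberRep E ν x χ = 0 := by
    refine norm_le_zero_iff.1 (norm_fiberRep_le E ν le_rfl fun γ => ?_)
    have hγ : γ • x ∉ tsupport χ := fun hγ =>
      hq ⟨γ • x, hγ, Eq.trans (Quotient.sound ⟨γ, rfl⟩) hx⟩
    rw [image_eq_zero_of_notMem_tsupport hγ, norm_zero]
  have h2 := h' (TwistedL2 E ν) (fiberPair E ν x)
  rw [fiberPair_π, h3, mul_zero, sub_zero] at h2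
  have h4 := norm_le_norm_sub_add (evalFiber ν x T) ((fiberPair E ν x).integratedForm ν a)
  rw [dist_zero_right, norm_norm]
  linarith [h x]

/-- The family of operators given by the pairs at the points of `X`, as a map from the twisted
crossed product to operator valued functions. -/
def sectionHom : twistedCrossedProduct E ν (translationAct Γ X) →⋆ₙₐ[ℂ]
    OperatorFunctions X (TwistedL2 E ν) where
  toFun T := OperatorFunctions.mk (fun x => evalFiber ν x T.1) (continuous_evalFiber ν T.2) ‖T.1‖
    fun _ => T.1.norm_eval_le _
  map_smul' _ _ := rfl
  map_zero' := rfl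
  map_add' _ _ := rfl
  map_mul' _ _ := rfl
  map_star' _ := rfl

theorem sectionHom_apply (T : twistedCrossedProduct E ν (translationAct Γ X)) (x : X) :
    sectionHom ν T x = evalFiber ν x T.1 := rfl

theorem sectionHom_mem [MulAction S X] [ContinuousSMul S X]
    (T : twistedCrossedProduct E ν (translationAct Γ X)) :
    sectionHom ν T ∈ fixedPointAlgebra hE ν X :=
  ⟨isCompactOperator_evalFiber ν T.2,
    fun g x => evalFiber_smul hE ν (homogeneousIdeal_le_crossedProduct _ _ _ _ T.2) x g,
    tendsto_evalFiber ν T.2⟩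

end SectionAlgebra



/-! ### Square integral estimates and injectivity -/

section SquareIntegrals

variable {X : Type*} [TopologicalSpace X]

/-- Evaluation at a point as a continuous linear functional on `C₀(X)`. -/
def ZeroAtInftyContinuousMap.evalCLM (x : X) : C₀(X, ℂ) →L[ℂ] ℂ :=
  LinearMap.mkContinuous
    { toFun := fun φ => φ x
      map_add' := fun _ _ => rfl
      map_smul' := fun _ _ => rfl } 1 fun φ => by
      rw [one_mul]
      exact φ.norm_apply_le x

theorem ZeroAtInftyContinuousMap.integral_apply {Y : Type*} [MeasurableSpace Y] {μ : Measure Y}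
    {φ : Y → C₀(X, ℂ)} (hφ : Integrable φ μ) (x : X) : (∫ y, φ y ∂μ) x = ∫ y, φ y x ∂μ :=
  ((ZeroAtInftyContinuousMap.evalCLM x).integral_comp_comm hφ).symm

variable {G : Type*} [Group G] [TopologicalSpace G] [IsTopologicalGroup G] [MeasurableSpace G]
  [BorelSpace G] [T2Space G]
  {α : G →* (C₀(X, ℂ) ≃⋆ₐ[ℂ] C₀(X, ℂ))} (ν : Measure G) [IsFiniteMeasureOnCompacts ν]
  {H : Type*} [NormedAddCommGroup H] [InnerProductSpace ℂ H] [CompleteSpace H]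

/-- The left side equals `⟨v, π(∫ φ_g* φ_g dg) v⟩`, and the norm in `C₀(X)` of that integral is the
supremum over `x` of the scalar integrals in the hypothesis. -/
theorem CovariantPair.setIntegral_norm_π_apply_sq_le (c : CovariantPair α H)
    {φ : G → C₀(X, ℂ)} (hφ : Continuous φ) {L : Set G} (hL : IsCompact L) {C : ℝ} (hC : 0 ≤ C)
    (h : ∀ x, ∫ g in L, ‖φ g x‖ ^ 2 ∂ν ≤ C) (v : H) :
    ∫ g in L, ‖c.π (φ g) v‖ ^ 2 ∂ν ≤ C * ‖v‖ ^ 2 := by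
  have hF : Continuous fun g => star (φ g) * φ g := hφ.star.mul hφ
  have hFi : IntegrableOn (fun g => star (φ g) * φ g) L ν := hF.continuousOn.integrableOn_compact hL
  let ℓ : C₀(X, ℂ) →L[ℂ] ℂ := (innerSL ℂ v) ∘L (ContinuousLinearMap.apply ℂ H v) ∘L c.πL
  have h1 : ∀ g, ((‖c.π (φ g) v‖ ^ 2 : ℝ) : ℂ) = ℓ (star (φ g) * φ g) := fun g => by
    change _ = inner ℂ v (c.π (star (φ g) * φ g) v)
    rw [map_mul, mul_apply_eq_comp, ← c.inner_π_apply, inner_self_eq_norm_sq_to_K]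
    push_cast
    rfl
  have h2 : ((∫ g in L, ‖c.π (φ g) v‖ ^ 2 ∂ν : ℝ) : ℂ) =
      inner ℂ v (c.π (∫ g in L, star (φ g) * φ g ∂ν) v) := by
    rw [← integral_complex_ofReal]
    simp only [h1]
    exact ℓ.integral_comp_comm hFi
  have h3 : ‖∫ g in L, star (φ g) * φ g ∂ν‖ ≤ C := by
    refine ZeroAtInftyContinuousMap.norm_le_of_forall_le hC fun x => ?_
    rw [ZeroAtInftyContinuousMap.integral_apply hFi]
    have h4 : ∀ g, (star (φ g) * φ g) x = ((‖φ g x‖ ^ 2 : ℝ) : ℂ) := fun g => by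
      change star (φ g x) * φ g x = _
      rw [Complex.star_def, Complex.conj_mul']
      push_cast
      rfl
    simp only [h4]
    rw [integral_complex_ofReal, Complex.norm_real, Real.norm_of_nonneg
      (integral_nonneg fun _ => by positivity)]
    exact h x
  calc ∫ g in L, ‖c.π (φ g) v‖ ^ 2 ∂ν
      = ‖((∫ g in L, ‖c.π (φ g) v‖ ^ 2 ∂ν : ℝ) : ℂ)‖ := by
        rw [Complex.norm_real, Real.norm_of_nonneg (integral_nonneg fun _ => by positivity)]
    _ ≤ ‖v‖ * (C * ‖v‖) := by
        rw [h2]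
        refine (norm_inner_le_norm _ _).trans ?_
        gcongr
        refine (ContinuousLinearMap.le_opNorm _ _).trans ?_
        gcongr
        exact (c.norm_π_le _).trans h3
    _ = C * ‖v‖ ^ 2 := by ring

/-- A Cauchy–Schwarz inequality valid in every covariant pair: the integrated form is controlled by
pointwise square integrals over the group, one for `χ` and one for `b`. Unlike the `L¹` bound, the
integral for `b` can be read off from the fibre pairs. -/
theorem CovariantPair.norm_integratedForm_π_apply_sq_le (hα : ∀ φ, Continuous fun g => α g φ)
    (c : CovariantPair α H) (b : C_c(G, C₀(X, ℂ))) (χ : C₀(X, ℂ)) {C M : ℝ} (hC : 0 < C)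
    (hχ : ∀ x, ∫ g in tsupport b, ‖α g (star χ) x‖ ^ 2 ∂ν ≤ C) (hM : 0 ≤ M)
    (hb : ∀ x, ∫ g in tsupport b, ‖α g⁻¹ (b g) x‖ ^ 2 ∂ν ≤ M) (v : H) :
    ‖c.integratedForm ν b (c.π χ v)‖ ^ 2 ≤ C * M * ‖v‖ ^ 2 := by
  set L := tsupport b
  have hL : IsCompact L := b.hasCompactSupport.isCompact
  have hB : Continuous fun g => α g⁻¹ (b g) :=
    (continuous_uncurry_of_stronglyContinuous (α := fun g => α g) hα).comp
      (continuous_inv.prodMk b.continuous)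
  -- Commutativity of `C₀(X)` is used here: `χ` is moved to the left of `α_{g⁻¹}(b g)`, so that in
  -- the pairing with `w` it can be thrown onto `w`.
  have hA : c.integratedForm ν b (c.π χ v) =
      ∫ g in L, (c.u g : H →L[ℂ] H) (c.π χ (c.π (α g⁻¹ (b g)) v)) ∂ν := by
    rw [c.integratedForm_apply ν, ← setIntegral_eq_integral_of_forall_compl_eq_zero (s := L) (μ := ν)]
    · refine integral_congr_ae (Eventually.of_forall fun g => ?_)
      have h1 : c.π χ (c.π (α g⁻¹ (b g)) v) = c.π (α g⁻¹ (b g)) (c.π χ v) := by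
        rw [← mul_apply_eq_comp, ← map_mul, mul_comm, map_mul]
        rfl
      have h2 : α g (α g⁻¹ (b g)) = b g := by
        change (α g * α g⁻¹) (b g) = b g
        rw [← map_mul, mul_inv_cancel, map_one]
        rfl
      simp only [h1]
      rw [c.u_apply_π_apply g (α g⁻¹ (b g)), h2]
    · intro g hg
      rw [image_eq_zero_of_notMem_tsupport hg, map_zero]
      rfl
  set A := c.integratedForm ν b (c.π χ v)
  have hcont : Continuous fun g => (c.u g : H →L[ℂ] H) (c.π χ (c.π (α g⁻¹ (b g)) v)) :=
    c.continuous_uncurry_u.comp (continuous_id.prodMk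
      ((c.π χ).continuous.comp ((c.πL.continuous.comp hB).clm_apply continuous_const)))
  have key : ∀ w : H, ‖inner ℂ w A‖ ≤ (C * ‖w‖ ^ 2 + M * ‖v‖ ^ 2) / 2 := fun w => by
    have hP : Continuous fun g => ‖c.π (α g (star χ)) w‖ ^ 2 :=
      (((c.πL.continuous.comp (hα (star χ))).clm_apply continuous_const).norm).pow 2
    have hQ : Continuous fun g => ‖c.π (α g⁻¹ (b g)) v‖ ^ 2 :=
      (((c.πL.continuous.comp hB).clm_apply continuous_const).norm).pow 2
    have hPi := hP.continuousOn.integrableOn_compact (μ := ν) hL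
    have hQi := hQ.continuousOn.integrableOn_compact (μ := ν) hL
    have h1 : inner ℂ w A =
        ∫ g in L, inner ℂ w ((c.u g : H →L[ℂ] H) (c.π χ (c.π (α g⁻¹ (b g)) v))) ∂ν := by
      rw [hA]
      exact ((innerSL ℂ w).integral_comp_comm
        (hcont.continuousOn.integrableOn_compact (μ := ν) hL)).symm
    rw [h1]
    refine (norm_integral_le_of_norm_le ((hPi.add hQi).div_const 2)
      (Eventually.of_forall fun g => ?_)).trans ?_
    · have h2 : inner ℂ w ((c.u g : H →L[ℂ] H) (c.π χ (c.π (α g⁻¹ (b g)) v))) =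
          inner ℂ (c.π (α g (star χ)) w) ((c.u g : H →L[ℂ] H) (c.π (α g⁻¹ (b g)) v)) := by
        rw [c.u_apply_π_apply, c.inner_π_apply, ← map_star, star_star]
      rw [h2]
      refine (norm_inner_le_norm _ _).trans ?_
      rw [c.norm_u_apply]
      simp only [Pi.add_apply]
      nlinarith [sq_nonneg (‖c.π (α g (star χ)) w‖ - ‖c.π (α g⁻¹ (b g)) v‖)]
    · rw [integral_div, integral_add' hPi hQi]
      gcongr
      · exact c.setIntegral_norm_π_apply_sq_le ν (hα _) hL hC.le hχ w
      · exact c.setIntegral_norm_π_apply_sq_le ν hB hL hM hb v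
  -- This choice of `w` makes the first term on the right half of `C⁻¹ ‖A‖²`, to be absorbed in the
  -- left side.
  have h5 := key (((C⁻¹ : ℝ) : ℂ) • A)
  rw [inner_smul_left, norm_mul, norm_smul, inner_self_eq_norm_sq_to_K, Complex.conj_ofReal,
    Complex.norm_real, norm_pow, Real.norm_of_nonneg (inv_nonneg.2 hC.le)] at h5
  simp only [Complex.coe_algebraMap, Complex.norm_real, norm_norm] at h5
  have h6 : C * (C⁻¹ * ‖A‖) ^ 2 = C⁻¹ * ‖A‖ ^ 2 := by field_simp
  rw [h6] at h5
  have h7 : C⁻¹ * ‖A‖ ^ 2 ≤ M * ‖v‖ ^ 2 := by linarith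
  rwa [inv_mul_le_iff₀ hC, ← mul_assoc] at h7

end SquareIntegrals

section Injectivity

variable {Γ Γτ X : Type u}
  [Group Γ] [TopologicalSpace Γ] [IsTopologicalGroup Γ] [T2Space Γ] [LocallyCompactSpace Γ]
  [Group Γτ] [TopologicalSpace Γτ]
  [IsTopologicalGroup Γτ] [LocallyCompactSpace Γτ] [T2Space Γτ] [SecondCountableTopology Γτ]
  [MeasurableSpace Γτ] [BorelSpace Γτ] [TopologicalSpace X] [LocallyCompactSpace X] [T2Space X]
  [MulAction Γ X] [ContinuousSMul Γ X] [ProperSMul Γ X]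
  {E : CentralExtension Γ Γτ} (ν : Measure Γτ) [ν.IsHaarMeasure]

/-- The integrals of a compactly supported function along the orbits are bounded. -/
theorem exists_forall_integral_orbit_le {χ : X → ℝ} (hχ : Continuous χ)
    (hχc : HasCompactSupport χ) (hχ0 : ∀ x, 0 ≤ χ x) :
    ∃ C : ℝ, 0 < C ∧ ∀ (L : Set Γτ) (x : X), ∫ g in L, χ (E.proj g⁻¹ • x) ∂ν ≤ C := by
  obtain ⟨m, hm⟩ := hχ.bounded_above_of_compact_support hχc
  have hm' : ∀ x, χ x ≤ m := fun x => (Real.le_norm_self _).trans (hm x)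
  -- This compact set depends only on the support of `χ`, not on the orbit.
  set D : Set Γτ := {g | ∃ y ∈ tsupport χ, E.proj g • y ∈ tsupport χ}⁻¹
  have hD : IsCompact D := (E.isCompact_setOf_smul_inter hχc hχc).inv
  have hDm : MeasurableSet D := hD.isClosed.measurableSet
  have hm0 : 0 ≤ m ∨ IsEmpty X := by
    rcases isEmpty_or_nonempty X with h | ⟨⟨x⟩⟩
    · exact Or.inr h
    · exact Or.inl ((hχ0 x).trans (hm' x))
  rcases hm0 with hm0 | hX
  swap
  · exact ⟨1, one_pos, fun _ x => (hX.false x).elim⟩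
  -- The summand `1` only ensures a strictly positive bound.
  refine ⟨ν.real D * m + 1, by positivity, fun L x => ?_⟩
  have hp := E.isOpenQuotientMap_proj.continuous
  have hcont : Continuous fun g : Γτ => χ (E.proj g⁻¹ • x) :=
    hχ.comp ((hp.comp continuous_inv).smul continuous_const)
  have hint : Integrable (fun g : Γτ => χ (E.proj g⁻¹ • x)) ν := by
    refine hcont.integrable_of_hasCompactSupport (HasCompactSupport.of_support_subset_isCompact
      (E.isCompact_setOf_smul_inter (isCompact_singleton (x := x)) hχc).inv fun g hg => ?_)
    exact ⟨x, rfl, subset_tsupport _ hg⟩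
  refine (setIntegral_le_integral hint (Eventually.of_forall fun g => hχ0 _)).trans ?_
  by_cases hx : ∃ h : Γτ, E.proj h⁻¹ • x ∈ tsupport χ
  · obtain ⟨h, hh⟩ := hx
    -- Left translation moves the base point to `h⁻¹ x`, which lies in the support of `χ`; the
    -- integrand then vanishes outside `D`.
    rw [← integral_mul_left_eq_self _ h]
    have h1 : ∀ g : Γτ, χ (E.proj (h * g)⁻¹ • x) ≤ D.indicator (fun _ => m) g := fun g => by
      by_cases hg : g ∈ D
      · rw [Set.indicator_of_mem hg]
        exact hm' _
      · have h2 : E.proj (h * g)⁻¹ • x ∉ tsupport χ := fun h2 => by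
          rw [mul_inv_rev, map_mul, mul_smul] at h2
          exact hg ⟨_, hh, h2⟩
        rw [Set.indicator_of_notMem hg, image_eq_zero_of_notMem_tsupport h2]
    have h3 : ∫ g, D.indicator (fun _ => m) g ∂ν = ν.real D * m := by
      rw [integral_indicator hDm, setIntegral_const, smul_eq_mul]
    rw [← h3]
    refine (integral_mono_of_nonneg (Eventually.of_forall fun g => hχ0 _)
      ((integrable_indicator_iff hDm).2 (integrableOn_const hD.measure_ne_top))
      (Eventually.of_forall h1)).trans ?_
    linarith
  · push Not at hx
    have : ∀ g : Γτ, χ (E.proj g⁻¹ • x) = 0 := fun g => image_eq_zero_of_notMem_tsupport (hx g)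
    simp only [this, integral_zero]
    positivity

/-- The restriction `g ↦ b(g; g x)` of a homogeneous function to an orbit. -/
theorem exists_orbitVector {b : C_c(Γτ, C₀(X, ℂ))} (hb : E.IsHomogeneous 1 b) (x : X) :
    ∃ β : TwistedL2 E ν, β.toLp =ᵐ[ν] (fun g => b g (E.proj g • x)) ∧
      ‖β‖ ^ 2 ≤ ∫ g, ‖b g‖ ^ 2 ∂ν := by
  have hc : Continuous fun g : Γτ => b g (E.proj g • x) := (continuous_uncurry_eval b).comp
    (continuous_id.prodMk (E.isOpenQuotientMap_proj.continuous.smul continuous_const))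
  have hs : HasCompactSupport fun g : Γτ => b g (E.proj g • x) := by
    refine b.hasCompactSupport.mono fun g hg h => hg ?_
    simp only [h]
    rfl
  have hmem : MemLp (fun g : Γτ => b g (E.proj g • x)) 2 ν := hc.memLp_of_hasCompactSupport hs
  have hβ := TwistedL2.mk_coeFn (E := E) ν _ hmem fun z g => by
    rw [hb, zpow_one, E.proj_incl_inv_mul]
    rfl
  refine ⟨_, hβ, ?_⟩
  rw [← TwistedL2.norm_toLp, Lp.norm_sq_eq_integral]
  have hi : Integrable (fun g => ‖b g‖ ^ 2) ν := by
    refine (b.continuous.norm.pow 2).integrable_of_hasCompactSupport ?_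
    refine b.hasCompactSupport.mono fun g hg h => hg ?_
    simp [h]
  refine integral_mono_of_nonneg (Eventually.of_forall fun g => by positivity) hi ?_
  filter_upwards [hβ] with g hg
  simp only [hg]
  gcongr
  exact (b g).norm_apply_le _

/-- Restricted to the orbit of `x`, the convolution `a * b` is the fibre operator of `a` applied to
the restriction of `b`, which is a vector of `L²_τ(Γ)` because `b` has weight one. -/
theorem integral_norm_convolution_orbit_sq_le (a : C_c(Γτ, C₀(X, ℂ))) {b : C_c(Γτ, C₀(X, ℂ))}
    (hb : E.IsHomogeneous 1 b) (x : X) (L : Set Γτ) :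
    ∫ g in L, ‖convolution (α := (translationAct Γ X).comp E.proj) ν continuous_translationAct_proj
      a b g (E.proj g • x)‖ ^ 2 ∂ν ≤
      ‖(fiberPair E ν x).integratedForm ν a‖ ^ 2 * ∫ g, ‖b g‖ ^ 2 ∂ν := by
  obtain ⟨β, hβ, hn⟩ := exists_orbitVector ν hb x
  have h1 : (fun g => convolution (α := (translationAct Γ X).comp E.proj) ν
      continuous_translationAct_proj a b g (E.proj g • x)) =ᵐ[ν]
      ((fiberPair E ν x).integratedForm ν a β).toLp := by
    filter_upwards [integratedForm_fiberPair_coeFn E ν x a β] with g hg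
    rw [hg, convolution_apply, ZeroAtInftyContinuousMap.integral_apply
      (integrable_convolution_integrand ν continuous_translationAct_proj a b g)]
    refine integral_congr_ae ?_
    have hq : Measure.QuasiMeasurePreserving (fun h : Γτ => h⁻¹ * g) ν ν :=
      (quasiMeasurePreserving_mul_right ν g).comp (quasiMeasurePreserving_inv ν)
    filter_upwards [hq.ae hβ] with h hh
    have h3 : E.proj (h⁻¹ * g) • x = (E.proj h)⁻¹ • E.proj g • x := by
      rw [map_mul, map_inv, mul_smul]
    rw [hh, h3]
    rfl
  have h2 : (fun g => ‖convolution (α := (translationAct Γ X).comp E.proj) ν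
      continuous_translationAct_proj a b g (E.proj g • x)‖ ^ 2) =ᵐ[ν]
      fun g => ‖((fiberPair E ν x).integratedForm ν a β).toLp g‖ ^ 2 := by
    filter_upwards [h1] with g hg
    rw [hg]
  rw [integral_congr_ae (ae_restrict_of_ae h2)]
  refine (setIntegral_le_integral ((Lp.memLp _).integrable_norm_pow two_ne_zero)
    (Eventually.of_forall fun g => by positivity)).trans ?_
  rw [← Lp.norm_sq_eq_integral, TwistedL2.norm_toLp]
  calc _ ≤ (‖(fiberPair E ν x).integratedForm ν a‖ * ‖β‖) ^ 2 := by
        gcongr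
        exact ContinuousLinearMap.le_opNorm _ _
    _ ≤ _ := by
        rw [mul_pow]
        gcongr

/-- A function `a` within `ε` of `T` has all fibre operators of norm at most `ε`, because those of
`T` vanish. The two square integral estimates applied to `a * b` then bound the vector by a multiple
of `ε` independent of `a`. -/
theorem eval_mul_integratedForm_π_eq_zero {T : UniversalAlgebra ((translationAct Γ X).comp E.proj)}
    (hT : T ∈ twistedCrossedProduct E ν (translationAct Γ X)) (h0 : ∀ x, evalFiber ν x T = 0)
    {b : C_c(Γτ, C₀(X, ℂ))} (hb : E.IsHomogeneous 1 b) {χ : C₀(X, ℂ)} (hχ : HasCompactSupport χ)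
    {H : HilbertSpaceBundle.{u}}
    (c : CovariantPair ((translationAct Γ X).comp E.proj) H.carrier) (v : H.carrier) :
    T.eval c (c.integratedForm ν b (c.π χ v)) = 0 := by
  obtain ⟨C, hC, hCχ⟩ := exists_forall_integral_orbit_le (E := E) ν (χ := fun x => ‖χ x‖ ^ 2)
    (χ.continuous.norm.pow 2) (hχ.comp_left (g := fun φ => ‖φ‖ ^ 2) (by simp))
    (fun _ => by positivity)
  set w := c.integratedForm ν b (c.π χ v)
  set B := ∫ g, ‖b g‖ ^ 2 ∂ν
  have hB : 0 ≤ B := integral_nonneg fun _ => by positivity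
  have key : ∀ ε > 0, ‖T.eval c w‖ ≤ ε * (‖w‖ + Real.sqrt (C * B) * ‖v‖) := fun ε hε => by
    obtain ⟨_, ⟨a, ha, rfl⟩, h⟩ := Metric.mem_closure_iff.1
      (mem_closure_of_mem_homogeneousIdeal ν continuous_translationAct_proj hT) ε hε
    rw [dist_eq_norm] at h
    have h1 : ∀ {K : HilbertSpaceBundle.{u}}
        (d : CovariantPair ((translationAct Γ X).comp E.proj) K.carrier),
        ‖T.eval d - d.integratedForm ν a‖ ≤ ε := fun d =>
      ((T - universalForm _ ν a).norm_eval_le d).trans h.le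
    have h2 : ∀ x, ‖(fiberPair E ν x).integratedForm ν a‖ ≤ ε := fun x => by
      have := h1 (K := ⟨TwistedL2 E ν⟩) (fiberPair E ν x)
      have h3 : T.eval (H := ⟨TwistedL2 E ν⟩) (fiberPair E ν x) = 0 := h0 x
      rw [h3, zero_sub, norm_neg] at this
      exact this
    set d := convolution (α := (translationAct Γ X).comp E.proj) ν
      continuous_translationAct_proj a b
    have h4 : ‖c.integratedForm ν a w‖ ^ 2 ≤ C * (ε ^ 2 * B) * ‖v‖ ^ 2 := by
      have h5 : c.integratedForm ν a w = c.integratedForm ν d (c.π χ v) := by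
        rw [integratedForm_convolution]
        rfl
      rw [h5]
      refine c.norm_integratedForm_π_apply_sq_le ν continuous_translationAct_proj d χ hC
        (fun x => ?_) (by positivity) (fun x => ?_) v
      · refine le_trans (le_of_eq ?_) (hCχ (tsupport d) x)
        refine integral_congr_ae (Eventually.of_forall fun g => ?_)
        change ‖star (χ ((E.proj g)⁻¹ • x))‖ ^ 2 = ‖χ (E.proj g⁻¹ • x)‖ ^ 2
        rw [norm_star, map_inv]
      · refine le_trans (le_of_eq ?_)
          ((integral_norm_convolution_orbit_sq_le ν a hb x (tsupport d)).trans ?_)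
        · refine integral_congr_ae (Eventually.of_forall fun g => ?_)
          change ‖d g ((E.proj g⁻¹)⁻¹ • x)‖ ^ 2 = ‖d g (E.proj g • x)‖ ^ 2
          rw [map_inv, inv_inv]
        · gcongr
          exact h2 x
    have h6 : ‖c.integratedForm ν a w‖ ≤ ε * (Real.sqrt (C * B) * ‖v‖) := by
      refine le_of_sq_le_sq ?_ (by positivity)
      rw [mul_pow, mul_pow, Real.sq_sqrt (by positivity)]
      linarith
    have h7 : ‖T.eval c w - c.integratedForm ν a w‖ ≤ ε * ‖w‖ :=
      ((T.eval c - c.integratedForm ν a).le_opNorm w).trans (by gcongr; exact h1 c)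
    have h8 := norm_le_norm_sub_add (T.eval c w) (c.integratedForm ν a w)
    linarith
  refine norm_le_zero_iff.1 (le_of_forall_pos_le_add fun δ hδ => ?_)
  set K := ‖w‖ + Real.sqrt (C * B) * ‖v‖
  have hK : 0 ≤ K := by positivity
  refine (key (δ / (K + 1)) (by positivity)).trans ?_
  rw [zero_add, div_mul_eq_mul_div, div_le_iff₀ (by positivity)]
  nlinarith

/-- The vanishing of `T b π(χ)` in every covariant pair gives `T b = 0`, since suitable cutoffs
change the integrated form of `b` arbitrarily little. As homogeneous functions approximate `T*`, it
follows that `T T* = 0`. -/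
theorem injective_sectionHom : Function.Injective (sectionHom (X := X) (E := E) ν) := by
  rw [injective_iff_map_eq_zero]
  rintro ⟨T, hT⟩ h
  have h0 : ∀ x, evalFiber ν x T = 0 := fun x => by
    rw [← sectionHom_apply ν ⟨T, hT⟩, h]
    rfl
  have h1 : ∀ b : C_c(Γτ, C₀(X, ℂ)), E.IsHomogeneous 1 b → T * universalForm _ ν b = 0 := by
    refine fun b hb => UniversalAlgebra.ext fun H c => ?_
    change T.eval c * c.integratedForm ν b = 0
    refine norm_le_zero_iff.1 (le_of_forall_pos_le_add fun δ hδ => ?_)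
    obtain ⟨χ, hχ, h'⟩ := exists_norm_integratedForm_sub_mul_le.{u} ν
      (continuous_translationAct_proj (E := E)) b (ε := δ / (‖T‖ + 1)) (by positivity)
    have h2 : T.eval c * c.integratedForm ν b =
        T.eval c * (c.integratedForm ν b - c.integratedForm ν b * c.π χ) := by
      rw [mul_sub]
      have : T.eval c * (c.integratedForm ν b * c.π χ) = 0 := by
        ext1 v
        exact eval_mul_integratedForm_π_eq_zero ν hT h0 hb hχ c v
      rw [this, sub_zero]
    rw [h2, zero_add]
    calc _ ≤ ‖T‖ * (δ / (‖T‖ + 1)) := by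
          refine (norm_mul_le _ _).trans ?_
          gcongr
          · exact T.norm_eval_le c
          · exact h' H.carrier c
      _ ≤ δ := by
          rw [mul_div_assoc', div_le_iff₀ (by positivity)]
          rw [mul_comm, mul_add_one]
          exact le_add_of_nonneg_right hδ.le
  have h2 : T * star T = 0 := by
    have hcl : IsClosed {R : UniversalAlgebra ((translationAct Γ X).comp E.proj) | T * R = 0} :=
      isClosed_eq (continuous_const.mul continuous_id) continuous_const
    refine closure_minimal ?_ hcl (mem_closure_of_mem_homogeneousIdeal ν
      continuous_translationAct_proj (star_mem hT))
    rintro _ ⟨b, hb, rfl⟩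
    exact h1 b hb
  exact Subtype.ext (CStarRing.mul_star_self_eq_zero_iff T |>.1 h2)

end Injectivity



/-! ### Functions representing averages of rank one operators -/

section AveragedRankOne

open MeasureTheory.Measure (modularCharacterFun)

variable {Γ Γτ X : Type*} [Group Γ] [TopologicalSpace Γ] [IsTopologicalGroup Γ] [T2Space Γ]
  [LocallyCompactSpace Γ] [Group Γτ] [TopologicalSpace Γτ]
  [IsTopologicalGroup Γτ] [LocallyCompactSpace Γτ] [T2Space Γτ] [SecondCountableTopology Γτ]
  [MeasurableSpace Γτ] [BorelSpace Γτ] [TopologicalSpace X] [LocallyCompactSpace X] [T2Space X]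
  [MulAction Γ X] [ContinuousSMul Γ X] [ProperSMul Γ X]
  {E : CentralExtension Γ Γτ} (ν : Measure Γτ) [ν.IsHaarMeasure]

theorem continuous_modularCharacterFun_coe :
    Continuous fun g : Γτ => ((modularCharacterFun g : ℝ) : ℂ) :=
  Complex.continuous_ofReal.comp (NNReal.continuous_coe.comp continuous_modularCharacterFun)

theorem modularCharacterFun_coe_ne_zero (g : Γτ) : ((modularCharacterFun g : ℝ) : ℂ) ≠ 0 := by
  exact_mod_cast modularCharacterFun_ne_zero g

/-- The integrand `D(g) D(h)⁻¹ ξ(h) (η(g⁻¹h))* α_h(φ)` of `averagedRankOne`. -/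
def averagedRankOneIntegrand (E : CentralExtension Γ Γτ) (φ : C₀(X, ℂ)) (ξ η : C_c(Γτ, ℂ))
    (g h : Γτ) : C₀(X, ℂ) :=
  (((modularCharacterFun g : ℝ) : ℂ) * ((modularCharacterFun h : ℝ) : ℂ)⁻¹ * ξ h *
    star (η (g⁻¹ * h))) • (translationAct Γ X).comp E.proj h φ

theorem averagedRankOneIntegrand_eq_zero (φ : C₀(X, ℂ)) {ξ : C_c(Γτ, ℂ)} (η : C_c(Γτ, ℂ))
    (g : Γτ) {h : Γτ} (hh : ξ h = 0) : averagedRankOneIntegrand E φ ξ η g h = 0 := by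
  rw [averagedRankOneIntegrand, hh, mul_zero, zero_mul, zero_smul]

theorem continuous_averagedRankOneIntegrand (φ : C₀(X, ℂ)) (ξ η : C_c(Γτ, ℂ)) :
    Continuous fun q : Γτ × Γτ => averagedRankOneIntegrand E φ ξ η q.1 q.2 := by
  have h1 := continuous_modularCharacterFun_coe (Γτ := Γτ)
  have h2 : Continuous fun q : Γτ × Γτ => η (q.1⁻¹ * q.2) :=
    η.continuous.comp (continuous_fst.inv.mul continuous_snd)
  exact ((((h1.comp continuous_fst).mul ((h1.comp continuous_snd).inv₀
    fun _ => modularCharacterFun_coe_ne_zero _)).mul (ξ.continuous.comp continuous_snd)).mul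
      h2.star).smul ((continuous_translationAct_proj φ).comp continuous_snd)

/-- The function `a(g; y) = D(g) ∫ D(h)⁻¹ ξ(h) (η(g⁻¹h))* φ(h⁻¹ y) dh`, `D` being the modular
function. -/
def averagedRankOne (E : CentralExtension Γ Γτ) (φ : C₀(X, ℂ)) (ξ η : C_c(Γτ, ℂ)) :
    C_c(Γτ, C₀(X, ℂ)) where
  toFun g := ∫ h, averagedRankOneIntegrand E φ ξ η g h ∂ν
  continuous_toFun := by
    rw [← continuousOn_univ]
    exact continuousOn_integral_of_compact_support ξ.hasCompactSupport.isCompact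
      (continuous_averagedRankOneIntegrand φ ξ η).continuousOn fun g h _ hh =>
        averagedRankOneIntegrand_eq_zero φ η g (image_eq_zero_of_notMem_tsupport hh)
  hasCompactSupport' := by
    refine HasCompactSupport.intro
      (ξ.hasCompactSupport.isCompact.mul η.hasCompactSupport.isCompact.inv) fun g hg => ?_
    have h0 : ∀ h, averagedRankOneIntegrand E φ ξ η g h = 0 := fun h => by
      by_cases hh : h ∈ tsupport ξ
      · have h1 : g⁻¹ * h ∉ tsupport η := fun h1 =>
          hg ⟨h, hh, (g⁻¹ * h)⁻¹, Set.inv_mem_inv.2 h1, by group⟩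
        rw [averagedRankOneIntegrand, image_eq_zero_of_notMem_tsupport h1, star_zero, mul_zero,
          zero_smul]
      · exact averagedRankOneIntegrand_eq_zero φ η g (image_eq_zero_of_notMem_tsupport hh)
    simp only [h0, integral_zero]

theorem averagedRankOne_apply_apply (φ : C₀(X, ℂ)) (ξ η : C_c(Γτ, ℂ)) (g : Γτ) (y : X) :
    averagedRankOne ν E φ ξ η g y = ∫ h, ((modularCharacterFun g : ℝ) : ℂ) *
      ((modularCharacterFun h : ℝ) : ℂ)⁻¹ * ξ h * star (η (g⁻¹ * h)) * φ ((E.proj h)⁻¹ • y) ∂ν := by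
  have h0 := (continuous_averagedRankOneIntegrand (E := E) φ ξ η).comp (Continuous.prodMk_right g)
  have h1 : Continuous fun h => averagedRankOneIntegrand E φ ξ η g h := h0
  have h2 : HasCompactSupport fun h => averagedRankOneIntegrand E φ ξ η g h :=
    ξ.hasCompactSupport.mono fun h hh h0 => hh (averagedRankOneIntegrand_eq_zero φ η g h0)
  exact ZeroAtInftyContinuousMap.integral_apply (h1.integrable_of_hasCompactSupport h2) y

/-- The weight comes from `η` alone: its argument contains `g⁻¹` and its value is conjugated, so the
two conjugations of the weight cancel. -/
theorem CentralExtension.IsHomogeneous.averagedRankOne (φ : C₀(X, ℂ)) (ξ : C_c(Γτ, ℂ))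
    {η : C_c(Γτ, ℂ)} (hη : E.IsHomogeneous 1 η) :
    E.IsHomogeneous 1 (averagedRankOne ν E φ ξ η) := by
  intro z g
  change ∫ h, averagedRankOneIntegrand E φ ξ η _ h ∂ν =
    ((z : ℂ) ^ (1 : ℤ)) • ∫ h, averagedRankOneIntegrand E φ ξ η g h ∂ν
  rw [← integral_smul]
  refine integral_congr_ae (Eventually.of_forall fun h => ?_)
  have h1 : ((E.incl z)⁻¹ * g)⁻¹ * h = E.incl z * (g⁻¹ * h) := by
    rw [mul_inv_rev, inv_inv, ← E.central, mul_assoc]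
  simp only [averagedRankOneIntegrand, h1, CentralExtension.modularCharacterFun_incl,
    hη.apply_mul, smul_smul, zpow_one, smul_eq_mul, star_mul', star_star]
  congr 1
  ring

theorem continuous_integral_star_mul_comp (η f : C_c(Γτ, ℂ)) {m : Γτ → Γτ} (hm : Continuous m) :
    Continuous fun h => ∫ k, star (η k) * f (k * m h) ∂ν := by
  rw [← continuousOn_univ]
  refine continuousOn_integral_of_compact_support η.hasCompactSupport.isCompact
    (Continuous.continuousOn ?_) fun h k _ hk => ?_
  · exact (η.continuous.comp continuous_snd).star.mul
      (f.continuous.comp (continuous_snd.mul (hm.comp continuous_fst)))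
  · rw [image_eq_zero_of_notMem_tsupport hk, star_zero, zero_mul]

/-- After exchanging the integrals, `h ↦ k h` turns the evaluation point into `h⁻¹ x`. Inverting `g`
and translating it on the right decouples the inner integral from `k`. The modular factors in
`averagedRankOneIntegrand` are those that cancel here. -/
theorem integral_averagedRankOne_mul (φ : C₀(X, ℂ)) (ξ η f : C_c(Γτ, ℂ)) (x : X) (k : Γτ) :
    ∫ g, averagedRankOne ν E φ ξ η g (E.proj k • x) * f (g⁻¹ * k) ∂ν =
      ∫ h, φ ((E.proj h)⁻¹ • x) * (∫ m, star (η m) * f (m * h⁻¹) ∂ν) * ξ (k * h) ∂ν := by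
  have hp := E.isOpenQuotientMap_proj.continuous
  let D : Γτ → ℂ := fun g => ((modularCharacterFun g : ℝ) : ℂ)
  have hD : Continuous D := continuous_modularCharacterFun_coe
  have hD0 : ∀ g, D g ≠ 0 := modularCharacterFun_coe_ne_zero
  let K : Γτ → Γτ → ℂ := fun g h =>
    D g * (D h)⁻¹ * ξ h * star (η (g⁻¹ * h)) * φ ((E.proj h)⁻¹ • E.proj k • x) * f (g⁻¹ * k)
  have hK : Continuous (Function.uncurry K) := by
    have h1 : Continuous fun q : Γτ × Γτ => η (q.1⁻¹ * q.2) :=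
      η.continuous.comp (continuous_fst.inv.mul continuous_snd)
    have h2 : Continuous fun q : Γτ × Γτ => φ ((E.proj q.2)⁻¹ • E.proj k • x) :=
      φ.continuous.comp ((hp.comp continuous_snd).inv.smul continuous_const)
    have h3 : Continuous fun q : Γτ × Γτ => f (q.1⁻¹ * k) :=
      f.continuous.comp (continuous_fst.inv.mul continuous_const)
    exact ((((((hD.comp continuous_fst).mul ((hD.comp continuous_snd).inv₀ fun _ => hD0 _)).mul
      (ξ.continuous.comp continuous_snd)).mul h1.star).mul h2).mul h3)
  have hKc : HasCompactSupport (Function.uncurry K) := by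
    refine HasCompactSupport.intro ((ξ.hasCompactSupport.isCompact.mul
      η.hasCompactSupport.isCompact.inv).prod ξ.hasCompactSupport.isCompact) fun q hq => ?_
    by_cases hh : q.2 ∈ tsupport ξ
    · have h1 : q.1⁻¹ * q.2 ∉ tsupport η := fun h1 =>
        hq ⟨⟨q.2, hh, (q.1⁻¹ * q.2)⁻¹, Set.inv_mem_inv.2 h1, by group⟩, hh⟩
      simp [Function.uncurry, K, image_eq_zero_of_notMem_tsupport h1]
    · simp [Function.uncurry, K, image_eq_zero_of_notMem_tsupport hh]
  have h1 : ∀ g, averagedRankOne ν E φ ξ η g (E.proj k • x) * f (g⁻¹ * k) = ∫ h, K g h ∂ν :=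
    fun g => by rw [averagedRankOne_apply_apply, ← integral_mul_const]
  simp only [h1]
  rw [integral_integral_swap_of_hasCompactSupport hK hKc, ← integral_mul_left_eq_self _ k]
  refine integral_congr_ae (Eventually.of_forall fun h => ?_)
  have h2 : ∫ g, K g (k * h) ∂ν = (D (k * h))⁻¹ * ξ (k * h) *
      φ ((E.proj (k * h))⁻¹ • E.proj k • x) * ∫ g, star (η (g * (k * h))) * f (g * k) ∂ν := by
    rw [← integral_modularCharacterFun_smul_inv ν fun g => star (η (g * (k * h))) * f (g * k),
      ← integral_const_mul]
    refine integral_congr_ae (Eventually.of_forall fun g => ?_)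
    simp only [K, D, Complex.real_smul]
    ring
  have h3 : ∫ g, star (η (g * (k * h))) * f (g * k) ∂ν =
      D k * (D h * ∫ m, star (η m) * f (m * h⁻¹) ∂ν) := by
    have e1 := integral_mul_right_eq ν (fun g => star (η (g * h)) * f g) k
    have e2 := integral_mul_right_eq ν (fun g => star (η g) * f (g * h⁻¹)) h
    simp only [mul_inv_cancel_right, Complex.real_smul] at e1 e2
    rw [← e2, ← e1]
    simp only [mul_assoc]
  have h4 : (E.proj (k * h))⁻¹ • E.proj k • x = (E.proj h)⁻¹ • x := by
    rw [map_mul, mul_inv_rev, mul_smul, inv_smul_smul]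
  have h5 : D (k * h) = D k * D h := by
    simp only [D, Measure.modularCharacterFun_map_mul, NNReal.coe_mul, Complex.ofReal_mul]
  have h6 := hD0 k
  have h7 := hD0 h
  simp only [h2, h3, h4, h5]
  field_simp

/-- The sesquilinear form of the averaged rank one operator on continuous functions of compact
support. -/
theorem integral_star_mul_averagedRankOne (φ : C₀(X, ℂ)) (ξ η f f' : C_c(Γτ, ℂ)) (x : X) :
    ∫ k, star (f' k) * ∫ g, averagedRankOne ν E φ ξ η g (E.proj k • x) * f (g⁻¹ * k) ∂ν ∂ν =
      ∫ h, φ ((E.proj h)⁻¹ • x) * (∫ k, star (η k) * f (k * h⁻¹) ∂ν) *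
        ∫ k, star (f' k) * ξ (k * h) ∂ν ∂ν := by
  have hp := E.isOpenQuotientMap_proj.continuous
  simp only [integral_averagedRankOne_mul]
  let K : Γτ → Γτ → ℂ := fun k h => star (f' k) *
    (φ ((E.proj h)⁻¹ • x) * (∫ m, star (η m) * f (m * h⁻¹) ∂ν) * ξ (k * h))
  have hK : Continuous (Function.uncurry K) := by
    have h1 := continuous_integral_star_mul_comp ν η f continuous_inv
    have h2 : Continuous fun q : Γτ × Γτ => φ ((E.proj q.2)⁻¹ • x) :=
      φ.continuous.comp ((hp.comp continuous_snd).inv.smul continuous_const)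
    exact (f'.continuous.comp continuous_fst).star.mul ((h2.mul (h1.comp continuous_snd)).mul
      (ξ.continuous.comp continuous_mul))
  have hKc : HasCompactSupport (Function.uncurry K) := by
    refine HasCompactSupport.intro (f'.hasCompactSupport.isCompact.prod
      (f'.hasCompactSupport.isCompact.inv.mul ξ.hasCompactSupport.isCompact)) fun q hq => ?_
    by_cases hh : q.1 ∈ tsupport f'
    · have h1 : q.1 * q.2 ∉ tsupport ξ := fun h1 =>
        hq ⟨hh, q.1⁻¹, Set.inv_mem_inv.2 hh, q.1 * q.2, h1, by group⟩
      simp [Function.uncurry, K, image_eq_zero_of_notMem_tsupport h1]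
    · simp [Function.uncurry, K, image_eq_zero_of_notMem_tsupport hh]
  have h1 : ∀ k, star (f' k) * ∫ h, φ ((E.proj h)⁻¹ • x) *
      (∫ m, star (η m) * f (m * h⁻¹) ∂ν) * ξ (k * h) ∂ν = ∫ h, K k h ∂ν := fun k => by
    rw [← integral_const_mul]
  have h2 : ∀ h, ∫ k, K k h ∂ν = φ ((E.proj h)⁻¹ • x) *
      (∫ m, star (η m) * f (m * h⁻¹) ∂ν) * ∫ k, star (f' k) * ξ (k * h) ∂ν := fun h => by
    rw [← integral_const_mul]
    refine integral_congr_ae (Eventually.of_forall fun k => ?_)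
    simp only [K]
    ring
  simp only [h1, ← h2]
  exact integral_integral_swap_of_hasCompactSupport hK hKc

end AveragedRankOne



/-! ### Dense vectors and approximation by finite rank operators -/

section DenseVectors

variable {Γ Γτ : Type*} [Group Γ] [TopologicalSpace Γ] [Group Γτ] [TopologicalSpace Γτ]
  [IsTopologicalGroup Γτ] [LocallyCompactSpace Γτ] [T2Space Γτ] [SecondCountableTopology Γτ]
  [MeasurableSpace Γτ] [BorelSpace Γτ]
  (E : CentralExtension Γ Γτ) (ν : Measure Γτ) [ν.IsHaarMeasure]

theorem Circle.continuous_coe_complex : Continuous fun z : Circle => (z : ℂ) :=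
  continuous_subtype_val

theorem Circle.star_mul_self (z : Circle) : star (z : ℂ) * z = 1 := by
  rw [Complex.star_def, ← Complex.normSq_eq_conj_mul_self]
  simp

/-- The homogeneous part `k ↦ ∫ z⁻¹ f(z⁻¹ k) dz` of a function. -/
def CentralExtension.homogeneousPart [MeasurableSpace Circle] [BorelSpace Circle]
    (m : Measure Circle) [IsProbabilityMeasure m] (f : C_c(Γτ, ℂ)) : C_c(Γτ, ℂ) where
  toFun k := ∫ z : Circle, star (z : ℂ) * f ((E.incl z)⁻¹ * k) ∂m
  continuous_toFun := by
    rw [← continuousOn_univ]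
    refine continuousOn_integral_of_compact_support isCompact_univ (Continuous.continuousOn ?_)
      fun k z _ hz => (hz (Set.mem_univ z)).elim
    exact (Circle.continuous_coe_complex.comp continuous_snd).star.mul
      (f.continuous.comp ((E.continuous_incl.comp continuous_snd).inv.mul continuous_fst))
  hasCompactSupport' := by
    refine HasCompactSupport.intro ((isCompact_range E.continuous_incl).mul
      f.hasCompactSupport.isCompact) fun k hk => ?_
    have h0 : ∀ z : Circle, f ((E.incl z)⁻¹ * k) = 0 := fun z =>
      image_eq_zero_of_notMem_tsupport fun h => hk ⟨_, ⟨z, rfl⟩, _, h, mul_inv_cancel_left _ _⟩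
    simp only [h0, mul_zero, integral_zero]

theorem CentralExtension.isHomogeneous_homogeneousPart [MeasurableSpace Circle]
    [BorelSpace Circle] (m : Measure Circle) [m.IsHaarMeasure] [IsProbabilityMeasure m]
    (f : C_c(Γτ, ℂ)) : E.IsHomogeneous 1 (E.homogeneousPart m f) := by
  intro w k
  change ∫ z : Circle, star (z : ℂ) * f ((E.incl z)⁻¹ * ((E.incl w)⁻¹ * k)) ∂m =
    ((w : ℂ) ^ (1 : ℤ)) • ∫ z : Circle, star (z : ℂ) * f ((E.incl z)⁻¹ * k) ∂m
  rw [← integral_smul]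
  refine Eq.trans (integral_congr_ae (Eventually.of_forall fun z => ?_))
    (integral_mul_left_eq_self (μ := m) _ w)
  have h1 : (E.incl (w * z))⁻¹ * k = (E.incl z)⁻¹ * ((E.incl w)⁻¹ * k) := by
    rw [map_mul, mul_inv_rev, mul_assoc]
  simp only [Circle.coe_mul, star_mul', zpow_one, smul_eq_mul, h1]
  linear_combination (-star (z : ℂ) * f ((E.incl z)⁻¹ * ((E.incl w)⁻¹ * k))) *
    Circle.star_mul_self w

/-- Against a homogeneous `f`, all translates of `g` by `U(1)` with their phases have the same
pairing, so averaging over the circle changes nothing. -/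
theorem integral_mul_star_homogeneousPart [MeasurableSpace Circle]
    [BorelSpace Circle] (m : Measure Circle) [IsProbabilityMeasure m]
    (f : TwistedL2 E ν) (g : C_c(Γτ, ℂ)) :
    ∫ k, f.toLp k * star (E.homogeneousPart m g k) ∂ν = ∫ k, f.toLp k * star (g k) ∂ν := by
  let K : Circle → Γτ → ℂ := fun z k => f.toLp k * (z * star (g ((E.incl z)⁻¹ * k)))
  have hg : Continuous fun q : Circle × Γτ => (q.1 : ℂ) * star (g ((E.incl q.1)⁻¹ * q.2)) :=
    (Circle.continuous_coe_complex.comp continuous_fst).mul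
      (g.continuous.comp ((E.continuous_incl.comp continuous_fst).inv.mul continuous_snd)).star
  set C : Set Γτ := Set.range E.incl * tsupport g
  have hC : IsCompact C := (isCompact_range E.continuous_incl).mul g.hasCompactSupport.isCompact
  have hCm : MeasurableSet C := hC.isClosed.measurableSet
  obtain ⟨M, hM⟩ := g.continuous.bounded_above_of_compact_support g.hasCompactSupport
  have hfC : Integrable (C.indicator fun k => ‖f.toLp k‖ * M) ν := by
    rw [integrable_indicator_iff hCm]
    have : IsFiniteMeasure (ν.restrict C) := ⟨by simpa using hC.measure_lt_top⟩
    exact (((Lp.memLp f.toLp).restrict C).integrable one_le_two).norm.mul_const M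
  have hKi : Integrable (Function.uncurry K) (m.prod ν) := by
    refine (hfC.comp_snd m).mono'
      ((Lp.aestronglyMeasurable f.toLp).comp_snd.mul hg.aestronglyMeasurable)
      (Eventually.of_forall fun q => ?_)
    by_cases hq : q.2 ∈ C
    · rw [Set.indicator_of_mem hq]
      simp only [Function.uncurry, K, norm_mul, norm_star, Circle.norm_coe, one_mul]
      gcongr
      exact hM _
    · have h0 : g ((E.incl q.1)⁻¹ * q.2) = 0 := image_eq_zero_of_notMem_tsupport fun h =>
        hq ⟨_, ⟨q.1, rfl⟩, _, h, mul_inv_cancel_left _ _⟩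
      rw [Set.indicator_of_notMem hq]
      simp [Function.uncurry, K, h0]
  have h1 : ∀ k, f.toLp k * star (E.homogeneousPart m g k) = ∫ z, K z k ∂m := fun k => by
    have : star (E.homogeneousPart m g k) =
        ∫ z : Circle, star (star (z : ℂ) * g ((E.incl z)⁻¹ * k)) ∂m := integral_conj.symm
    rw [this, ← integral_const_mul]
    refine integral_congr_ae (Eventually.of_forall fun z => ?_)
    simp only [K, star_mul', star_star]
  have h2 : ∀ z, ∫ k, K z k ∂ν = ∫ k, f.toLp k * star (g k) ∂ν := fun z => by
    rw [← integral_mul_left_eq_self (fun k => f.toLp k * star (g k)) (E.incl z)⁻¹]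
    refine integral_congr_ae ?_
    filter_upwards [f.homogeneous z] with k hk
    simp only [hk, K]
    ring
  simp only [h1]
  rw [← integral_integral_swap hKi]
  simp only [h2, integral_const, probReal_univ, one_smul]

/-- The vectors of `L²_τ(Γ)` represented by continuous functions of compact support. -/
def TwistedL2.compactlySupported : Submodule ℂ (TwistedL2 E ν) where
  carrier := {f | ∃ ξ : C_c(Γτ, ℂ), E.IsHomogeneous 1 ξ ∧ f.toLp =ᵐ[ν] ξ}
  zero_mem' := ⟨0, fun z g => by simp, Lp.coeFn_zero ℂ 2 ν⟩
  add_mem' := by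
    rintro f f' ⟨ξ, hξ, h⟩ ⟨ξ', hξ', h'⟩
    refine ⟨ξ + ξ', fun z g => ?_, ?_⟩
    · change ξ _ + ξ' _ = _ • (ξ g + ξ' g)
      rw [hξ, hξ', smul_add]
    · filter_upwards [Lp.coeFn_add f.toLp f'.toLp, h, h'] with g h1 h2 h3
      rw [TwistedL2.toLp_add, h1, Pi.add_apply, h2, h3]
      rfl
  smul_mem' := by
    rintro k f ⟨ξ, hξ, h⟩
    refine ⟨k • ξ, fun z g => ?_, ?_⟩
    · change k • ξ _ = _ • (k • ξ g)
      rw [hξ, smul_comm]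
    · filter_upwards [Lp.coeFn_smul k f.toLp, h] with g h1 h2
      rw [TwistedL2.toLp_smul, h1, Pi.smul_apply, h2]
      rfl

variable {E ν} in
theorem TwistedL2.inner_eq_integral {f f' : TwistedL2 E ν} {ξ ξ' : Γτ → ℂ}
    (h : f.toLp =ᵐ[ν] ξ) (h' : f'.toLp =ᵐ[ν] ξ') :
    inner ℂ f f' = ∫ k, star (ξ k) * ξ' k ∂ν := by
  rw [TwistedL2.inner_def, L2.inner_def]
  refine integral_congr_ae ?_
  filter_upwards [h, h'] with k h1 h2
  rw [h1, h2, RCLike.inner_apply', ]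
  rfl

/-- If `f ≠ 0`, some continuous compactly supported `g` is within `‖f‖ / 2` of `f`. Orthogonality to
`g` would give `‖f‖² ≤ ‖f‖² / 2`. -/
theorem TwistedL2.eq_zero_of_forall_integral_eq_zero {f : TwistedL2 E ν}
    (h : ∀ g : C_c(Γτ, ℂ), ∫ k, f.toLp k * star (g k) ∂ν = 0) : f = 0 := by
  by_contra hf
  have hf0 : 0 < ‖f.toLp‖ := by
    rw [TwistedL2.norm_toLp]
    exact norm_pos_iff.2 hf
  obtain ⟨g, hgc, hg, hgcont, hgm⟩ := (Lp.memLp f.toLp).exists_hasCompactSupport_eLpNorm_sub_le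
    ENNReal.ofNat_ne_top (ε := ENNReal.ofReal (‖f.toLp‖ / 2))
    (by simpa using hf0)
  have h1 : inner ℂ hgm.toLp f.toLp = 0 := by
    rw [L2.inner_def, ← h ⟨⟨g, hgcont⟩, hgc⟩]
    refine integral_congr_ae ?_
    filter_upwards [hgm.coeFn_toLp] with k hk
    rw [hk, RCLike.inner_apply]
    rfl
  have h2 : ‖f.toLp - hgm.toLp‖ ≤ ‖f.toLp‖ / 2 := by
    rw [Lp.norm_def]
    refine ENNReal.toReal_le_of_le_ofReal (by positivity) (le_trans (le_of_eq ?_) hg)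
    refine eLpNorm_congr_ae ?_
    filter_upwards [Lp.coeFn_sub f.toLp hgm.toLp, hgm.coeFn_toLp] with k h3 h4
    rw [h3, Pi.sub_apply, h4, Pi.sub_apply]
  have h3 : ‖f.toLp‖ ^ 2 ≤ ‖f.toLp‖ / 2 * ‖f.toLp‖ := by
    have h4 : (inner ℂ (f.toLp - hgm.toLp) f.toLp : ℂ) = ‖f.toLp‖ ^ 2 := by
      rw [inner_sub_left, h1, sub_zero, inner_self_eq_norm_sq_to_K]
      rfl
    have h5 := norm_inner_le_norm (𝕜 := ℂ) (f.toLp - hgm.toLp) f.toLp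
    rw [h4, norm_pow, Complex.norm_real, norm_norm] at h5
    exact h5.trans (by gcongr)
  nlinarith

/-- A vector orthogonal to these is orthogonal to the homogeneous part of every function in
`C_c(Γτ)`, hence to the function itself, hence zero. -/
theorem TwistedL2.dense_compactlySupported :
    Dense (TwistedL2.compactlySupported E ν : Set (TwistedL2 E ν)) := by
  borelize Circle
  let m : Measure Circle := Measure.haarMeasure ⊤
  have : IsProbabilityMeasure m := ⟨by
    have := Measure.haarMeasure_self (K₀ := (⊤ : TopologicalSpace.PositiveCompacts Circle))
    simpa using this⟩
  rw [Submodule.dense_iff_topologicalClosure_eq_top, Submodule.topologicalClosure_eq_top_iff,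
    Submodule.eq_bot_iff]
  intro f hf
  refine TwistedL2.eq_zero_of_forall_integral_eq_zero E ν fun g => ?_
  rw [← integral_mul_star_homogeneousPart E ν m]
  set ξ := E.homogeneousPart m g
  have hξ : E.IsHomogeneous 1 ξ := E.isHomogeneous_homogeneousPart m g
  have hmem : MemLp ξ 2 ν := ξ.continuous.memLp_of_hasCompactSupport ξ.hasCompactSupport
  have hv := TwistedL2.mk_coeFn (E := E) ν ξ hmem fun z k => by rw [hξ, zpow_one, smul_eq_mul]
  have h0 := hf _ ⟨ξ, hξ, hv⟩
  rw [TwistedL2.inner_eq_integral hv (Filter.EventuallyEq.refl _ _)] at h0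
  rw [← h0]
  simp only [mul_comm]

end DenseVectors

section FiniteRank

variable {H : Type*} [NormedAddCommGroup H] [InnerProductSpace ℂ H] [CompleteSpace H]

open InnerProductSpace

/-- Compact operators on a Hilbert space are norm limits of operators of finite rank; the ranks one
operators may be taken from a dense subset. -/
theorem IsCompactOperator.mem_closure_span_rankOne {T : H →L[ℂ] H} (hT : IsCompactOperator T)
    {V : Set H} (hV : Dense V) :
    T ∈ closure (Submodule.span ℂ {A : H →L[ℂ] H | ∃ ξ ∈ V, ∃ η ∈ V, A = rankOne ℂ ξ η} :
      Set (H →L[ℂ] H)) := by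
  set R := (Submodule.span ℂ {A : H →L[ℂ] H | ∃ ξ ∈ V, ∃ η ∈ V, A = rankOne ℂ ξ η})
  -- The rank one operator is continuous in each vector separately, so `V` may be replaced by `H` in
  -- one variable and then in the other.
  have h0 : ∀ η ∈ V, ∀ ξ : H, rankOne ℂ ξ η ∈ R.topologicalClosure := fun η hη ξ => by
    have hc : Continuous fun ξ : H => (rankOne ℂ ξ η : H →L[ℂ] H) := by
      simp only [← adjoint_rankOne (𝕜 := ℂ) η]
      exact ContinuousLinearMap.adjoint.continuous.comp
        (rankOne ℂ η : H →L⋆[ℂ] H →L[ℂ] H).continuous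
    have hcl : closure V ⊆ {ξ : H | (rankOne ℂ ξ η : H →L[ℂ] H) ∈ R.topologicalClosure} :=
      closure_minimal (fun ξ hξ => R.le_topologicalClosure
        (Submodule.subset_span ⟨ξ, hξ, η, hη, rfl⟩)) (R.isClosed_topologicalClosure.preimage hc)
    exact hcl (hV ξ)
  have h1 : ∀ ξ η : H, rankOne ℂ ξ η ∈ R.topologicalClosure := fun ξ η =>
    have hcl : closure V ⊆ {η : H | (rankOne ℂ ξ η : H →L[ℂ] H) ∈ R.topologicalClosure} :=
      closure_minimal (fun η hη => h0 η hη ξ) (R.isClosed_topologicalClosure.preimage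
        (rankOne ℂ ξ : H →L⋆[ℂ] H →L[ℂ] H).continuous)
    hcl (hV η)
  change T ∈ closure (R : Set (H →L[ℂ] H))
  rw [← Submodule.topologicalClosure_coe, ← R.isClosed_topologicalClosure.closure_eq]
  refine Metric.mem_closure_iff.2 fun ε hε => ?_
  have h2 : TotallyBounded (T '' Metric.closedBall 0 1) :=
    (IsCompactOperator.isCompact_closure_image_closedBall
      (f := T.toLinearMap) hT 1).totallyBounded.subset subset_closure
  obtain ⟨t, htf, ht⟩ := Metric.totallyBounded_iff.1 h2 (ε / 2) (half_pos hε)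
  have : FiniteDimensional ℂ (Submodule.span ℂ t) := FiniteDimensional.span_of_finite ℂ htf
  set U := Submodule.span ℂ t
  let b := stdOrthonormalBasis ℂ U
  -- `U` is spanned by an `ε / 2`-net of the image of the unit ball; the projection realizes the
  -- distance to `U`, hence moves `T v` by at most `ε / 2`.
  refine ⟨U.starProjection ∘L T, ?_, ?_⟩
  · have h3 : U.starProjection ∘L T =
        ∑ i, rankOne ℂ (b i : H) (ContinuousLinearMap.adjoint T (b i : H)) := by
      ext1 v
      rw [b.starProjection_eq_sum_rankOne]
      simp [ContinuousLinearMap.adjoint_inner_left]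
    rw [h3]
    exact Submodule.sum_mem _ fun i _ => h1 _ _
  · rw [dist_eq_norm]
    refine lt_of_le_of_lt (ContinuousLinearMap.opNorm_le_of_unit_norm (C := ε / 2) (half_pos hε).le
      fun v hv => ?_) (half_lt_self hε)
    obtain ⟨y, hy, hvy⟩ := Set.mem_iUnion₂.1 (ht ⟨v, by simp [hv], rfl⟩)
    rw [Metric.mem_ball, dist_eq_norm] at hvy
    change ‖T v - U.starProjection (T v)‖ ≤ ε / 2
    rw [Submodule.starProjection_minimal]
    exact (ciInf_le ⟨0, by rintro _ ⟨w, rfl⟩; exact norm_nonneg _⟩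
      (⟨y, Submodule.subset_span hy⟩ : U)).trans hvy.le

end FiniteRank



/-! ### Weak averages over the group -/

section Averages

open InnerProductSpace

variable {S : Type v} {Γ Γτ X : Type u} [Group S] [TopologicalSpace S]
  [Group Γ] [TopologicalSpace Γ] [IsTopologicalGroup Γ] [T2Space Γ] [LocallyCompactSpace Γ]
  [Group Γτ] [TopologicalSpace Γτ]
  [IsTopologicalGroup Γτ] [LocallyCompactSpace Γτ] [T2Space Γτ] [SecondCountableTopology Γτ]
  [MeasurableSpace Γτ] [BorelSpace Γτ] [TopologicalSpace X] [LocallyCompactSpace X] [T2Space X]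
  [MulAction Γ X] [ContinuousSMul Γ X] [ProperSMul Γ X]
  [MulDistribMulAction S Γ] [MulDistribMulAction S Γτ] [ContinuousSMul S Γτ]
  {E : CentralExtension Γ Γτ} (hE : E.IsLift S) (ν : Measure Γτ) [ν.IsHaarMeasure]

theorem rho_symm_coeFn (g : Γτ) (f : TwistedL2 E ν) :
    ⇑((rho hE ν (1 : S) g).symm f).toLp =ᵐ[ν] fun k => f.toLp (k * g⁻¹) := by
  have h := rhoLinear_coeFn hE ν (1 : S)⁻¹ ((1 : S) • g⁻¹) f
  refine EventuallyEq.trans (f := ⇑((rho hE ν (1 : S) g).symm f).toLp) h ?_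
  simp only [inv_one, one_smul]
  rfl

/-- The operators `ρ(s, g)` are unitary only up to a scalar, but conjugation by them is a
`*`-homomorphism of a `C*`-algebra and therefore contractive. -/
theorem norm_adRho_le (s : S) (g : Γτ) (T : TwistedL2 E ν →L[ℂ] TwistedL2 E ν) :
    ‖adRho hE ν s g T‖ ≤ ‖T‖ := by
  let Ψ : (TwistedL2 E ν →L[ℂ] TwistedL2 E ν) →⋆ₙₐ[ℂ] (TwistedL2 E ν →L[ℂ] TwistedL2 E ν) :=
    { toFun := adRho hE ν s g
      map_smul' := fun k T => adRho_smul hE ν s g k T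
      map_zero' := by ext1 f; simp [adRho_apply]
      map_add' := adRho_add hE ν s g
      map_mul' := adRho_mul hE ν s g
      map_star' := adRho_star hE ν s g }
  exact NonUnitalStarAlgHom.norm_apply_le Ψ T

/-- The function `a` represents the average `∫ Ad ρ(h) Ψ(h⁻¹ x) dh` of the operator valued function
`Ψ`, in the weak sense. -/
def IsAverage (a : C_c(Γτ, C₀(X, ℂ))) (Ψ : X → TwistedL2 E ν →L[ℂ] TwistedL2 E ν) : Prop :=
  ∀ x, ∀ f ∈ TwistedL2.compactlySupported E ν, ∀ f' ∈ TwistedL2.compactlySupported E ν,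
    Integrable (fun h => (inner ℂ f' (adRho hE ν (1 : S) h (Ψ ((E.proj h)⁻¹ • x)) f) : ℂ)) ν ∧
    inner ℂ f' ((fiberPair E ν x).integratedForm ν a f) =
      ∫ h, inner ℂ f' (adRho hE ν (1 : S) h (Ψ ((E.proj h)⁻¹ • x)) f) ∂ν

/-- Both sides equal `∫ φ(h⁻¹ x) ⟨η, ρ(h)⁻¹ f⟩ ⟨f', ρ(h) ξ⟩ dh`. Integrability needs no support
condition on `φ`: the second coefficient has compact support in `h`, as `f'` and `ξ` are compactly
supported. -/
theorem isAverage_averagedRankOne (φ : C₀(X, ℂ)) {ξ η : TwistedL2 E ν} {ξc ηc : C_c(Γτ, ℂ)}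
    (hξ : ξ.toLp =ᵐ[ν] ξc) (hη : η.toLp =ᵐ[ν] ηc) :
    IsAverage hE ν (averagedRankOne ν E φ ξc ηc) fun x => φ x • rankOne ℂ ξ η := by
  rintro x f ⟨fc, -, hf⟩ f' ⟨fc', -, hf'⟩
  have h1 : ∀ h : Γτ, (inner ℂ f' (adRho hE ν (1 : S) h
      (φ ((E.proj h)⁻¹ • x) • rankOne ℂ ξ η) f) : ℂ) =
      φ ((E.proj h)⁻¹ • x) * (∫ k, star (ηc k) * fc (k * h⁻¹) ∂ν) *
        ∫ k, star (fc' k) * ξc (k * h) ∂ν := fun h => by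
    have e1 : (inner ℂ η ((rho hE ν (1 : S) h).symm f) : ℂ) =
        ∫ k, star (ηc k) * fc (k * h⁻¹) ∂ν := by
      refine TwistedL2.inner_eq_integral hη ?_
      filter_upwards [rho_symm_coeFn hE ν h f,
        (quasiMeasurePreserving_mul_right ν h⁻¹).ae hf] with k h1 h2
      rw [h1, h2]
    have e2 : (inner ℂ f' (rho hE ν (1 : S) h ξ) : ℂ) = ∫ k, star (fc' k) * ξc (k * h) ∂ν := by
      refine TwistedL2.inner_eq_integral hf' ?_
      filter_upwards [rho_coeFn hE ν (1 : S) h ξ,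
        (quasiMeasurePreserving_mul_right ν h).ae hξ] with k h1 h2
      rw [h1, inv_one, one_smul, h2]
    rw [← e1, ← e2, adRho_smul, smul_apply, inner_smul_right, adRho_apply,
      rankOne_apply, map_smul (rho hE ν (1 : S) h), inner_smul_right, mul_assoc]
  simp only [h1]
  have hp := E.isOpenQuotientMap_proj.continuous
  refine ⟨?_, ?_⟩
  · refine Continuous.integrable_of_hasCompactSupport ?_ ?_
    · have c1 : Continuous fun h : Γτ => φ ((E.proj h)⁻¹ • x) :=
        φ.continuous.comp (hp.inv.smul continuous_const)
      exact (c1.mul (continuous_integral_star_mul_comp ν ηc fc continuous_inv)).mul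
        (continuous_integral_star_mul_comp ν fc' ξc continuous_id)
    · refine HasCompactSupport.intro (fc'.hasCompactSupport.isCompact.inv.mul
        ξc.hasCompactSupport.isCompact) fun h hh => ?_
      have h2 : ∀ k, star (fc' k) * ξc (k * h) = 0 := fun k => by
        by_cases hk : k ∈ tsupport fc'
        · rw [image_eq_zero_of_notMem_tsupport (f := ξc) (x := k * h) fun h2 =>
            hh ⟨k⁻¹, Set.inv_mem_inv.2 hk, k * h, h2, inv_mul_cancel_left _ _⟩, mul_zero]
        · rw [image_eq_zero_of_notMem_tsupport hk, star_zero, zero_mul]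
      simp only [h2, integral_zero, mul_zero]
  · rw [← integral_star_mul_averagedRankOne]
    refine TwistedL2.inner_eq_integral hf' ?_
    filter_upwards [integratedForm_fiberPair_coeFn E ν x (averagedRankOne ν E φ ξc ηc) f]
      with k hk
    rw [hk]
    have hq : Measure.QuasiMeasurePreserving (fun h : Γτ => h⁻¹ * k) ν ν :=
      (quasiMeasurePreserving_mul_right ν k).comp (quasiMeasurePreserving_inv ν)
    refine integral_congr_ae ?_
    filter_upwards [hq.ae hf] with h hh
    rw [hh]

theorem IsAverage.add {a a' : C_c(Γτ, C₀(X, ℂ))}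
    {Ψ Ψ' : X → TwistedL2 E ν →L[ℂ] TwistedL2 E ν} (h : IsAverage hE ν a Ψ)
    (h' : IsAverage hE ν a' Ψ') : IsAverage hE ν (a + a') fun x => Ψ x + Ψ' x := by
  intro x f hf f' hf'
  obtain ⟨h1, h2⟩ := h x f hf f' hf'
  obtain ⟨h3, h4⟩ := h' x f hf f' hf'
  have e : ∀ g : Γτ, (inner ℂ f' (adRho hE ν (1 : S) g
      (Ψ ((E.proj g)⁻¹ • x) + Ψ' ((E.proj g)⁻¹ • x)) f) : ℂ) =
      inner ℂ f' (adRho hE ν (1 : S) g (Ψ ((E.proj g)⁻¹ • x)) f) +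
        inner ℂ f' (adRho hE ν (1 : S) g (Ψ' ((E.proj g)⁻¹ • x)) f) := fun g => by
    rw [adRho_add, add_apply, inner_add_right]
  have e' : (fiberPair E ν x).integratedForm ν (a + a') =
      (fiberPair E ν x).integratedForm ν a + (fiberPair E ν x).integratedForm ν a' :=
    congrArg (fun T : UniversalAlgebra ((translationAct Γ X).comp E.proj) =>
      T.eval (H := ⟨TwistedL2 E ν⟩) (fiberPair E ν x)) (universalForm_add ν a a')
  simp only [e, e']
  refine ⟨h1.add h3, ?_⟩
  rw [integral_add h1 h3, add_apply, inner_add_right, h2, h4]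

/-- Every function with values in the span of rank one operators has an average. -/
theorem exists_isAverage_smul_const (φ : C₀(X, ℂ)) {T : TwistedL2 E ν →L[ℂ] TwistedL2 E ν}
    (hT : T ∈ Submodule.span ℂ {A : TwistedL2 E ν →L[ℂ] TwistedL2 E ν |
      ∃ ξ ∈ (TwistedL2.compactlySupported E ν : Set (TwistedL2 E ν)),
        ∃ η ∈ (TwistedL2.compactlySupported E ν : Set (TwistedL2 E ν)), A = rankOne ℂ ξ η}) :
    ∃ a : C_c(Γτ, C₀(X, ℂ)), E.IsHomogeneous 1 a ∧ IsAverage hE ν a fun x => φ x • T := by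
  induction hT using Submodule.span_induction generalizing φ with
  | mem A hA =>
    obtain ⟨ξ, ⟨ξc, -, hξ⟩, η, ⟨ηc, hηh, hη⟩, rfl⟩ := hA
    exact ⟨_, hηh.averagedRankOne ν φ ξc, isAverage_averagedRankOne hE ν φ hξ hη⟩
  | zero =>
    refine ⟨averagedRankOne ν E φ 0 0, CentralExtension.IsHomogeneous.averagedRankOne ν φ 0
      fun z g => by simp, ?_⟩
    have h := isAverage_averagedRankOne hE ν φ (ξ := 0) (η := 0) (ξc := 0) (ηc := 0)
      (Lp.coeFn_zero ℂ 2 ν) (Lp.coeFn_zero ℂ 2 ν)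
    simpa using h
  | add T T' _ _ h h' =>
    obtain ⟨a, ha, ha'⟩ := h φ
    obtain ⟨b, hb, hb'⟩ := h' φ
    refine ⟨a + b, fun z g => ?_, ?_⟩
    · change a _ + b _ = _ • (a g + b g)
      rw [ha, hb, smul_add]
    · simpa only [smul_add] using ha'.add hE ν hb'
  | smul k T _ h =>
    -- The scalar is absorbed in `φ`, which is why the induction is over all `φ` at once.
    obtain ⟨a, ha, ha'⟩ := h (k • φ)
    refine ⟨a, ha, ?_⟩
    have e : ∀ x, (k • φ) x • T = φ x • k • T := fun x => by
      rw [smul_smul, mul_comm]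
      rfl
    simpa only [e] using ha'

theorem exists_isAverage_sum {n : ℕ} (φ : Fin n → C₀(X, ℂ))
    (T : Fin n → TwistedL2 E ν →L[ℂ] TwistedL2 E ν)
    (hT : ∀ i, T i ∈ Submodule.span ℂ {A : TwistedL2 E ν →L[ℂ] TwistedL2 E ν |
      ∃ ξ ∈ (TwistedL2.compactlySupported E ν : Set (TwistedL2 E ν)),
        ∃ η ∈ (TwistedL2.compactlySupported E ν : Set (TwistedL2 E ν)), A = rankOne ℂ ξ η}) :
    ∃ a : C_c(Γτ, C₀(X, ℂ)), E.IsHomogeneous 1 a ∧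
      IsAverage hE ν a fun x => ∑ i, φ i x • T i := by
  classical
  suffices h : ∀ s : Finset (Fin n), ∃ a : C_c(Γτ, C₀(X, ℂ)), E.IsHomogeneous 1 a ∧
      IsAverage hE ν a fun x => ∑ i ∈ s, φ i x • T i from h _
  intro s
  induction s using Finset.induction_on with
  | empty =>
    obtain ⟨a, ha, ha'⟩ := exists_isAverage_smul_const hE ν (0 : C₀(X, ℂ)) (T := 0)
      (Submodule.zero_mem _)
    exact ⟨a, ha, by simpa using ha'⟩
  | insert i s hi h =>
    obtain ⟨a, ha, ha'⟩ := exists_isAverage_smul_const hE ν (φ i) (hT i)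
    obtain ⟨b, hb, hb'⟩ := h
    refine ⟨a + b, fun z g => ?_, ?_⟩
    · change a _ + b _ = _ • (a g + b g)
      rw [ha, hb, smul_add]
    · simpa only [Finset.sum_insert hi] using ha'.add hE ν hb'

end Averages



/-- Averages are known only through matrix coefficients on dense vectors; joint continuity of the
inequality extends the bound to all vectors, and `f' = A f` gives the norm. -/
theorem ContinuousLinearMap.opNorm_le_of_dense_inner {H : Type*} [NormedAddCommGroup H]
    [InnerProductSpace ℂ H] {A : H →L[ℂ] H} {V : Set H} (hV : Dense V) {C : ℝ} (hC : 0 ≤ C)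
    (h : ∀ f ∈ V, ∀ f' ∈ V, ‖(inner ℂ f' (A f) : ℂ)‖ ≤ C * ‖f‖ * ‖f'‖) : ‖A‖ ≤ C := by
  have h1 : ∀ p : H × H, ‖(inner ℂ p.2 (A p.1) : ℂ)‖ ≤ C * ‖p.1‖ * ‖p.2‖ := fun p => by
    have hcl : IsClosed {p : H × H | ‖(inner ℂ p.2 (A p.1) : ℂ)‖ ≤ C * ‖p.1‖ * ‖p.2‖} :=
      isClosed_le (by fun_prop) (by fun_prop)
    have hsub : closure (V ×ˢ V) ⊆ {p : H × H | ‖(inner ℂ p.2 (A p.1) : ℂ)‖ ≤ C * ‖p.1‖ * ‖p.2‖} :=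
      closure_minimal (fun q hq => h q.1 hq.1 q.2 hq.2) hcl
    exact hsub ((hV.prod hV) p)
  refine ContinuousLinearMap.opNorm_le_bound _ hC fun f => ?_
  have h2 := h1 (f, A f)
  rw [inner_self_eq_norm_sq_to_K, norm_pow] at h2
  simp only [Complex.coe_algebraMap, Complex.norm_real, norm_norm] at h2
  rcases (norm_nonneg (A f)).eq_or_lt with h0 | h0
  · rw [← h0]
    positivity
  · nlinarith

/-! ### Orbit integrals and density of the range -/

section OrbitAverage

variable {Γ Γτ X : Type*} [Group Γ] [TopologicalSpace Γ] [IsTopologicalGroup Γ] [T2Space Γ]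
  [Group Γτ] [TopologicalSpace Γτ]
  [IsTopologicalGroup Γτ] [LocallyCompactSpace Γτ] [T2Space Γτ] [SecondCountableTopology Γτ]
  [MeasurableSpace Γτ] [BorelSpace Γτ] [TopologicalSpace X] [LocallyCompactSpace X] [T2Space X]
  [MulAction Γ X] [ContinuousSMul Γ X] [ProperSMul Γ X]
  (E : CentralExtension Γ Γτ) (ν : Measure Γτ) [ν.IsHaarMeasure]

theorem isCompact_setOf_inv_smul_mem {N C : Set X} (hN : IsCompact N) (hC : IsCompact C) :
    IsCompact {h : Γτ | ∃ x ∈ N, (E.proj h)⁻¹ • x ∈ C} := by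
  convert (E.isCompact_setOf_smul_inter hN hC).inv using 1
  ext h
  simp only [Set.mem_inv, Set.mem_ofPred_eq, map_inv]

theorem continuous_orbitMap (x : X) : Continuous fun h : Γτ => (E.proj h)⁻¹ • x :=
  E.isOpenQuotientMap_proj.continuous.inv.smul continuous_const

theorem hasCompactSupport_comp_orbitMap {χ : X → ℝ} (hχ : HasCompactSupport χ) (x : X) :
    HasCompactSupport fun h : Γτ => χ ((E.proj h)⁻¹ • x) := by
  refine HasCompactSupport.of_support_subset_isCompact
    (isCompact_setOf_inv_smul_mem E (isCompact_singleton (x := x)) hχ) fun h hh => ?_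
  exact ⟨x, rfl, subset_tsupport _ hh⟩

/-- By properness the integrands for `x` in a compact neighbourhood are supported in one compact
subset of `Γτ`. -/
theorem continuous_integral_orbitMap {χ : X → ℝ} (hχ : Continuous χ) (hχc : HasCompactSupport χ) :
    Continuous fun x => ∫ h, χ ((E.proj h)⁻¹ • x) ∂ν := by
  refine continuous_iff_continuousAt.2 fun x => ?_
  obtain ⟨N, hN, hxN⟩ := exists_compact_mem_nhds x
  refine ContinuousOn.continuousAt (s := N) ?_ hxN
  refine continuousOn_integral_of_compact_support (isCompact_setOf_inv_smul_mem E hN hχc)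
    (Continuous.continuousOn ?_) fun y h hy hh => ?_
  · exact hχ.comp ((E.isOpenQuotientMap_proj.continuous.comp continuous_snd).inv.smul
      continuous_fst)
  · exact image_eq_zero_of_notMem_tsupport fun h' => hh ⟨y, hy, h'⟩

theorem integral_orbitMap_smul (χ : X → ℝ) (γ : Γ) (x : X) :
    ∫ h, χ ((E.proj h)⁻¹ • γ • x) ∂ν = ∫ h, χ ((E.proj h)⁻¹ • x) ∂ν := by
  obtain ⟨g, rfl⟩ := E.isOpenQuotientMap_proj.surjective γ
  rw [← integral_mul_left_eq_self _ g]
  simp only [map_mul, mul_inv_rev, mul_smul, inv_smul_smul]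

/-- There is a function of compact support whose integrals along the orbits are at most one, and
equal to one for the orbits meeting a given compact set. -/
theorem exists_integral_orbitMap_eq_one {K : Set X} (hK : IsCompact K) :
    ∃ χ : X → ℝ, Continuous χ ∧ HasCompactSupport χ ∧ (∀ x, 0 ≤ χ x) ∧
      (∀ x, ∫ h, χ ((E.proj h)⁻¹ • x) ∂ν ≤ 1) ∧
      ∀ (γ : Γ) (x : X), γ • x ∈ K → ∫ h, χ ((E.proj h)⁻¹ • x) ∂ν = 1 := by
  obtain ⟨φ, hφ1, -, hφc, hφ01⟩ := exists_continuous_one_zero_of_isCompact hK isClosed_empty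
    (Set.disjoint_empty K)
  have hφ0 : ∀ x, 0 ≤ φ x := fun x => (hφ01 x).1
  set A : X → ℝ := fun x => ∫ h, φ ((E.proj h)⁻¹ • x) ∂ν
  have hA : Continuous A := continuous_integral_orbitMap E ν φ.continuous hφc
  have hA0 : ∀ x, 0 ≤ A x := fun x => integral_nonneg fun _ => hφ0 _
  have hAK : ∀ x ∈ K, 0 < A x := fun x hx => by
    refine Continuous.integral_pos_of_hasCompactSupport_nonneg_nonzero (x := 1)
      (φ.continuous.comp (continuous_orbitMap E x)) (hasCompactSupport_comp_orbitMap E hφc x)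
      (fun _ => hφ0 _) ?_
    simp [hφ1 hx]
  -- Dividing by `max A δ` instead of `A` keeps the quotient continuous where `A` vanishes, and
  -- costs nothing on orbits through `K`, where `A ≥ δ`.
  obtain ⟨δ, hδ, hδK⟩ : ∃ δ, 0 < δ ∧ ∀ x ∈ K, δ ≤ A x := by
    rcases K.eq_empty_or_nonempty with rfl | hne
    · exact ⟨1, one_pos, by simp⟩
    · obtain ⟨y, hy, hmin⟩ := hK.exists_isMinOn hne hA.continuousOn
      exact ⟨A y, hAK y hy, fun x hx => hmin hx⟩
  have hm : ∀ x, 0 < max (A x) δ := fun x => hδ.trans_le (le_max_right _ _)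
  have hint : ∀ x, ∫ h, φ ((E.proj h)⁻¹ • x) / max (A ((E.proj h)⁻¹ • x)) δ ∂ν =
      A x / max (A x) δ := fun x => by
    have h1 : ∀ h : Γτ, A ((E.proj h)⁻¹ • x) = A x := fun h => integral_orbitMap_smul E ν φ _ x
    simp only [h1, integral_div]
    rfl
  refine ⟨fun x => φ x / max (A x) δ, φ.continuous.div (hA.max continuous_const)
    fun x => (hm x).ne', ?_, fun x => div_nonneg (hφ0 x) (hm x).le, fun x => ?_, fun γ x hx => ?_⟩
  · exact hφc.mono fun x hx h0 => hx (by simp [h0])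
  · rw [hint, div_le_one (hm x)]
    exact le_max_left _ _
  · have h1 : A (γ • x) = A x := integral_orbitMap_smul E ν φ γ x
    have h2 := hδK _ hx
    rw [h1] at h2
    rw [hint, max_eq_left h2, div_self (hδ.trans_le h2).ne']

end OrbitAverage

section DenseRange

open InnerProductSpace

variable {S : Type v} {Γ Γτ X : Type u} [Group S] [TopologicalSpace S]
  [Group Γ] [TopologicalSpace Γ] [IsTopologicalGroup Γ] [T2Space Γ] [LocallyCompactSpace Γ]
  [Group Γτ] [TopologicalSpace Γτ]
  [IsTopologicalGroup Γτ] [LocallyCompactSpace Γτ] [T2Space Γτ] [SecondCountableTopology Γτ]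
  [MeasurableSpace Γτ] [BorelSpace Γτ] [TopologicalSpace X] [LocallyCompactSpace X] [T2Space X]
  [MulAction Γ X] [ContinuousSMul Γ X] [ProperSMul Γ X]
  [MulDistribMulAction S Γ] [MulDistribMulAction S Γτ] [ContinuousSMul S Γτ]
  {E : CentralExtension Γ Γτ} (hE : E.IsLift S) (ν : Measure Γτ) [ν.IsHaarMeasure]

/-- The quotient map is open and `X` is locally compact, so a compact subset of `X/Γ` is covered by
the image of a compact subset of `X`. -/
theorem exists_isCompact_norm_le_of_tendsto {B : Type*} [SeminormedAddCommGroup B] {F : X → B}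
    (hF : Tendsto F (comap (Quotient.mk (MulAction.orbitRel Γ X))
      (cocompact (MulAction.orbitRel.Quotient Γ X))) (𝓝 0)) {ε : ℝ} (hε : 0 < ε) :
    ∃ K : Set X, IsCompact K ∧ ∀ x, (∀ γ : Γ, γ • x ∉ K) → ‖F x‖ ≤ ε := by
  have h1 := (tendsto_zero_iff_norm_tendsto_zero.1 hF).eventually (ge_mem_nhds hε)
  obtain ⟨Q, hQ, hQF⟩ := mem_cocompact.1 (eventually_comap.1 h1)
  choose N hN hNx using fun x : X => exists_compact_mem_nhds x
  have hop : IsOpenMap (Quotient.mk (MulAction.orbitRel Γ X)) := isOpenMap_quotient_mk'_mul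
  obtain ⟨t, ht⟩ := hQ.elim_finite_subcover
    (fun x : X => Quotient.mk (MulAction.orbitRel Γ X) '' interior (N x))
    (fun x => hop _ isOpen_interior) fun q _ => by
      obtain ⟨x, rfl⟩ := Quotient.exists_rep q
      exact Set.mem_iUnion.2 ⟨x, x, mem_interior_iff_mem_nhds.2 (hNx x), rfl⟩
  refine ⟨⋃ x ∈ t, N x, t.finite_toSet.isCompact_biUnion fun x _ => hN x, fun x hx => ?_⟩
  refine hQF (a := Quotient.mk _ x) (fun hxQ => ?_) x rfl
  obtain ⟨y, hy, z, hz, hzx⟩ := Set.mem_iUnion₂.1 (ht hxQ)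
  obtain ⟨γ, hγ⟩ := (Quotient.exact hzx : MulAction.orbitRel Γ X z x)
  refine hx γ (Set.mem_iUnion₂.2 ⟨y, hy, ?_⟩)
  have : γ • x = z := hγ
  rw [this]
  exact interior_subset hz

/-- Approximation of a continuous operator valued function, on the support of a function `χ`. -/
theorem exists_norm_smul_sub_sum_le {H : Type*} [NormedAddCommGroup H] [InnerProductSpace ℂ H]
    {F : X → H →L[ℂ] H} (hF : Continuous F) {χ : X → ℝ} (hχ : Continuous χ)
    (hχc : HasCompactSupport χ) (hχ0 : ∀ x, 0 ≤ χ x) {R : Set (H →L[ℂ] H)}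
    (hR : ∀ x, F x ∈ closure R) {ε : ℝ} (hε : 0 < ε) :
    ∃ (n : ℕ) (φ : Fin n → C₀(X, ℂ)) (T : Fin n → H →L[ℂ] H), (∀ i, T i ∈ R) ∧
      ∀ y, ‖(χ y : ℂ) • F y - ∑ i, φ i y • T i‖ ≤ ε * χ y := by
  have hU : ∀ y : X, IsOpen {z | ‖F z - F y‖ < ε / 2} := fun y =>
    isOpen_lt (hF.sub continuous_const).norm continuous_const
  obtain ⟨t, ht⟩ := hχc.isCompact.elim_finite_subcover (fun y => {z | ‖F z - F y‖ < ε / 2}) hU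
    fun y _ => Set.mem_iUnion.2 ⟨y, by simpa using half_pos hε⟩
  let e := t.equivFin
  -- A partition of unity on the support of `χ`, subordinate to sets where `F` varies by less than
  -- `ε / 2`; the other `ε / 2` is spent on replacing the values at the centres by elements of `R`.
  obtain ⟨ρ, hρs, hρ1, hρ01, -⟩ := exists_continuous_sum_one_of_isOpen_isCompact
    (s := fun i => {z | ‖F z - F (e.symm i).1‖ < ε / 2}) (fun i => hU _) hχc.isCompact
    (fun y hy => by
      obtain ⟨z, hz, hyz⟩ := Set.mem_iUnion₂.1 (ht hy)
      exact Set.mem_iUnion.2 ⟨e ⟨z, hz⟩, by simpa using hyz⟩)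
  choose T hT hTF using fun i => Metric.mem_closure_iff.1 (hR (e.symm i).1) (ε / 2) (half_pos hε)
  let φ : Fin t.card → C₀(X, ℂ) := fun i =>
    { toFun := fun y => ((χ y * ρ i y : ℝ) : ℂ)
      continuous_toFun := Complex.continuous_ofReal.comp (hχ.mul (ρ i).continuous)
      zero_at_infty' := by
        refine HasCompactSupport.is_zero_at_infty (hχc.mono fun y hy h0 => hy ?_)
        simp [h0] }
  refine ⟨t.card, φ, T, hT, fun y => ?_⟩
  by_cases hy : y ∈ tsupport χ
  · have hsum : ∑ i, ρ i y = 1 := by simpa using hρ1 hy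
    have h1 : (χ y : ℂ) • F y - ∑ i, φ i y • T i =
        (χ y : ℂ) • ∑ i, ((ρ i y : ℝ) : ℂ) • (F y - T i) := by
      have h2 : ∑ i, ((ρ i y : ℝ) : ℂ) • F y = F y := by
        rw [← Finset.sum_smul, ← Complex.ofReal_sum, hsum, Complex.ofReal_one, one_smul]
      have h3 : ∀ i, φ i y = (χ y : ℂ) * ((ρ i y : ℝ) : ℂ) := fun i => by
        rw [← Complex.ofReal_mul]
        rfl
      simp only [smul_sub, Finset.sum_sub_distrib, h2, h3, mul_smul, ← Finset.smul_sum]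
    rw [h1, norm_smul, Complex.norm_real, Real.norm_of_nonneg (hχ0 y), mul_comm ε]
    refine mul_le_mul_of_nonneg_left ?_ (hχ0 y)
    calc ‖∑ i, ((ρ i y : ℝ) : ℂ) • (F y - T i)‖ ≤ ∑ i, ρ i y * ε := by
          refine (norm_sum_le _ _).trans (Finset.sum_le_sum fun i _ => ?_)
          rw [norm_smul, Complex.norm_real, Real.norm_of_nonneg (hρ01 i y).1]
          by_cases h0 : ρ i y = 0
          · rw [h0, zero_mul, zero_mul]
          · refine mul_le_mul_of_nonneg_left ?_ (hρ01 i y).1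
            have h2 : ‖F y - F (e.symm i).1‖ < ε / 2 := hρs i (subset_tsupport _ h0)
            have h3 := hTF i
            rw [dist_eq_norm] at h3
            have h4 := norm_sub_le_norm_sub_add_norm_sub (F y) (F (e.symm i).1) (T i)
            linarith
      _ = ε := by rw [← Finset.sum_mul, hsum, one_mul]
  · have h0 : χ y = 0 := image_eq_zero_of_notMem_tsupport hy
    have h1 : ∀ i, φ i y = 0 := fun i => by
      change ((χ y * ρ i y : ℝ) : ℂ) = 0
      simp [h0]
    simp [h0, h1]

/-- Averaging `χ F` returns `F` times the orbit integral of `χ`, and `χ F` is approximated with an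
error proportional to `χ`. The error of the average is therefore at most `ε / 2` times that orbit
integral, uniformly in `x`. -/
theorem exists_norm_sub_integratedForm_le {F : OperatorFunctions X (TwistedL2 E ν)}
    (hF : F ∈ fixedPointAlgebra hE ν X) {ε : ℝ} (hε : 0 < ε) :
    ∃ a : C_c(Γτ, C₀(X, ℂ)), E.IsHomogeneous 1 a ∧
      ∀ x, ‖F x - (fiberPair E ν x).integratedForm ν a‖ ≤ ε := by
  obtain ⟨hFc, hFe, hFt⟩ := hF
  obtain ⟨K, hK, hKF⟩ := exists_isCompact_norm_le_of_tendsto hFt (half_pos hε)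
  obtain ⟨χ, hχ, hχc, hχ0, hχ1, hχK⟩ := exists_integral_orbitMap_eq_one E ν hK
  have hV := TwistedL2.dense_compactlySupported E ν
  obtain ⟨n, φ, T, hT, hφT⟩ := exists_norm_smul_sub_sum_le F.continuous hχ hχc hχ0
    (fun x => (hFc x).mem_closure_span_rankOne hV) (half_pos hε)
  obtain ⟨a, ha, hav⟩ := exists_isAverage_sum hE ν φ T hT
  refine ⟨a, ha, fun x => ContinuousLinearMap.opNorm_le_of_dense_inner hV hε.le
    fun f hf f' hf' => ?_⟩
  obtain ⟨hint, hval⟩ := hav x f hf f' hf'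
  have hχi : Integrable (fun h : Γτ => χ ((E.proj h)⁻¹ • x)) ν :=
    (hχ.comp (continuous_orbitMap E x)).integrable_of_hasCompactSupport
      (hasCompactSupport_comp_orbitMap E hχc x)
  set I := ∫ h, χ ((E.proj h)⁻¹ • x) ∂ν
  have hI0 : 0 ≤ I := integral_nonneg fun _ => hχ0 _
  -- Equivariance makes the conjugated value of `F` along the orbit constant, so it leaves the
  -- average.
  have hFx : ∀ h : Γτ, F x = adRho hE ν (1 : S) h (F ((E.proj h)⁻¹ • x)) := fun h => by
    rw [← hFe, smul_inv_smul]
  have h1 : (I : ℂ) * inner ℂ f' (F x f) =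
      ∫ h, ((χ ((E.proj h)⁻¹ • x) : ℝ) : ℂ) * inner ℂ f' (F x f) ∂ν := by
    rw [integral_mul_const, integral_complex_ofReal]
  have h2 : (I : ℂ) * inner ℂ f' (F x f) - inner ℂ f' ((fiberPair E ν x).integratedForm ν a f) =
      ∫ h, inner ℂ f' (adRho hE ν (1 : S) h (((χ ((E.proj h)⁻¹ • x) : ℝ) : ℂ) •
        F ((E.proj h)⁻¹ • x) - ∑ i, φ i ((E.proj h)⁻¹ • x) • T i) f) ∂ν := by
    have hχi' : Integrable (fun h : Γτ => ((χ ((E.proj h)⁻¹ • x) : ℝ) : ℂ) *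
        inner ℂ f' (F x f)) ν := (hχi.ofReal (𝕜 := ℂ)).mul_const _
    rw [h1, hval, ← integral_sub hχi' hint]
    refine integral_congr_ae (Eventually.of_forall fun h => ?_)
    have e1 : ∀ A B : TwistedL2 E ν →L[ℂ] TwistedL2 E ν,
        adRho hE ν (1 : S) h (A - B) = adRho hE ν (1 : S) h A - adRho hE ν (1 : S) h B :=
      fun A B => by ext1 f; simp [adRho_apply]
    simp only [e1]
    rw [adRho_smul, ← hFx, sub_apply, inner_sub_right, smul_apply, inner_smul_right]
  have h3 : ‖(I : ℂ) * inner ℂ f' (F x f) -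
      inner ℂ f' ((fiberPair E ν x).integratedForm ν a f)‖ ≤ ε / 2 * ‖f‖ * ‖f'‖ := by
    rw [h2]
    refine (norm_integral_le_of_norm_le (hχi.mul_const (ε / 2 * ‖f‖ * ‖f'‖))
      (Eventually.of_forall fun h => ?_)).trans ?_
    · calc _ ≤ ‖f'‖ * ((ε / 2 * χ ((E.proj h)⁻¹ • x)) * ‖f‖) := by
            refine (norm_inner_le_norm _ _).trans ?_
            gcongr
            refine (ContinuousLinearMap.le_opNorm _ _).trans ?_
            gcongr
            exact (norm_adRho_le hE ν 1 h _).trans (hφT _)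
        _ = _ := by ring
    · rw [integral_mul_const]
      have : 0 ≤ ε / 2 * ‖f‖ * ‖f'‖ := by positivity
      exact mul_le_of_le_one_left this (hχ1 x)
  -- The orbit integral is one on orbits meeting `K`; on the others it lies between zero and one and
  -- `F` is at most `ε / 2`.
  have h4 : ‖(1 - I) • F x‖ ≤ ε / 2 := by
    by_cases hx : ∃ γ : Γ, γ • x ∈ K
    · obtain ⟨γ, hγ⟩ := hx
      have : I = 1 := hχK γ x hγ
      rw [this, sub_self, zero_smul, norm_zero]
      positivity
    · push Not at hx
      rw [norm_smul, Real.norm_of_nonneg (sub_nonneg.2 (hχ1 x))]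
      calc _ ≤ 1 * (ε / 2) := by
            gcongr
            · linarith
            · exact hKF x hx
        _ = ε / 2 := one_mul _
  have h5 : inner ℂ f' ((F x - (fiberPair E ν x).integratedForm ν a) f) =
      inner ℂ f' (((1 - I) • F x) f) + ((I : ℂ) * inner ℂ f' (F x f) -
        inner ℂ f' ((fiberPair E ν x).integratedForm ν a f)) := by
    have e2 : ((1 - I) • F x) f = ((1 - I : ℝ) : ℂ) • F x f := rfl
    rw [e2, inner_smul_right, sub_apply, inner_sub_right]
    push_cast
    ring
  rw [h5]
  refine (norm_add_le _ _).trans ?_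
  have h6 : ‖(inner ℂ f' (((1 - I) • F x) f) : ℂ)‖ ≤ ε / 2 * ‖f‖ * ‖f'‖ := by
    refine (norm_inner_le_norm _ _).trans ?_
    rw [mul_comm]
    gcongr
    exact (ContinuousLinearMap.le_opNorm _ _).trans (by gcongr)
  linarith

end DenseRange



/-- Strong continuity of a family of `*`-homomorphisms needs to be checked on a dense set only. -/
theorem continuous_apply_of_mem_closure {P A B : Type*} [TopologicalSpace P]
    [NonUnitalCStarAlgebra A] [NonUnitalCStarAlgebra B] (φ : P → A →⋆ₙₐ[ℂ] B) {D : Set A}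
    (hD : ∀ a ∈ D, Continuous fun s => φ s a) {T : A} (hT : T ∈ closure D) :
    Continuous fun s => φ s T := by
  refine continuous_of_uniform_approx_of_continuous fun u hu => ?_
  obtain ⟨ε, hε, hεu⟩ := Metric.mem_uniformity_dist.1 hu
  obtain ⟨a, ha, hTa⟩ := Metric.mem_closure_iff.1 hT ε hε
  refine ⟨fun s => φ s a, hD a ha, fun s => hεu ?_⟩
  rw [dist_eq_norm, ← map_sub]
  rw [dist_eq_norm] at hTa
  exact (NonUnitalStarAlgHom.norm_apply_le _ _).trans_lt hTa

/-! ### Strong continuity of the action on the crossed product -/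

section StrongContinuity

variable {S : Type v} {Γ : Type*} {Γτ A : Type u} [Group S] [TopologicalSpace S]
  [IsTopologicalGroup S] [LocallyCompactSpace S] [Group Γ] [TopologicalSpace Γ] [Group Γτ]
  [TopologicalSpace Γτ] [IsTopologicalGroup Γτ] [LocallyCompactSpace Γτ]
  [SecondCountableTopology Γτ] [T2Space Γτ] [MeasurableSpace Γτ] [BorelSpace Γτ]
  [NonUnitalCStarAlgebra A] [MulDistribMulAction S Γ] [MulDistribMulAction S Γτ]
  [ContinuousSMul S Γτ] {E : CentralExtension Γ Γτ} (ν : Measure Γτ) [ν.IsHaarMeasure]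
  {α : Γ →* (A ≃⋆ₐ[ℂ] A)} (β : S →* (A ≃⋆ₐ[ℂ] A))

theorem norm_universalForm_sub_le (a b : C_c(Γτ, A)) :
    ‖universalForm (α.comp E.proj) ν a - universalForm (α.comp E.proj) ν b‖ ≤
      ∫ g, ‖a g - b g‖ ∂ν := by
  have h : universalForm (α.comp E.proj) ν a - universalForm (α.comp E.proj) ν b =
      universalForm (α.comp E.proj) ν (a + (-1 : ℂ) • b) := by
    rw [universalForm_add, universalForm_smul, neg_one_smul, sub_eq_add_neg]
  rw [h]
  refine (norm_universalForm_le ν _).trans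
    (le_of_eq (integral_congr_ae (Eventually.of_forall fun g => ?_)))
  change ‖a g + (-1 : ℂ) • b g‖ = ‖a g - b g‖
  rw [neg_one_smul, sub_eq_add_neg]

/-- For `s` in a compact neighbourhood of `s₀` the functions `s · a` share a compact support, so
they converge in `L¹`, and the `L¹` norm dominates the universal norm. -/
theorem continuous_universalForm_actOnFunction (hβ : ∀ a, Continuous fun s => β s a)
    (a : C_c(Γτ, A)) :
    Continuous fun s => universalForm (α.comp E.proj) ν (actOnFunction β s a) := by
  rw [continuous_iff_continuousAt]
  intro s₀
  obtain ⟨N, hN, hN'⟩ := exists_compact_mem_nhds s₀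
  have hc : Continuous fun q : S × Γτ => actOnFunction β q.1 a q.2 :=
    (continuous_uncurry_of_stronglyContinuous hβ).comp
      (continuous_fst.prodMk (a.continuous.comp (continuous_fst.inv.smul continuous_snd)))
  have h0 : ∀ s ∈ N, ∀ g ∉ N • tsupport a, actOnFunction β s a g = 0 := fun s hs g hg => by
    have : s⁻¹ • g ∉ tsupport a := fun h => hg ⟨s, hs, _, h, smul_inv_smul s g⟩
    rw [actOnFunction_apply, image_eq_zero_of_notMem_tsupport this, map_zero]
  have hI : ContinuousOn (fun s => ∫ g, ‖actOnFunction β s a g - actOnFunction β s₀ a g‖ ∂ν) N := by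
    refine continuousOn_integral_of_compact_support (hN.smul_set a.hasCompactSupport.isCompact)
      (Continuous.continuousOn ?_) fun s g hs hg => ?_
    · exact (hc.sub (hc.comp (continuous_const.prodMk continuous_snd))).norm
    · rw [h0 s hs g hg, h0 s₀ (mem_of_mem_nhds hN') g hg, sub_zero, norm_zero]
  have ht := (hI.continuousAt hN').tendsto
  simp only [sub_self, norm_zero, integral_zero] at ht
  exact tendsto_iff_norm_sub_tendsto_zero.2
    (squeeze_zero (fun _ => norm_nonneg _) (fun s => norm_universalForm_sub_le ν _ _) ht)

theorem continuous_universalAct_apply (hE : E.IsLift S)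
    (hν : ∀ s : S, MeasurePreserving (fun g : Γτ => s • g) ν ν)
    (hβα : ∀ s γ a, β s (α γ a) = α (s • γ) (β s a))
    (hα : ∀ a, Continuous fun g => α.comp E.proj g a) (hβ : ∀ a, Continuous fun s => β s a)
    {n : ℤ} {T : UniversalAlgebra (α.comp E.proj)} (hT : T ∈ homogeneousIdeal E ν α n) :
    Continuous fun s => universalAct β (hE.compat β hβα) s T := by
  refine continuous_apply_of_mem_closure _ ?_ (mem_closure_of_mem_homogeneousIdeal ν hα hT)
  rintro _ ⟨a, -, rfl⟩
  simp only [universalAct_universalForm _ _ _ _ (hν _)]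
  exact continuous_universalForm_actOnFunction ν β hβ a

end StrongContinuity

/-- An injective `*`-homomorphism on a closed `*`-subalgebra of a `C*`-algebra is isometric. -/
theorem NonUnitalStarSubalgebra.isometry_of_injective {A D : Type*} [NonUnitalCStarAlgebra A]
    [NonUnitalCStarAlgebra D] {B : NonUnitalStarSubalgebra ℂ A} (hB : IsClosed (B : Set A))
    (φ : B →⋆ₙₐ[ℂ] D) (hφ : Function.Injective φ) : Isometry φ := by
  let : NonUnitalCStarAlgebra B := NonUnitalStarSubalgebra.nonUnitalCStarAlgebra (h_closed := hB) _
  exact NonUnitalStarAlgHom.isometry φ hφ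

/-! ### The isomorphism and strong continuity on the fixed point algebra -/

section Isomorphism

variable {S : Type v} {Γ Γτ X : Type u} [Group S] [TopologicalSpace S]
  [Group Γ] [TopologicalSpace Γ] [IsTopologicalGroup Γ] [LocallyCompactSpace Γ] [T2Space Γ]
  [SecondCountableTopology Γ]
  [Group Γτ] [TopologicalSpace Γτ] [IsTopologicalGroup Γτ] [LocallyCompactSpace Γτ]
  [T2Space Γτ] [SecondCountableTopology Γτ] [MeasurableSpace Γτ] [BorelSpace Γτ]
  [MulDistribMulAction S Γ] [MulDistribMulAction S Γτ] [ContinuousSMul S Γτ]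
  [TopologicalSpace X] [LocallyCompactSpace X] [T2Space X]
  [MulAction Γ X] [ContinuousSMul Γ X] [ProperSMul Γ X] [MulAction S X] [ContinuousSMul S X]
  {E : CentralExtension Γ Γτ} (hE : E.IsLift S) (ν : Measure Γτ) [ν.IsHaarMeasure]

theorem isClosed_twistedCrossedProduct :
    IsClosed (twistedCrossedProduct E ν (translationAct Γ X) :
      Set (UniversalAlgebra ((translationAct Γ X).comp E.proj))) :=
  NonUnitalStarSubalgebra.isClosed_topologicalClosure _

theorem isometry_sectionHom : Isometry (sectionHom (X := X) (E := E) ν) :=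
  NonUnitalStarSubalgebra.isometry_of_injective (isClosed_twistedCrossedProduct ν) _
    (injective_sectionHom ν)

theorem exists_norm_sub_sectionHom_le {F : OperatorFunctions X (TwistedL2 E ν)}
    (hF : F ∈ fixedPointAlgebra hE ν X) {ε : ℝ} (hε : 0 < ε) :
    ∃ T, ‖F - sectionHom ν T‖ ≤ ε := by
  have h := exists_norm_sub_integratedForm_le hE ν hF hε
  exact ⟨toTwistedCrossedProduct E ν (translationAct Γ X) h.choose h.choose_spec.1,
    OperatorFunctions.norm_le hε.le h.choose_spec.2⟩

/-- An isometry from a complete space has closed range, so the uniform approximation by sections of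
functions suffices. -/
theorem exists_sectionHom_eq {F : OperatorFunctions X (TwistedL2 E ν)}
    (hF : F ∈ fixedPointAlgebra hE ν X) : ∃ T, sectionHom ν T = F := by
  have : CompleteSpace (twistedCrossedProduct E ν (translationAct Γ X)) :=
    (isClosed_twistedCrossedProduct ν).completeSpace_coe
  have hcl : IsClosed (Set.range (sectionHom (X := X) (E := E) ν)) :=
    (isometry_sectionHom ν).isClosedEmbedding.isClosed_range
  have hmem : F ∈ closure (Set.range (sectionHom (X := X) (E := E) ν)) := by
    refine Metric.mem_closure_iff.2 fun ε hε => ?_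
    have h := exists_norm_sub_sectionHom_le hE ν hF (half_pos hε)
    exact ⟨_, ⟨h.choose, rfl⟩,
      ((dist_eq_norm F _).trans_le h.choose_spec).trans_lt (half_lt_self hε)⟩
  rwa [hcl.closure_eq] at hmem

/-- The isomorphism `Γ ⋉_τ C₀(X) ≃ C₀(X ×_Γ 𝕂)`. -/
def sectionEquiv :
    twistedCrossedProduct E ν (translationAct Γ X) ≃⋆ₐ[ℂ] fixedPointAlgebra hE ν X :=
  StarAlgEquiv.ofBijective
    (NonUnitalStarAlgHom.codRestrict (sectionHom ν) (fixedPointAlgebra hE ν X)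
      (sectionHom_mem hE ν))
    ⟨fun _ _ h => injective_sectionHom ν (congrArg Subtype.val h), fun F =>
      (exists_sectionHom_eq hE ν F.2).imp fun _ h => Subtype.ext h⟩

/-- Strong continuity of `ρ` is not used: every `F` in the fixed point algebra is the section of
some `T`, and the section map is continuous and equivariant, so the claim follows from the crossed
product. -/
theorem continuous_boundedAct [IsTopologicalGroup S] [LocallyCompactSpace S]
    (hν : ∀ s : S, MeasurePreserving (fun g : Γτ => s • g) ν ν)
    (hX : ∀ (s : S) (γ : Γ) (x : X), s • γ • x = (s • γ) • s • x)
    {F : OperatorFunctions X (TwistedL2 E ν)} (hF : F ∈ fixedPointAlgebra hE ν X) :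
    Continuous fun s : S => boundedAct hE ν s F := by
  obtain ⟨T, rfl⟩ := exists_sectionHom_eq hE ν hF
  have h := continuous_universalAct_apply ν (translationAct S X) hE hν (translationAct_compat hX)
    continuous_translationAct_proj continuous_translationAct T.2
  refine ((isometry_sectionHom ν).continuous.comp (h.subtype_mk fun s =>
    universalAct_mem hE ν hν _ (translationAct_compat hX) 1 s T.2)).congr fun s => ?_
  exact OperatorFunctions.ext fun x =>
    evalFiber_universalAct hE ν hX (homogeneousIdeal_le_crossedProduct _ _ _ _ T.2) x s

end Isomorphism

end

theorem mainTheorem9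
    {S : Type v} {Γ Γτ X : Type u}
    [Group S] [TopologicalSpace S] [IsTopologicalGroup S] [LocallyCompactSpace S] [T2Space S]
    [SecondCountableTopology S]
    [Group Γ] [TopologicalSpace Γ] [IsTopologicalGroup Γ] [LocallyCompactSpace Γ] [T2Space Γ]
    [SecondCountableTopology Γ] [MeasurableSpace Γ] [BorelSpace Γ]
    [Group Γτ] [TopologicalSpace Γτ] [IsTopologicalGroup Γτ] [LocallyCompactSpace Γτ]
    [T2Space Γτ] [SecondCountableTopology Γτ] [MeasurableSpace Γτ] [BorelSpace Γτ]
    -- `S` acts on `Γ`, the action lifts to the central extension `Γτ`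
    [MulDistribMulAction S Γ] [ContinuousSMul S Γ]
    [MulDistribMulAction S Γτ] [ContinuousSMul S Γτ]
    (E : CentralExtension Γ Γτ) (hE : E.IsLift S)
    -- `S` preserves the Haar measure `μ` of `Γ`; `ν` is the normalized Haar measure of `Γτ`
    (μ : Measure Γ) [μ.IsHaarMeasure]
    (hμ : ∀ s : S, MeasurePreserving (fun γ : Γ => s • γ) μ μ)
    (ν : Measure Γτ) [ν.IsHaarMeasure] (hν : ν.map E.proj = μ)
    -- `X` is a locally compact `S ⋉ Γ`-space on which `Γ` acts properly; a continuous action of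
    -- `S ⋉ Γ` is a pair of continuous actions of `S` and `Γ` satisfying `hX`
    [TopologicalSpace X] [LocallyCompactSpace X] [T2Space X]
    [MulAction Γ X] [ContinuousSMul Γ X] [ProperSMul Γ X] [MulAction S X] [ContinuousSMul S X]
    (hX : ∀ (s : S) (γ : Γ) (x : X), s • γ • x = (s • γ) • s • x) :
    -- both sides are `S`-`C*`-algebras
    IsStronglyContinuous (twistedAct hE ν (hE.measurePreserving hμ hν) (translationAct S X)
      (translationAct_compat hX)) ∧
    IsStronglyContinuous (fixedPointAct hE ν hX) ∧
    -- and there is an `S`-equivariant isomorphism, given on functions by Rieffel's formula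
    ∃ Φ : twistedCrossedProduct E ν (translationAct Γ X) ≃⋆ₐ[ℂ] fixedPointAlgebra hE ν X,
      (∀ (s : S) (T : twistedCrossedProduct E ν (translationAct Γ X)),
        Φ (twistedAct hE ν (hE.measurePreserving hμ hν) (translationAct S X)
          (translationAct_compat hX) s T) = fixedPointAct hE ν hX s (Φ T)) ∧
      ∀ (a : C_c(Γτ, C₀(X, ℂ))) (ha : E.IsHomogeneous 1 a) (x : X) (f : TwistedL2 E ν),
        ⇑((Φ (toTwistedCrossedProduct E ν (translationAct Γ X) a ha)).1 x f).toLp =ᵐ[ν]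
          fun g₁ => ∫ g, a g (E.proj g₁ • x) * f.toLp (g⁻¹ * g₁) ∂ν := by
  have hS := hE.measurePreserving hμ hν
  exact ⟨fun T => (continuous_universalAct_apply ν (translationAct S X) hE hS
      (translationAct_compat hX) continuous_translationAct_proj continuous_translationAct
      T.2).subtype_mk _,
    fun F => (continuous_boundedAct hE ν hS hX F.2).subtype_mk _, sectionEquiv hE ν,
    fun s T => Subtype.ext (OperatorFunctions.ext fun x => evalFiber_universalAct hE ν hX
      (homogeneousIdeal_le_crossedProduct _ _ _ _ T.2) x s),
    fun a _ x f => integratedForm_fiberPair_coeFn E ν x a f⟩
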